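/- **Setting.** Let $\mathbb D$ be the unit disc, $\mathbb H=\{(z_1,z_2)\in\mathbb C^2:|z_1|<|z_2|<1\}$ the Hartogs triangle, $dV$ Lebesgue measure, and $du=|w_2|^{-2}\,dV$ on $\mathbb H$. The Bergman kernel of $\mathbb H$, i.e. the kernel of the orthogonal projection of $L^2(\mathbb H)$ onto its subspace of holomorphic functions, is $$K(z;\bar w)=\frac{1}{\pi^2z_2\bar w_2\left(1-\frac{z_1\bar w_1}{z_2\bar w_2}\right)^2(1-z_2\bar w_2)^2}.$$ Put $Pf(z)=\int_{\mathbb H}K(z;\bar w)f(w)\,dV(w)$ and $P^+f(z)=\int_{\mathbb H}|K(z;\bar w)|f(w)\,dV(w)$. For $A,B\subseteq\mathbb D$ let $(A\times B)'=\{w\in\mathbb H:(w_1/w_2,w_2)\in A\times B\}$. *Tents.* For $z\in\mathbb D\setminus\{0\}$ let $T_z=\{w\in\mathbb D:|1-\bar wz/|z||<1-|z|\}$, and $T_0=\mathbb D$. Let $d(0,z)=\operatorname{artanh}|z|$ and $r=\frac12\ln 2$. For a shift $l\in\mathbb R$, $k\ge 0$ and $1\le j\le 2^k$, the kube $K^k_j(l)$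 is the set of $z\in\mathbb D$ with $kr\le d(0,z)<(k+1)r$ and, if $k\ge1$, $z/|z|\in D^k_j(l)=\{e^{2\pi i\theta}:(j-1)2^{-k}+l\le\theta<j2^{-k}+l\}$. Its center is $c^k_j(l)=\tanh\left((k+\tfrac12)r\right)e^{2\pi i((j-1/2)2^{-k}+l)}$ for $k\ge1$, and $c^0_1(l)=0$. The Bergman tree $\mathcal T_l$ consists of these centers, ordered by $c^m_i\ge c^k_j$ if $m\ge k$ and ($k=0$ or $c^m_i/|c^m_i|\in D^k_j(l)$). For $\beta\in\mathcal T_l$ the dyadic tent $\hat K_\beta$ is the union of the kubes with center $\ge\beta$. A finite set $L$ of shifts is *admissible* if there is a constant $c$ such that every $T_z$, $z\in\mathbb D$, is contained in a dyadic tent $\hat K_\beta$, $\beta\in\mathcal T_l$, $l\in L$, with $|\hat K_\beta|\le c|T_z|$. *Weights.* Let $1<p<\infty$ and $p'=p/(p-1)$. For a weight $\mu$ on $\mathbb H$ (positive and locally integrable) put $\nu=|w_2|^{-p'}\mu^{-p'/p}$ and $$[\mu,\nu]_p=\sup_{z_1,z_2\in\mathbb D}\left(\frac{\int_{T'}\mu|w_2|^{2-p}\,du}{u(T')}\right)\left(\frac{\int_{T'}|w_2|^2\nu\,du}{u(T')}\right)^{p-1},\qquad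 T'=(T_{z_1}\times T_{z_2})'.$$ For $m,n\in L$ and a weight $\rho$ let $$\mathcal M_{\mathcal T'_{m,n},\rho}f(w)=\sup_{\beta_1\in\mathcal T_m,\ \beta_2\in\mathcal T_n}\frac{1_{\hat K'_{\beta_1,\beta_2}}(w)}{\int_{\hat K'_{\beta_1,\beta_2}}\rho\,dV}\int_{\hat K'_{\beta_1,\beta_2}}|f|\,\rho\,dV,\qquad \hat K'_{\beta_1,\beta_2}=(\hat K_{\beta_1}\times\hat K_{\beta_2})'.$$ **Statement.** The formula above gives the Bergman kernel of $\mathbb H$, and admissible finite sets of shifts exist. Let $L$ be any admissible finite set of shifts and let $1<p<\infty$. There is a constant $C$, depending only on $L$ and $p$, such that the following holds for every weight $\mu$ on $\mathbb H$. Suppose that $[\mu,\nu]_p<\infty$ and that, for all $m,n\in L$, the norms $\|\mathcal M_{\mathcal T'_{m,n},\nu}\|_{L^p(\mathbb H,\nu dV)}$ and $\|\mathcal M_{\mathcal T'_{m,n},|w_2|^{-p}\mu}\|_{L^{p'}(\mathbb H,|w_2|^{-p}\mu dV)}$ are finite. Then for $f\in L^p(\mathbb H,\mu dV)$ the integrals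 defining $Pf(z)$ and $P^+f(z)$ converge absolutely for every $z\in\mathbb H$, the operators $P$ and $P^+$ are bounded on $L^p(\mathbb H,\mu dV)$, and $$\|P\|_{L^p(\mathbb H,\mu dV)}\le\|P^+\|_{L^p(\mathbb H,\mu dV)}\le C\,\max_{m,n\in L}\left(\|\mathcal M_{\mathcal T'_{m,n},\nu}\|_{L^p(\mathbb H,\nu dV)}\,\|\mathcal M_{\mathcal T'_{m,n},|w_2|^{-p}\mu}\|_{L^{p'}(\mathbb H,|w_2|^{-p}\mu dV)}\right)[\mu,\nu]_p^{\max\{1,\frac1{p-1}\}}.$$ -/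

import Mathlib

open MeasureTheory
open scoped ENNReal NNReal ComplexConjugate

noncomputable section

namespace Hartogs

/-! ### Bergman spaces, projections and kernels -/

/-- `h` is a square-integrable holomorphic function on `Ω ⊆ ℂ²` (values off `Ω` are irrelevant). -/
def MemBergman (Ω : Set (ℂ × ℂ)) (h : ℂ × ℂ → ℂ) : Prop :=
  DifferentiableOn ℂ h Ω ∧ MemLp h 2 (volume.restrict Ω)

/-- `g` is the orthogonal projection of `f ∈ L²(Ω)` onto the Bergman space `A²(Ω)`. -/
def IsBergmanProjection (Ω : Set (ℂ × ℂ)) (f g : ℂ × ℂ → ℂ) : Prop :=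
  MemBergman Ω g ∧ ∀ h, MemBergman Ω h → ∫ z in Ω, (f z - g z) * conj (h z) = 0

/-- `K` (with `K z w` standing for `K_Ω(z; w̄)`) is the Bergman kernel of `Ω`: it is the kernel that
represents the orthogonal projection `L²(Ω) → A²(Ω)` pointwise as an integral operator,
each `w ↦ conj (K z w)` being an element of `A²(Ω)`. -/
structure IsBergmanKernel (Ω : Set (ℂ × ℂ)) (K : ℂ × ℂ → ℂ × ℂ → ℂ) : Prop where
  conj_mem : ∀ z ∈ Ω, MemBergman Ω (fun w => conj (K z w))
  proj : ∀ f : ℂ × ℂ → ℂ, MemLp f 2 (volume.restrict Ω) →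
    IsBergmanProjection Ω f (fun z => ∫ w in Ω, K z w * f w)

/-- The Hartogs triangle `{(z₁, z₂) : |z₁| < |z₂| < 1}`. -/
def triangle : Set (ℂ × ℂ) := {z | ‖z.1‖ < ‖z.2‖ ∧ ‖z.2‖ < 1}

/-- The kernel `K_ℍ(z; w̄) = 1 / (π² z₂ w̄₂ (1 - z₁ w̄₁ / (z₂ w̄₂))² (1 - z₂ w̄₂)²)`. -/
def kernel (z w : ℂ × ℂ) : ℂ :=
  1 / ((Real.pi : ℂ) ^ 2 * z.2 * conj w.2 * (1 - z.1 * conj w.1 / (z.2 * conj w.2)) ^ 2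
    * (1 - z.2 * conj w.2) ^ 2)

/-- The Bergman projection `P` of the Hartogs triangle, as an integral operator. -/
def proj (f : ℂ × ℂ → ℂ) (z : ℂ × ℂ) : ℂ := ∫ w in triangle, kernel z w * f w

/-- The positive Bergman projection `P⁺` of the Hartogs triangle. -/
def projPlus (f : ℂ × ℂ → ℂ) (z : ℂ × ℂ) : ℂ := ∫ w in triangle, (‖kernel z w‖ : ℂ) * f w

/-! ### Operator norms on `Lᵖ` -/

/-- The norm of a (linear or sublinear) operator `T` on `Lᵖ(ω)`: the least `C ∈ [0, ∞]` with
`‖T f‖ₚ ≤ C ‖f‖ₚ` for all `f ∈ Lᵖ(ω)`. -/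
def operatorNorm {F : Type} [ENorm F] (p : ℝ) (ω : Measure (ℂ × ℂ))
    (T : (ℂ × ℂ → ℂ) → (ℂ × ℂ → F)) : ℝ≥0∞ :=
  sInf {C : ℝ≥0∞ | ∀ f : ℂ × ℂ → ℂ, MemLp f (ENNReal.ofReal p) ω →
    eLpNorm (T f) (ENNReal.ofReal p) ω ≤ C * eLpNorm f (ENNReal.ofReal p) ω}

/-- `T` maps `Lᵖ(ω)` to itself with finite operator norm. -/
def IsBoundedOnLp (p : ℝ) (ω : Measure (ℂ × ℂ))
    (T : (ℂ × ℂ → ℂ) → (ℂ × ℂ → ℂ)) : Prop :=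
  (∀ f, MemLp f (ENNReal.ofReal p) ω → MemLp (T f) (ENNReal.ofReal p) ω) ∧
    operatorNorm p ω T < ∞

/-! ### Weights and the two-weight characteristic -/

/-- The measure `ρ dV` on the Hartogs triangle. -/
def weightMeasure (ρ : ℂ × ℂ → ℝ) : Measure (ℂ × ℂ) :=
  (volume.restrict triangle).withDensity (fun z => ENNReal.ofReal (ρ z))

/-- The measure `du = |w₂|⁻² dV` on the Hartogs triangle. -/
def uMeasure : Measure (ℂ × ℂ) := weightMeasure (fun w => (‖w.2‖ ^ 2)⁻¹)

/-- The dual weight `ν = |w₂|^{-p'} μ^{-p'/p}`, where `p' = p / (p - 1)`. -/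
def dualWeight (p : ℝ) (μ : ℂ × ℂ → ℝ) (w : ℂ × ℂ) : ℝ :=
  ‖w.2‖ ^ (-p.conjExponent) * μ w ^ (-p.conjExponent / p)

/-- The Carleson tent `T_z` in the unit disc. -/
def carlesonTent (z : ℂ) : Set ℂ :=
  if z = 0 then Metric.ball 0 1
  else {w ∈ Metric.ball (0 : ℂ) 1 | ‖1 - conj w * (z / (‖z‖ : ℂ))‖ < 1 - ‖z‖}

/-- The subset of the Hartogs triangle induced by `A × B ⊆ 𝔻 × 𝔻`. -/
def induced (A B : Set ℂ) : Set (ℂ × ℂ) := {w ∈ triangle | w.1 / w.2 ∈ A ∧ w.2 ∈ B}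

/-- The characteristic `[μ, ν]_p`: the supremum over the induced Carleson tents `T'` of
`⟨μ |w₂|^{2-p}⟩ (⟨|w₂|² ν⟩)^{p-1}`, the averages over `T'` being taken with respect to `du`. -/
def characteristic (p : ℝ) (μ ν : ℂ × ℂ → ℝ) : ℝ≥0∞ :=
  ⨆ z₁ ∈ Metric.ball (0 : ℂ) 1, ⨆ z₂ ∈ Metric.ball (0 : ℂ) 1,
    (⨍⁻ w in induced (carlesonTent z₁) (carlesonTent z₂),
        ENNReal.ofReal (μ w * ‖w.2‖ ^ (2 - p)) ∂uMeasure) *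
      (⨍⁻ w in induced (carlesonTent z₁) (carlesonTent z₂),
        ENNReal.ofReal (‖w.2‖ ^ 2 * ν w) ∂uMeasure) ^ (p - 1)

/-! ### Bergman trees on the unit disc -/

/-- The Bergman distance on the unit disc, normalized so that `d(0, z) = artanh |z|`. -/
def bergmanDist (z w : ℂ) : ℝ := Real.artanh ‖(z - w) / (1 - conj w * z)‖

/-- The radial step `r = 2⁻¹ ln 2`. -/
def step : ℝ := Real.log 2 / 2

/-- The radial projection onto the circle about `0` of Bergman radius `ρ`. -/
def radialProj (ρ : ℝ) (z : ℂ) : ℂ := (Real.tanh ρ : ℂ) * (z / (‖z‖ : ℂ))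

/-- Indices `(k, j)` of the kubes: generation `k` and position `0 ≤ j < 2ᵏ`. -/
abbrev Index : Type := Σ k : ℕ, Fin (2 ^ k)

/-- The dyadic arc `{e^{2πiθ} : j 2⁻ᵏ + l ≤ θ < (j + 1) 2⁻ᵏ + l}` of the system shifted by `l`. -/
def arc (l : ℝ) (a : Index) : Set ℂ :=
  {ζ | ∃ θ : ℝ, ((a.2 : ℕ) : ℝ) / 2 ^ a.1 + l ≤ θ ∧ θ < (((a.2 : ℕ) : ℝ) + 1) / 2 ^ a.1 + l ∧
    ζ = Complex.exp (2 * Real.pi * θ * Complex.I)}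

/-- The kube of index `a = (k, j)`: `k r ≤ d(0, z) < (k + 1) r`, and the radial projection of `z` to
the circle of radius `k r` lies in the projected arc (no restriction when `k = 0`). -/
def kube (l : ℝ) (a : Index) : Set ℂ :=
  {z ∈ Metric.ball (0 : ℂ) 1 | (a.1 : ℝ) * step ≤ bergmanDist 0 z ∧
    bergmanDist 0 z < ((a.1 : ℝ) + 1) * step ∧
    radialProj (a.1 * step) z ∈ radialProj (a.1 * step) '' arc l a}

/-- The center of a kube, a vertex of the Bergman tree with shift `l`. -/
def center (l : ℝ) (a : Index) : ℂ :=
  if a.1 = 0 then 0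
  else radialProj (((a.1 : ℝ) + 1 / 2) * step)
    (Complex.exp (2 * Real.pi * ((((a.2 : ℕ) : ℝ) + 1 / 2) / 2 ^ a.1 + l : ℝ) * Complex.I))

/-- The tree order: `b` is `a` or a descendant of `a`. -/
def TreeLE (l : ℝ) (a b : Index) : Prop :=
  a.1 ≤ b.1 ∧ radialProj (a.1 * step) (center l b) ∈ radialProj (a.1 * step) '' arc l a

/-- The dyadic tent under the kube of index `a`. -/
def dyadicTent (l : ℝ) (a : Index) : Set ℂ := ⋃ b ∈ {b : Index | TreeLE l a b}, kube l b

/-- A finite collection of Bergman trees (given by their shifts) is admissible if every Carleson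
tent lies in a dyadic tent of comparable area of one of the trees. -/
def IsAdmissible (L : Finset ℝ) : Prop :=
  ∃ c : ℝ≥0, ∀ z ∈ Metric.ball (0 : ℂ) 1, ∃ l ∈ L, ∃ a : Index,
    carlesonTent z ⊆ dyadicTent l a ∧ volume (dyadicTent l a) ≤ c * volume (carlesonTent z)

/-- The weighted dyadic strong maximal operator on the Hartogs triangle for the trees with shifts
`m` and `n` and the weight `ρ`. -/
def maximal (m n : ℝ) (ρ : ℂ × ℂ → ℝ) (f : ℂ × ℂ → ℂ) (w : ℂ × ℂ) : ℝ≥0∞ :=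
  ⨆ (a : Index) (b : Index),
    (induced (dyadicTent m a) (dyadicTent n b)).indicator
      (fun _ => ⨍⁻ z in induced (dyadicTent m a) (dyadicTent n b), ‖f z‖ₑ ∂(weightMeasure ρ)) w

end Hartogs

end

open MeasureTheory
open scoped ENNReal NNReal ComplexConjugate

noncomputable section

namespace Hartogs

/-! ### Change of variables -/

/-! The chart (w₁, w₂) ↦ (w₁w₂, w₂) turns the Hartogs triangle into a product: it carries 𝔻 × (𝔻 \
{0}) onto the triangle, and `uMeasure` is the image of Lebesgue measure on the bidisc
(`uMeasure_eq_map`). Hence h ↦ w₂ · (h ∘ chart) is an L² isometry, and in these coordinates the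
kernel is the product of two disc Bergman kernels divided by z₂ w̄₂.

Kernel. On the disc the reproducing formula comes from Cauchy's formula on circles, integrated in
the radius (`disc_reproducing`). A square-integrable holomorphic function on the punctured disc
extends across 0 (`punctured_reproducing`), so Fubini gives the formula on the triangle
(`triangle_reproducing`). Reproduction together with closedness of the Bergman space in L²
identifies the integral operator with the orthogonal projection (`isBergmanKernel_kernel`).

Trees. A Carleson tent is a disc of radius δ about a boundary point, cut by 𝔻. A dyadic tent of
generation k lies in such a disc of radius 16 · 2⁻ᵏ, and its top kube contains a disc of radius 2⁻ᵏ
/ 6. The one-third trick with shifts 0 and 1/3 then gives admissibility (`exists_isAdmissible`).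

Estimate. Any two points z, w of 𝔻 lie in a tent of area ≲ |1 - z w̄|². So |K(z, w)| is at most a
constant times |z₂|⁻¹ |w₂|⁻¹ / u(T') for some induced dyadic tent T' containing both points
(`exists_tent_bound`). Pairing P⁺|f| with γ μ thus leads to sums over T' of u(T')⁻¹ ∫_{T'} F ν
∫_{T'} G ψ, where ψ = |w₂|⁻ᵖ μ, F = |w₂|⁻¹ |f| / ν and G = |w₂|^{p-1} γ. The passages f ↦ F and γ ↦
G preserve the norms in the respective weighted spaces.

Such a sum is treated as a sparse form. The kube products E ⊆ T' are disjoint with u(T') ≲ u(E), and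
ν^{1/p'} ψ^{1/p} = |w₂|⁻² gives u(E) ≤ ν(E)^{1/p'} ψ(E)^{1/p} by Hölder. For p ≥ 2 this and the
characteristic bound u(T')⁻¹ ν(T') ψ(T') by a multiple of [μ, ν]_p ν(E)^{1/p} ψ(E)^{1/p'}. Hölder
for sums and disjointness of the E then leave the two maximal functions. The case p ≤ 2 follows by
exchanging the roles of ν and ψ, which produces the exponent 1/(p-1) (`SparseFamily.tsum_le`). -/

theorem map_mul_left_volume {c : ℂ} (hc : c ≠ 0) :
    Measure.map (fun z : ℂ => c * z) volume = ENNReal.ofReal ((‖c‖ ^ 2)⁻¹) • volume := by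
  have hdet : LinearMap.det (Algebra.lmul ℝ ℂ c) = ‖c‖ ^ 2 := by
    rw [← Algebra.norm_apply, Algebra.norm_complex_apply, Complex.normSq_eq_norm_sq]
  have h := Measure.map_linearMap_addHaar_eq_smul_addHaar (volume : Measure ℂ)
    (f := Algebra.lmul ℝ ℂ c) (by rw [hdet]; positivity)
  rw [hdet, abs_of_nonneg (by positivity)] at h
  exact h

theorem lintegral_comp_mul_left {c : ℂ} (hc : c ≠ 0) {f : ℂ → ℝ≥0∞} (hf : Measurable f) :
    ∫⁻ z, f (c * z) = ENNReal.ofReal ((‖c‖ ^ 2)⁻¹) * ∫⁻ z, f z := by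
  rw [← lintegral_map hf (measurable_const_mul c), map_mul_left_volume hc, lintegral_smul_measure,
    smul_eq_mul]

theorem isOpen_triangle : IsOpen triangle :=
  (isOpen_lt (f := fun z : ℂ × ℂ => ‖z.1‖) (g := fun z => ‖z.2‖) (by fun_prop) (by fun_prop)).inter
    (isOpen_lt (f := fun z : ℂ × ℂ => ‖z.2‖) (g := fun _ => 1) (by fun_prop) (by fun_prop))

theorem measurableSet_triangle : MeasurableSet triangle := isOpen_triangle.measurableSet

theorem snd_ne_zero {z : ℂ × ℂ} (hz : z ∈ triangle) : z.2 ≠ 0 :=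
  norm_pos_iff.1 ((norm_nonneg _).trans_lt hz.1)

/-- The parametrization of the Hartogs triangle by the bidisc. -/
def chart (w : ℂ × ℂ) : ℂ × ℂ := (w.1 * w.2, w.2)

theorem measurable_chart : Measurable chart := by unfold chart; fun_prop

/-- The unit bidisc. -/
def bidisc : Set (ℂ × ℂ) := Metric.ball 0 1 ×ˢ Metric.ball 0 1

theorem measurableSet_bidisc : MeasurableSet bidisc :=
  Metric.isOpen_ball.measurableSet.prod Metric.isOpen_ball.measurableSet

theorem chart_mem_triangle_iff {w : ℂ × ℂ} (h : w.2 ≠ 0) : chart w ∈ triangle ↔ w ∈ bidisc := by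
  have : 0 < ‖w.2‖ := norm_pos_iff.2 h
  simp only [chart, triangle, bidisc, Set.mem_ofPred_eq, Set.mem_prod, mem_ball_zero_iff, norm_mul]
  rw [mul_lt_iff_lt_one_left this]

/-- On the slice w₂ = y ≠ 0 the chart is the dilation x ↦ y x, whose real Jacobian |y|² is exactly
what the density |y|⁻² compensates. The slice y = 0 is null. -/
theorem uMeasure_eq_map : uMeasure = Measure.map chart (volume.restrict bidisc) := by
  ext S hS
  rw [Measure.map_apply measurable_chart hS, Measure.restrict_apply (measurable_chart hS),
    uMeasure, weightMeasure, withDensity_apply _ hS, Measure.restrict_restrict hS]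
  have hm := hS.inter measurableSet_triangle
  have hm2 := (measurable_chart hS).inter measurableSet_bidisc
  rw [← lintegral_indicator hm, ← lintegral_indicator_one hm2, Measure.volume_eq_prod]
  have hdens : Measurable fun w : ℂ × ℂ => ENNReal.ofReal ((‖w.2‖ ^ 2)⁻¹) := by fun_prop
  rw [lintegral_prod_symm _ (hdens.indicator hm).aemeasurable,
    lintegral_prod_symm _ (measurable_one.indicator hm2).aemeasurable]
  refine lintegral_congr_ae ?_
  have h0 : ∀ᵐ y : ℂ, y ≠ 0 := by simp [ae_iff]
  filter_upwards [h0] with y hy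
  have hsec : MeasurableSet ((fun x : ℂ => (x, y)) ⁻¹' (S ∩ triangle)) :=
    (by fun_prop : Measurable fun x : ℂ => (x, y)) hm
  have e1 : ∀ x : ℂ, (S ∩ triangle).indicator
      (fun w : ℂ × ℂ => ENNReal.ofReal ((‖w.2‖ ^ 2)⁻¹)) (x, y) =
      ENNReal.ofReal ((‖y‖ ^ 2)⁻¹) *
        ((fun x : ℂ => (x, y)) ⁻¹' (S ∩ triangle)).indicator 1 x := by
    intro x
    by_cases hx : (x, y) ∈ S ∩ triangle
    · rw [Set.indicator_of_mem hx, Set.indicator_of_mem (by exact hx)]; simp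
    · rw [Set.indicator_of_notMem hx, Set.indicator_of_notMem (by exact hx)]; simp
  simp_rw [e1]
  rw [lintegral_const_mul _ (measurable_one.indicator hsec),
    ← lintegral_comp_mul_left hy (measurable_one.indicator hsec)]
  refine lintegral_congr fun x => ?_
  have key : (y * x, y) ∈ S ∩ triangle ↔ (x, y) ∈ chart ⁻¹' S ∩ bidisc := by
    rw [Set.mem_inter_iff, Set.mem_inter_iff, ← chart_mem_triangle_iff (w := (x, y)) hy]
    simp only [chart, Set.mem_preimage, mul_comm y x]
  by_cases hx : (x, y) ∈ chart ⁻¹' S ∩ bidisc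
  · rw [Set.indicator_of_mem hx, Set.indicator_of_mem (by exact key.2 hx)]; rfl
  · rw [Set.indicator_of_notMem hx]
    have hx' : y * x ∉ (fun x : ℂ => (x, y)) ⁻¹' (S ∩ triangle) := fun h => hx (key.1 h)
    rw [Set.indicator_of_notMem hx']

theorem measurableSet_induced {A B : Set ℂ} (hA : MeasurableSet A) (hB : MeasurableSet B) :
    MeasurableSet (induced A B) :=
  measurableSet_triangle.inter
    (((measurable_fst.div measurable_snd) hA).inter (measurable_snd hB))

theorem uMeasure_induced {A B : Set ℂ} (hA : MeasurableSet A) (hB : MeasurableSet B)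
    (hA1 : A ⊆ Metric.ball 0 1) (hB1 : B ⊆ Metric.ball 0 1) :
    uMeasure (induced A B) = volume A * volume B := by
  rw [uMeasure_eq_map, Measure.map_apply measurable_chart (measurableSet_induced hA hB),
    Measure.restrict_apply (measurable_chart (measurableSet_induced hA hB)),
    ← Measure.prod_prod, ← Measure.volume_eq_prod]
  refine measure_congr ?_
  have h0 : ∀ᵐ w : ℂ × ℂ, w.2 ≠ 0 := by
    have : ∀ᵐ y : ℂ, y ≠ 0 := by simp [ae_iff]
    exact Measure.quasiMeasurePreserving_snd.ae this
  filter_upwards [h0] with w hw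
  refine propext ?_
  change (chart w ∈ triangle ∧ (w.1 * w.2) / w.2 ∈ A ∧ w.2 ∈ B) ∧ w ∈ bidisc ↔ w ∈ A ×ˢ B
  rw [chart_mem_triangle_iff hw, mul_div_cancel_right₀ _ hw]
  constructor
  · exact fun h => ⟨h.1.2.1, h.1.2.2⟩
  · exact fun h => ⟨⟨⟨hA1 h.1, hB1 h.2⟩, h.1, h.2⟩, hA1 h.1, hB1 h.2⟩

theorem induced_subset_triangle (A B : Set ℂ) : induced A B ⊆ triangle := fun _ h => h.1

theorem induced_mono {A A' B B' : Set ℂ} (hA : A ⊆ A') (hB : B ⊆ B') :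
    induced A B ⊆ induced A' B' := fun _ h => ⟨h.1, hA h.2.1, hB h.2.2⟩

theorem uMeasure_univ_lt_top : uMeasure Set.univ < ∞ := by
  rw [uMeasure_eq_map, Measure.map_apply measurable_chart MeasurableSet.univ, Set.preimage_univ,
    Measure.restrict_apply_univ, bidisc, Measure.volume_eq_prod, Measure.prod_prod]
  exact ENNReal.mul_lt_top measure_ball_lt_top measure_ball_lt_top

/-- Integrals over the Hartogs triangle, in the coordinates of the bidisc. -/
theorem setIntegral_triangle_eq (F : ℂ × ℂ → ℂ)
    (hF : AEStronglyMeasurable F (volume.restrict triangle)) :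
    ∫ w in triangle, F w = ∫ w in bidisc, (‖w.2‖ ^ 2 : ℝ) • F (chart w) := by
  have hu : uMeasure = (volume.restrict triangle).withDensity
      (fun z => ((‖z.2‖₊ ^ 2)⁻¹ : ℝ≥0)) := by
    rw [uMeasure, weightMeasure]
    congr 1; ext z
    rw [ENNReal.ofReal, ENNReal.coe_inj]
    ext; simp
  have hmeas : Measurable fun z : ℂ × ℂ => (‖z.2‖₊ ^ 2)⁻¹ := by fun_prop
  have h1 : ∫ w in triangle, F w = ∫ w, (‖w.2‖ ^ 2 : ℝ) • F w ∂uMeasure := by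
    rw [hu, integral_withDensity_eq_integral_smul hmeas]
    refine setIntegral_congr_fun measurableSet_triangle fun w hw => ?_
    have : ‖w.2‖ ≠ 0 := norm_ne_zero_iff.2 (snd_ne_zero hw)
    simp only [NNReal.smul_def]
    rw [smul_smul]
    simp [this]
  rw [h1, uMeasure_eq_map, integral_map measurable_chart.aemeasurable]
  · rfl
  · rw [← uMeasure_eq_map]
    have hac : uMeasure ≪ volume.restrict triangle := withDensity_absolutelyContinuous _ _
    have hs : Measurable fun w : ℂ × ℂ => (‖w.2‖ ^ 2 : ℝ) := by fun_prop
    exact hs.aestronglyMeasurable.smul (hF.mono_ac hac)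

/-! ### Elementary properties of the kernel -/

theorem conj_kernel (z w : ℂ × ℂ) : conj (kernel z w) = kernel w z := by
  simp only [kernel, map_div₀, map_mul, map_pow, map_sub, map_one, Complex.conj_conj,
    Complex.conj_ofReal]
  congr 1
  ring

theorem norm_kernel (z w : ℂ × ℂ) : ‖kernel z w‖ =
    (Real.pi ^ 2)⁻¹ * ‖z.2‖⁻¹ * ‖w.2‖⁻¹ *
      (‖1 - (z.1 / z.2) * conj (w.1 / w.2)‖ ^ 2)⁻¹ * (‖1 - z.2 * conj w.2‖ ^ 2)⁻¹ := by
  have : z.1 * conj w.1 / (z.2 * conj w.2) = (z.1 / z.2) * conj (w.1 / w.2) := by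
    rw [map_div₀, div_mul_div_comm]
  rw [kernel, this]
  simp only [norm_mul, norm_inv, norm_pow, Complex.norm_real, Complex.norm_conj,
    Real.norm_eq_abs, abs_of_pos Real.pi_pos, one_div, mul_inv]

theorem measurable_kernel : Measurable fun q : (ℂ × ℂ) × (ℂ × ℂ) => kernel q.1 q.2 := by
  unfold kernel; fun_prop

theorem norm_fst_div_snd_lt {z : ℂ × ℂ} (hz : z ∈ triangle) : ‖z.1 / z.2‖ < 1 := by
  rw [norm_div, div_lt_one (norm_pos_iff.2 (snd_ne_zero hz))]
  exact hz.1

theorem one_sub_norm_le {a b : ℂ} (hb : ‖b‖ ≤ 1) : 1 - ‖a‖ ≤ ‖1 - a * conj b‖ := by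
  have h := norm_sub_norm_le (1 : ℂ) (a * conj b)
  rw [norm_one, norm_mul, Complex.norm_conj] at h
  nlinarith [norm_nonneg a]

/-- The factor depending on `z` in a bound of `kernel z w`. -/
def kernelBound (z : ℂ × ℂ) : ℝ :=
  (Real.pi ^ 2)⁻¹ * ‖z.2‖⁻¹ * ((1 - ‖z.1 / z.2‖) ^ 2)⁻¹ * ((1 - ‖z.2‖) ^ 2)⁻¹

/-- For fixed z the only singularity left in w is |w₂|⁻¹. Square-integrability of the kernel,
holomorphy of P f and absolute convergence all rest on this bound. -/
theorem norm_kernel_le {z w : ℂ × ℂ} (hz : z ∈ triangle) (hw : w ∈ triangle) :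
    ‖kernel z w‖ ≤ kernelBound z * ‖w.2‖⁻¹ := by
  have h1 : 0 < 1 - ‖z.1 / z.2‖ := sub_pos.2 (norm_fst_div_snd_lt hz)
  have h2 : 0 < 1 - ‖z.2‖ := sub_pos.2 hz.2
  have h3 := one_sub_norm_le (a := z.1 / z.2) (norm_fst_div_snd_lt hw).le
  have h4 := one_sub_norm_le (a := z.2) hw.2.le
  rw [norm_kernel, kernelBound]
  calc _ ≤ (Real.pi ^ 2)⁻¹ * ‖z.2‖⁻¹ * ‖w.2‖⁻¹ * ((1 - ‖z.1 / z.2‖) ^ 2)⁻¹ *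
        ((1 - ‖z.2‖) ^ 2)⁻¹ := by gcongr
    _ = _ := by ring

theorem continuousOn_kernelBound : ContinuousOn kernelBound triangle := by
  unfold kernelBound
  have h2 : ∀ z ∈ triangle, z.2 ≠ 0 := fun z hz => snd_ne_zero hz
  have h3 : ContinuousOn (fun z : ℂ × ℂ => z.1 / z.2) triangle :=
    continuousOn_fst.div continuousOn_snd h2
  refine ((continuousOn_const.mul (continuousOn_snd.norm.inv₀ fun z hz => ?_)).mul
    (((continuousOn_const.sub h3.norm).pow 2).inv₀ fun z hz => ?_)).mul
    (((continuousOn_const.sub continuousOn_snd.norm).pow 2).inv₀ fun z hz => ?_)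
  · exact norm_ne_zero_iff.2 (h2 z hz)
  · exact pow_ne_zero _ (sub_pos.2 (norm_fst_div_snd_lt hz)).ne'
  · exact pow_ne_zero _ (sub_pos.2 hz.2).ne'

theorem one_sub_mul_conj_ne_zero {a b : ℂ} (ha : ‖a‖ < 1) (hb : ‖b‖ ≤ 1) :
    1 - a * conj b ≠ 0 :=
  norm_pos_iff.1 ((sub_pos.2 ha).trans_le (one_sub_norm_le hb))

theorem differentiableOn_kernel {w : ℂ × ℂ} (hw : w ∈ triangle) :
    DifferentiableOn ℂ (fun z => kernel z w) triangle := by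
  intro z hz
  refine DifferentiableAt.differentiableWithinAt ?_
  have hz2 := snd_ne_zero hz
  have hw2 : conj w.2 ≠ 0 := (map_ne_zero _).2 (snd_ne_zero hw)
  have h1 : 1 - z.1 * conj w.1 / (z.2 * conj w.2) ≠ 0 := by
    have := one_sub_mul_conj_ne_zero (norm_fst_div_snd_lt hz) (norm_fst_div_snd_lt hw).le
    rwa [map_div₀, div_mul_div_comm] at this
  have h2 : 1 - z.2 * conj w.2 ≠ 0 := one_sub_mul_conj_ne_zero hz.2 hw.2.le
  have hpi : (Real.pi : ℂ) ≠ 0 := Complex.ofReal_ne_zero.2 Real.pi_pos.ne'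
  unfold kernel
  have h3 : z.2 * conj w.2 ≠ 0 := mul_ne_zero hz2 hw2
  have h5 : DifferentiableAt ℂ (fun z : ℂ × ℂ => (Real.pi : ℂ) ^ 2 * z.2 * conj w.2 *
      (1 - z.1 * conj w.1 / (z.2 * conj w.2)) ^ 2 * (1 - z.2 * conj w.2) ^ 2) z := by
    fun_prop (disch := assumption)
  simp only [one_div]
  refine h5.fun_inv ?_
  exact mul_ne_zero (mul_ne_zero (mul_ne_zero (mul_ne_zero (pow_ne_zero _ hpi) hz2) hw2)
    (pow_ne_zero _ h1)) (pow_ne_zero _ h2)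

/-- The integral of |w₂|⁻² is the total mass of `uMeasure`, which is the volume of the bidisc. -/
theorem memLp_inv_norm_snd :
    MemLp (fun w : ℂ × ℂ => ‖w.2‖⁻¹) 2 (volume.restrict triangle) := by
  refine ⟨(by fun_prop : Measurable fun w : ℂ × ℂ => ‖w.2‖⁻¹).aestronglyMeasurable, ?_⟩
  rw [eLpNorm_lt_top_iff_lintegral_rpow_enorm_lt_top (by norm_num) (by norm_num)]
  have := uMeasure_univ_lt_top
  rw [uMeasure, weightMeasure, withDensity_apply _ MeasurableSet.univ,
    Measure.restrict_univ] at this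
  convert this using 3 with w
  rw [Real.enorm_eq_ofReal (by positivity), ENNReal.toReal_ofNat,
    ENNReal.ofReal_rpow_of_nonneg (by positivity) (by norm_num)]
  simp

theorem memBergman_kernel {z : ℂ × ℂ} (hz : z ∈ triangle) :
    MemBergman triangle (fun w => conj (kernel z w)) := by
  simp_rw [conj_kernel]
  have hm : Measurable fun w => kernel w z := by unfold kernel; fun_prop
  have hb := memLp_inv_norm_snd.const_mul (kernelBound z)
  refine ⟨differentiableOn_kernel hz, ?_⟩
  have hm' : AEStronglyMeasurable (fun w => kernel w z) (volume.restrict triangle) :=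
    hm.aestronglyMeasurable
  refine hb.of_le hm' ?_
  filter_upwards [ae_restrict_mem measurableSet_triangle] with w hw
  rw [← conj_kernel, Complex.norm_conj]
  exact (norm_kernel_le hz hw).trans (le_abs_self _)

open Metric Set Filter Topology

/-! ### The reproducing formula in the unit disc -/

/-- On |ω| = r one has ω̄ = r²/ω, so 1 - z ω̄ = (ω - r² z)/ω. The integral becomes Cauchy's formula
for the derivative of w g(w) at r² z. -/
theorem circle_reproducing {g : ℂ → ℂ} (hg : DifferentiableOn ℂ g (ball 0 1)) {z : ℂ}
    (hz : z ∈ ball (0 : ℂ) 1) {r : ℝ} (hr0 : 0 < r) (hr1 : r < 1) :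
    ∫ θ in -Real.pi..Real.pi, g (circleMap 0 r θ) / (1 - z * conj (circleMap 0 r θ)) ^ 2 =
      2 * Real.pi * deriv (fun w => w * g w) (r ^ 2 * z) := by
  have hz' : ‖z‖ < 1 := mem_ball_zero_iff.1 hz
  have hper : Function.Periodic
      (fun θ => g (circleMap 0 r θ) / (1 - z * conj (circleMap 0 r θ)) ^ 2) (2 * Real.pi) := by
    intro θ
    simp only [periodic_circleMap 0 r θ]
  have h1 := hper.intervalIntegral_add_eq (-Real.pi) 0
  rw [show -Real.pi + 2 * Real.pi = Real.pi by ring, zero_add] at h1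
  rw [h1]
  have hw : (r ^ 2 * z : ℂ) ∈ ball (0 : ℂ) r := by
    rw [mem_ball_zero_iff, norm_mul, norm_pow, Complex.norm_real, Real.norm_eq_abs,
      abs_of_pos hr0]
    nlinarith [norm_nonneg z]
  have hc := Complex.two_pi_I_inv_smul_circleIntegral_sub_sq_inv_smul_of_differentiable
    (f := fun w => w * g w) isOpen_ball (closedBall_subset_ball hr1)
    (differentiableOn_id.mul hg) hw
  rw [← hc, circleIntegral, smul_eq_mul]
  have hne : (2 * Real.pi * Complex.I : ℂ) ≠ 0 := by
    simp [Real.pi_ne_zero]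
  rw [mul_inv, ← mul_assoc, ← mul_assoc, mul_inv_cancel₀ (by simp [Real.pi_ne_zero]), one_mul,
    ← intervalIntegral.integral_const_mul]
  refine intervalIntegral.integral_congr fun θ _ => ?_
  have hω : circleMap 0 r θ ≠ 0 := circleMap_ne_center hr0.ne'
  set ω := circleMap 0 r θ with hωdef
  have hn : ‖ω‖ = r := by simp [hωdef, abs_of_pos hr0]
  have hcc : ω * conj ω = r ^ 2 := by
    rw [Complex.mul_conj, Complex.normSq_eq_norm_sq, hn]; push_cast; ring
  simp only [deriv_circleMap, smul_eq_mul]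
  rw [← hωdef]
  have e : ω - r ^ 2 * z = ω * (1 - z * conj ω) := by rw [← hcc]; ring
  rw [e, mul_pow, mul_inv, div_eq_mul_inv]
  have : Complex.I⁻¹ * Complex.I = 1 := inv_mul_cancel₀ Complex.I_ne_zero
  field_simp

/-- Supplies the antiderivative of the radial integrand that circle integration leaves in
`disc_reproducing`. -/
theorem hasDerivAt_sq_mul_comp {g : ℂ → ℂ} (hg : DifferentiableOn ℂ g (ball 0 1)) {z : ℂ}
    {r : ℝ} (hr : (r ^ 2 * z : ℂ) ∈ ball (0 : ℂ) 1) :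
    HasDerivAt (fun r : ℝ => (r ^ 2 * g (r ^ 2 * z) : ℂ))
      (2 * r * deriv (fun w => w * g w) (r ^ 2 * z)) r := by
  have hgd : HasDerivAt g (deriv g (r ^ 2 * z)) (r ^ 2 * z) :=
    (hg.differentiableAt (isOpen_ball.mem_nhds hr)).hasDerivAt
  have hG : deriv (fun w => w * g w) (r ^ 2 * z) = g (r ^ 2 * z) +
      r ^ 2 * z * deriv g (r ^ 2 * z) := by
    have := ((hasDerivAt_id _).mul hgd).deriv
    simpa using! this
  have hp : HasDerivAt (fun r : ℂ => r ^ 2) (2 * r) (r : ℂ) := by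
    simpa using hasDerivAt_pow 2 (r : ℂ)
  have hq : HasDerivAt (fun r : ℂ => r ^ 2 * z) (2 * r * z) (r : ℂ) := hp.mul_const z
  have hcomp := HasDerivAt.comp (r : ℂ) (h₂ := g) hgd hq
  have := (hp.mul hcomp).comp_ofReal
  rw [hG]
  convert! this using 1
  simp only [Function.comp]
  ring

theorem integrable_polar {F : ℂ → ℂ} (hF : Measurable F) (hi : Integrable F) :
    IntegrableOn (fun p : ℝ × ℝ => p.1 • F (Complex.polarCoord.symm p)) polarCoord.target := by
  have hs : Measurable fun p : ℝ × ℝ => Complex.polarCoord.symm p := by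
    simp only [Complex.polarCoord_symm_apply]; fun_prop
  refine ⟨(measurable_fst.smul (hF.comp hs)).aestronglyMeasurable, ?_⟩
  have h := Complex.lintegral_comp_polarCoord_symm (fun z => ‖F z‖ₑ)
  have hlt := hi.2
  rw [HasFiniteIntegral, ← h] at hlt
  refine lt_of_eq_of_lt ?_ hlt
  refine setLIntegral_congr_fun polarCoord.open_target.measurableSet fun p hp => ?_
  rw [polarCoord_target] at hp
  simp only [smul_eq_mul, enorm_smul]
  rw [Real.enorm_eq_ofReal (le_of_lt hp.1)]

/-- In polar coordinates the circle integrals, weighted by r, are π times the derivative of r² g(r²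
z). Integrating over 0 < r < 1 leaves the value at r = 1. -/
theorem disc_reproducing {g : ℂ → ℂ} (hg : DifferentiableOn ℂ g (ball 0 1))
    (hi : IntegrableOn g (ball 0 1)) {z : ℂ} (hz : z ∈ ball (0 : ℂ) 1) :
    ∫ w in ball (0 : ℂ) 1, g w / (1 - z * conj w) ^ 2 = Real.pi * g z := by
  have hz' : ‖z‖ < 1 := mem_ball_zero_iff.1 hz
  set F : ℂ → ℂ := (ball (0 : ℂ) 1).indicator fun w => g w / (1 - z * conj w) ^ 2 with hFdef
  have hne : ∀ w ∈ ball (0 : ℂ) 1, 1 - z * conj w ≠ 0 := fun w hw =>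
    one_sub_mul_conj_ne_zero hz' (mem_ball_zero_iff.1 hw).le
  have hcont : ContinuousOn (fun w => g w / (1 - z * conj w) ^ 2) (ball (0 : ℂ) 1) :=
    hg.continuousOn.div (by fun_prop) fun w hw => pow_ne_zero _ (hne w hw)
  have hFm : Measurable F := by
    classical
    have := ContinuousOn.measurable_piecewise hcont
      (continuousOn_const (c := (0 : ℂ))) (isOpen_ball (x := (0 : ℂ)) (ε := 1)).measurableSet
    rwa [show (fun _ : ℂ => (0 : ℂ)) = 0 from rfl, Set.piecewise_eq_indicator] at this
  have hFon : IntegrableOn (fun w => g w / (1 - z * conj w) ^ 2) (ball (0 : ℂ) 1) := by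
    refine Integrable.mono' (hi.norm.const_mul ((1 - ‖z‖) ^ 2)⁻¹)
      (hcont.aestronglyMeasurable isOpen_ball.measurableSet) ?_
    filter_upwards [ae_restrict_mem isOpen_ball.measurableSet] with w hw
    have h1 : 0 < 1 - ‖z‖ := sub_pos.2 hz'
    have h2 := one_sub_norm_le (a := z) (mem_ball_zero_iff.1 hw).le
    rw [norm_div, norm_pow, div_eq_inv_mul]
    gcongr
  have hFi : Integrable F := hFon.integrable_indicator isOpen_ball.measurableSet
  have hpol := integrable_polar hFm hFi
  rw [← integral_indicator isOpen_ball.measurableSet, ← hFdef,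
    ← Complex.integral_comp_polarCoord_symm]
  rw [polarCoord_target, Measure.volume_eq_prod] at *
  rw [setIntegral_prod _ hpol]
  have hpos : ∀ r ∈ Ioi (0 : ℝ), ∫ θ in Ioo (-Real.pi) Real.pi,
      r • F (Complex.polarCoord.symm (r, θ)) =
      (Iio (1 : ℝ)).indicator
        (fun r : ℝ => Real.pi * (2 * r * deriv (fun w => w * g w) (r ^ 2 * z))) r := by
    intro r hr
    have hsymm : ∀ θ, Complex.polarCoord.symm (r, θ) = circleMap 0 r θ := fun θ => by
      rw [Complex.polarCoord_symm_apply, circleMap, zero_add, Complex.exp_mul_I]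
      push_cast; ring
    have hnorm : ∀ θ, ‖circleMap 0 r θ‖ = r := fun θ => by simp [abs_of_pos (mem_Ioi.1 hr)]
    simp_rw [hsymm]
    by_cases h1 : r < 1
    · rw [indicator_of_mem (mem_Iio.2 h1)]
      have : ∀ θ, F (circleMap 0 r θ) = g (circleMap 0 r θ) /
          (1 - z * conj (circleMap 0 r θ)) ^ 2 := fun θ =>
        indicator_of_mem (by rw [mem_ball_zero_iff, hnorm]; exact h1) _
      simp_rw [this]
      rw [integral_smul, ← integral_Ioc_eq_integral_Ioo,
        ← intervalIntegral.integral_of_le (by linarith [Real.pi_pos]),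
        circle_reproducing hg hz hr h1, Complex.real_smul]
      ring
    · rw [indicator_of_notMem (by simpa using h1)]
      have : ∀ θ, F (circleMap 0 r θ) = 0 := fun θ =>
        indicator_of_notMem (by rw [mem_ball_zero_iff, hnorm]; exact h1) _
      simp [this]
  rw [setIntegral_congr_fun measurableSet_Ioi hpos, setIntegral_indicator measurableSet_Iio,
    Ioi_inter_Iio, ← integral_Ioc_eq_integral_Ioo,
    ← intervalIntegral.integral_of_le zero_le_one, intervalIntegral.integral_const_mul]
  have hmem : ∀ r ∈ uIcc (0 : ℝ) 1, (r ^ 2 * z : ℂ) ∈ ball (0 : ℂ) 1 := by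
    intro r hr
    rw [uIcc_of_le zero_le_one] at hr
    rw [mem_ball_zero_iff, norm_mul, norm_pow, Complex.norm_real, Real.norm_eq_abs,
      abs_of_nonneg hr.1]
    have : r ^ 2 ≤ 1 := pow_le_one₀ hr.1 hr.2
    nlinarith [norm_nonneg z]
  rw [intervalIntegral.integral_eq_sub_of_hasDerivAt
    (fun r hr => hasDerivAt_sq_mul_comp hg (hmem r hr))]
  · simp
  · refine ContinuousOn.intervalIntegrable ?_
    have hd : ContinuousOn (deriv fun w => w * g w) (ball (0 : ℂ) 1) :=
      ((differentiableOn_id.mul hg).deriv isOpen_ball).continuousOn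
    exact ContinuousOn.mul (by fun_prop)
      (hd.comp (f := fun r : ℝ => (r ^ 2 * z : ℂ)) (by fun_prop) hmem)

/-! ### Point evaluation in L² and the removable puncture. -/

theorem sq_lintegral_le {α : Type*} [MeasurableSpace α] {μ : Measure α} {f : α → ℝ≥0∞}
    (hf : AEMeasurable f μ) : (∫⁻ x, f x ∂μ) ^ 2 ≤ μ univ * ∫⁻ x, f x ^ 2 ∂μ := by
  have h := ENNReal.lintegral_mul_le_Lp_mul_Lq μ Real.HolderConjugate.two_two hf
    (aemeasurable_const (b := (1 : ℝ≥0∞)))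
  simp only [Pi.mul_apply, mul_one, lintegral_const, ENNReal.rpow_two, one_pow, one_mul] at h
  calc (∫⁻ x, f x ∂μ) ^ 2
      ≤ ((∫⁻ x, f x ^ 2 ∂μ) ^ (1 / 2 : ℝ) * (μ univ) ^ (1 / 2 : ℝ)) ^ 2 := by gcongr
    _ = μ univ * ∫⁻ x, f x ^ 2 ∂μ := by
      rw [mul_pow, ← ENNReal.rpow_two, ← ENNReal.rpow_two, ← ENNReal.rpow_mul,
        ← ENNReal.rpow_mul]
      norm_num [mul_comm]

theorem integrableOn_of_lintegral_sq {g : ℂ → ℂ} {s : Set ℂ} (hs : volume s < ∞)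
    (hg : AEStronglyMeasurable g (volume.restrict s)) (h2 : ∫⁻ w in s, ‖g w‖ₑ ^ 2 < ∞) :
    IntegrableOn g s := by
  refine ⟨hg, ?_⟩
  have h := sq_lintegral_le hg.enorm
  rw [Measure.restrict_apply_univ] at h
  have h3 := h.trans_lt (ENNReal.mul_lt_top hs h2)
  exact (ENNReal.pow_lt_top_iff.1 h3).resolve_right (by norm_num)

/-- Boundedness of point evaluation, from the reproducing formula and Cauchy–Schwarz; the constant
is not sharp. -/
theorem enorm_sq_le_lintegral {g : ℂ → ℂ} (hg : DifferentiableOn ℂ g (ball 0 1)) {z : ℂ}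
    (hz : z ∈ ball (0 : ℂ) 1) :
    ‖g z‖ₑ ^ 2 ≤ (ENNReal.ofReal ((1 - ‖z‖) ^ 2)⁻¹) ^ 2 *
      ∫⁻ w in ball (0 : ℂ) 1, ‖g w‖ₑ ^ 2 := by
  have h1 : 0 < 1 - ‖z‖ := sub_pos.2 (mem_ball_zero_iff.1 hz)
  have hc : ENNReal.ofReal ((1 - ‖z‖) ^ 2)⁻¹ ≠ 0 := by
    rw [ne_eq, ENNReal.ofReal_eq_zero, not_le]; positivity
  rcases eq_or_ne (∫⁻ w in ball (0 : ℂ) 1, ‖g w‖ₑ ^ 2) ∞ with h | h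
  · rw [h, ENNReal.mul_top (pow_ne_zero _ hc)]; exact le_top
  have hm : AEStronglyMeasurable g (volume.restrict (ball (0 : ℂ) 1)) :=
    hg.continuousOn.aestronglyMeasurable isOpen_ball.measurableSet
  have hi := integrableOn_of_lintegral_sq measure_ball_lt_top hm h.lt_top
  have hrep := disc_reproducing hg hi hz
  have hpi : ENNReal.ofReal Real.pi ≠ 0 := by
    rw [ne_eq, ENNReal.ofReal_eq_zero, not_le]; exact Real.pi_pos
  have hvol : volume (ball (0 : ℂ) 1) = ENNReal.ofReal Real.pi := by
    rw [Complex.volume_ball]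
    rw [ENNReal.ofReal_one, one_pow, one_mul, ← NNReal.coe_real_pi, ENNReal.ofReal_coe_nnreal]
  have hle : ENNReal.ofReal Real.pi * ‖g z‖ₑ ≤
      ENNReal.ofReal ((1 - ‖z‖) ^ 2)⁻¹ * ∫⁻ w in ball (0 : ℂ) 1, ‖g w‖ₑ := by
    have : ENNReal.ofReal Real.pi * ‖g z‖ₑ = ‖(Real.pi : ℂ) * g z‖ₑ := by
      rw [enorm_mul]
      congr 1
      rw [← ofReal_norm, Complex.norm_real, Real.norm_eq_abs, abs_of_pos Real.pi_pos]
    rw [this, ← hrep, ← lintegral_const_mul'' _ hm.enorm]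
    refine (enorm_integral_le_lintegral_enorm _).trans
      (setLIntegral_mono_ae' isOpen_ball.measurableSet (ae_of_all _ fun w hw => ?_))
    have h2 := one_sub_norm_le (a := z) (mem_ball_zero_iff.1 hw).le
    rw [← ofReal_norm, ← ofReal_norm, ← ENNReal.ofReal_mul (by positivity)]
    refine ENNReal.ofReal_le_ofReal ?_
    rw [norm_div, norm_pow, div_eq_inv_mul]
    gcongr
  have h3 := sq_lintegral_le hm.enorm
  rw [Measure.restrict_apply_univ, hvol] at h3
  have h4 : ENNReal.ofReal Real.pi ^ 2 * ‖g z‖ₑ ^ 2 ≤ ENNReal.ofReal Real.pi ^ 2 *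
      ((ENNReal.ofReal ((1 - ‖z‖) ^ 2)⁻¹) ^ 2 * ∫⁻ w in ball (0 : ℂ) 1, ‖g w‖ₑ ^ 2) := by
    calc ENNReal.ofReal Real.pi ^ 2 * ‖g z‖ₑ ^ 2 = (ENNReal.ofReal Real.pi * ‖g z‖ₑ) ^ 2 := by
          rw [mul_pow]
      _ ≤ (ENNReal.ofReal ((1 - ‖z‖) ^ 2)⁻¹ * ∫⁻ w in ball (0 : ℂ) 1, ‖g w‖ₑ) ^ 2 := by gcongr
      _ ≤ (ENNReal.ofReal ((1 - ‖z‖) ^ 2)⁻¹) ^ 2 *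
          (ENNReal.ofReal Real.pi * ∫⁻ w in ball (0 : ℂ) 1, ‖g w‖ₑ ^ 2) := by
        rw [mul_pow]; gcongr
      -- Cauchy–Schwarz gives a factor π; enlarging it to π² lets it cancel against the left side.
      _ ≤ (ENNReal.ofReal ((1 - ‖z‖) ^ 2)⁻¹) ^ 2 *
          (ENNReal.ofReal Real.pi ^ 2 * ∫⁻ w in ball (0 : ℂ) 1, ‖g w‖ₑ ^ 2) := by
        gcongr
        rw [sq]
        refine le_mul_of_one_le_left' ?_
        rw [ENNReal.one_le_ofReal]
        linarith [Real.pi_gt_three]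
      _ = _ := by ring
  exact (ENNReal.mul_le_mul_iff_right (pow_ne_zero _ hpi)
    (ENNReal.pow_ne_top ENNReal.ofReal_ne_top)).1 h4

/-- The disc of centre w and radius |w| avoids 0, so point evaluation applies to u ↦ g(w(1 + u)) at
u = 0. The integral runs over a disc shrinking to 0, so for square-integrable g it forces |w| |g(w)|
→ 0. -/
theorem punctured_pointwise_bound {g : ℂ → ℂ} (hg : DifferentiableOn ℂ g (ball 0 1 \ {0}))
    {w : ℂ} (hw : w ≠ 0) (hw2 : ‖w‖ < 1 / 2) :
    ‖w‖ₑ ^ 2 * ‖g w‖ₑ ^ 2 ≤ ∫⁻ u in ball (0 : ℂ) 1 ∩ ball 0 (2 * ‖w‖), ‖g u‖ₑ ^ 2 := by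
  have hw0 : 0 < ‖w‖ := norm_pos_iff.2 hw
  have hmaps : ∀ u ∈ ball (0 : ℂ) 1, w * (1 + u) ∈ ball (0 : ℂ) 1 \ {0} := by
    intro u hu
    have hu' : ‖u‖ < 1 := mem_ball_zero_iff.1 hu
    refine ⟨?_, ?_⟩
    · rw [mem_ball_zero_iff, norm_mul]
      have : ‖1 + u‖ ≤ 1 + ‖u‖ := (norm_add_le _ _).trans (by simp)
      nlinarith [norm_nonneg (1 + u)]
    · rw [mem_singleton_iff, mul_eq_zero, not_or]
      refine ⟨hw, fun h => ?_⟩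
      rw [add_comm, add_eq_zero_iff_eq_neg] at h
      simp [h] at hu'
  have hd : DifferentiableOn ℂ (fun u => g (w * (1 + u))) (ball 0 1) :=
    hg.comp (by fun_prop) hmaps
  have h := enorm_sq_le_lintegral hd (mem_ball_self one_pos)
  simp only [add_zero, mul_one, norm_zero, sub_zero, one_pow, inv_one, ENNReal.ofReal_one,
    one_mul] at h
  have hcont : ContinuousOn (fun u => ‖g u‖ₑ ^ 2) (ball (0 : ℂ) 1 \ {0}) :=
    (ENNReal.continuous_pow 2).comp_continuousOn hg.continuousOn.enorm
  set A : Set ℂ := (ball (0 : ℂ) 1 ∩ ball 0 (2 * ‖w‖)) \ {0} with hA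
  have hAo : IsOpen A := (isOpen_ball.inter isOpen_ball).sdiff isClosed_singleton
  have hmeas : Measurable (A.indicator fun u => ‖g u‖ₑ ^ 2) := by
    classical
    have := ContinuousOn.measurable_piecewise (s := A)
      (hcont.mono fun x hx => ⟨hx.1.1, hx.2⟩)
      (continuousOn_const (c := (0 : ℝ≥0∞))) hAo.measurableSet
    rwa [show (fun _ : ℂ => (0 : ℝ≥0∞)) = 0 from rfl, Set.piecewise_eq_indicator] at this
  have h1 : ∫⁻ u in ball (0 : ℂ) 1, ‖g (w * (1 + u))‖ₑ ^ 2 ≤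
      ENNReal.ofReal ((‖w‖ ^ 2)⁻¹) *
        ∫⁻ u in ball (0 : ℂ) 1 ∩ ball 0 (2 * ‖w‖), ‖g u‖ₑ ^ 2 := by
    calc ∫⁻ u in ball (0 : ℂ) 1, ‖g (w * (1 + u))‖ₑ ^ 2
        ≤ ∫⁻ u, A.indicator (fun u => ‖g u‖ₑ ^ 2) (w * (1 + u)) := by
          refine le_trans (le_of_eq ?_) (setLIntegral_le_lintegral (ball (0 : ℂ) 1) _)
          refine setLIntegral_congr_fun isOpen_ball.measurableSet fun u hu => ?_
          have hmem : w * (1 + u) ∈ A := by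
            refine ⟨⟨(hmaps u hu).1, ?_⟩, (hmaps u hu).2⟩
            rw [mem_ball_zero_iff, norm_mul, mul_comm]
            have : ‖1 + u‖ < 2 := by
              have h5 : ‖1 + u‖ ≤ 1 + ‖u‖ := (norm_add_le _ _).trans (by simp)
              linarith [mem_ball_zero_iff.1 hu]
            gcongr
          rw [indicator_of_mem hmem]
      _ = ∫⁻ u, A.indicator (fun u => ‖g u‖ₑ ^ 2) (w * u) :=
          lintegral_add_left_eq_self (fun u => A.indicator (fun u => ‖g u‖ₑ ^ 2) (w * u)) 1
      _ = ENNReal.ofReal ((‖w‖ ^ 2)⁻¹) * ∫⁻ u in A, ‖g u‖ₑ ^ 2 := by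
          rw [lintegral_comp_mul_left hw hmeas, lintegral_indicator hAo.measurableSet]
      _ ≤ _ := by
          gcongr
          exact sdiff_subset
  calc ‖w‖ₑ ^ 2 * ‖g w‖ₑ ^ 2 ≤ ‖w‖ₑ ^ 2 * (ENNReal.ofReal ((‖w‖ ^ 2)⁻¹) *
        ∫⁻ u in ball (0 : ℂ) 1 ∩ ball 0 (2 * ‖w‖), ‖g u‖ₑ ^ 2) := by
        gcongr; exact h.trans h1
    _ = _ := by
      rw [← mul_assoc, ← ofReal_norm, ← ENNReal.ofReal_pow (norm_nonneg _),
        ← ENNReal.ofReal_mul (by positivity), mul_inv_cancel₀ (by positivity),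
        ENNReal.ofReal_one, one_mul]

/-- The reproducing formula for square-integrable holomorphic functions on the punctured disc. -/
theorem punctured_reproducing {g : ℂ → ℂ} (hg : DifferentiableOn ℂ g (ball 0 1 \ {0}))
    (h2 : ∫⁻ w in ball (0 : ℂ) 1, ‖g w‖ₑ ^ 2 < ∞) {z : ℂ} (hz : z ∈ ball (0 : ℂ) 1)
    (hz0 : z ≠ 0) :
    ∫ w in ball (0 : ℂ) 1, g w / (1 - z * conj w) ^ 2 = Real.pi * g z := by
  have hlim : Tendsto (fun w : ℂ => ∫⁻ u in ball (0 : ℂ) 1 ∩ ball 0 (2 * ‖w‖), ‖g u‖ₑ ^ 2)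
      (𝓝 0) (𝓝 0) := by
    have hmu : Tendsto (fun w : ℂ => volume.restrict (ball (0 : ℂ) 1) (ball 0 (2 * ‖w‖))) (𝓝 0)
        (𝓝 0) := by
      refine tendsto_of_tendsto_of_tendsto_of_le_of_le tendsto_const_nhds ?_
        (fun _ => zero_le) (fun w => Measure.restrict_apply_le _ _)
      simp_rw [Complex.volume_ball]
      have : Tendsto (fun w : ℂ => ENNReal.ofReal (2 * ‖w‖)) (𝓝 0) (𝓝 0) := by
        have h : Continuous fun w : ℂ => ENNReal.ofReal (2 * ‖w‖) :=
          ENNReal.continuous_ofReal.comp (by fun_prop)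
        simpa using h.tendsto 0
      have h3 := ENNReal.Tendsto.mul_const (b := (NNReal.pi : ℝ≥0∞))
        ((ENNReal.continuous_pow 2).tendsto 0 |>.comp this) (Or.inr ENNReal.coe_ne_top)
      simpa using h3
    have := tendsto_setLIntegral_zero h2.ne hmu
    refine this.congr fun w => ?_
    rw [Measure.restrict_restrict isOpen_ball.measurableSet, inter_comm]
  have ho : (fun w => g w) =o[𝓝[≠] (0 : ℂ)] fun w => (w - 0)⁻¹ := by
    rw [Asymptotics.isLittleO_iff]
    intro c hc
    have hev : ∀ᶠ w in 𝓝[≠] (0 : ℂ),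
        ∫⁻ u in ball (0 : ℂ) 1 ∩ ball 0 (2 * ‖w‖), ‖g u‖ₑ ^ 2 < ENNReal.ofReal (c ^ 2) :=
      nhdsWithin_le_nhds (hlim.eventually (gt_mem_nhds (by
        rw [ENNReal.ofReal_pos]; positivity)))
    have hev2 : ∀ᶠ w in 𝓝[≠] (0 : ℂ), ‖w‖ < 1 / 2 :=
      nhdsWithin_le_nhds (by
        filter_upwards [ball_mem_nhds (0 : ℂ) (by norm_num : (0 : ℝ) < 1 / 2)] with w hw
        exact mem_ball_zero_iff.1 hw)
    filter_upwards [hev, hev2, self_mem_nhdsWithin] with w h1 h3 h4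
    have h5 := (punctured_pointwise_bound hg h4 h3).trans h1.le
    rw [← mul_pow, ← ofReal_norm, ← ofReal_norm, ← ENNReal.ofReal_mul (norm_nonneg _),
      ← ENNReal.ofReal_pow (by positivity), ENNReal.ofReal_le_ofReal_iff (by positivity)] at h5
    have h6 := abs_le_of_sq_le_sq h5 hc.le
    rw [sub_zero, norm_inv, ← div_eq_mul_inv, le_div_iff₀ (norm_pos_iff.2 h4), mul_comm]
    exact (le_abs_self _).trans h6
  -- The removable-singularity criterion is applied to `g - g 0`; the value `g 0` is arbitrary, but
  -- a constant is also o(1/|w|).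
  have hconst : (fun _ : ℂ => g 0) =o[𝓝[≠] (0 : ℂ)] fun w => (w - 0)⁻¹ := by
    refine (Asymptotics.isLittleO_const_left).2 (Or.inr ?_)
    simp only [sub_zero]
    exact tendsto_norm_inv_nhdsNE_zero_atTop
  have hext := Complex.differentiableOn_update_limUnder_of_isLittleO
    (ball_mem_nhds (0 : ℂ) one_pos) hg (ho.sub hconst)
  set G := Function.update g 0 (limUnder (𝓝[≠] 0) g) with hG
  have hGg : ∀ w, w ≠ 0 → G w = g w := fun w hw => Function.update_of_ne hw _ _
  have hae : ∀ᵐ w : ℂ ∂(volume.restrict (ball (0 : ℂ) 1)), G w = g w := by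
    have h0 : ∀ᵐ w : ℂ, w ≠ 0 := by simp [ae_iff]
    filter_upwards [ae_restrict_of_ae h0] with w hw using hGg w hw
  have h2' : ∫⁻ w in ball (0 : ℂ) 1, ‖G w‖ₑ ^ 2 < ∞ := by
    rwa [lintegral_congr_ae (hae.mono fun w hw => by rw [hw])]
  have hGi := integrableOn_of_lintegral_sq measure_ball_lt_top
    (hext.continuousOn.aestronglyMeasurable isOpen_ball.measurableSet) h2'
  rw [← hGg z hz0, ← disc_reproducing hext hGi hz]
  exact integral_congr_ae (hae.mono fun w hw => by simp only [hw])

/-! ### The reproducing formula on the Hartogs triangle -/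

theorem restrict_bidisc : (volume : Measure (ℂ × ℂ)).restrict bidisc =
    (volume.restrict (ball (0 : ℂ) 1)).prod (volume.restrict (ball (0 : ℂ) 1)) := by
  rw [Measure.prod_restrict, Measure.volume_eq_prod, bidisc]

theorem ae_ball_ne_zero : ∀ᵐ w : ℂ ∂(volume.restrict (ball (0 : ℂ) 1)),
    w ∈ ball (0 : ℂ) 1 ∧ w ≠ 0 := by
  have h0 : ∀ᵐ w : ℂ, w ≠ 0 := by simp [ae_iff]
  filter_upwards [ae_restrict_mem isOpen_ball.measurableSet, ae_restrict_of_ae h0] with w h1 h2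
    using ⟨h1, h2⟩

/-- Fubini: the disc formula in the first variable on almost every slice, then the punctured formula
in the second. Holomorphy at w₂ = 0 is not available in advance, since G will be w₂ · (h ∘ chart).
-/
theorem bidisc_reproducing {G : ℂ × ℂ → ℂ}
    (hG1 : ∀ y ∈ ball (0 : ℂ) 1, y ≠ 0 → DifferentiableOn ℂ (fun x => G (x, y)) (ball 0 1))
    (hG2 : ∀ x ∈ ball (0 : ℂ) 1, DifferentiableOn ℂ (fun y => G (x, y)) (ball 0 1 \ {0}))
    (hm : AEStronglyMeasurable G (volume.restrict bidisc))
    (h2 : ∫⁻ w in bidisc, ‖G w‖ₑ ^ 2 < ∞) {a b : ℂ} (ha : a ∈ ball (0 : ℂ) 1)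
    (hb : b ∈ ball (0 : ℂ) 1) (hb0 : b ≠ 0) :
    ∫ w in bidisc, G w / ((1 - a * conj w.1) ^ 2 * (1 - b * conj w.2) ^ 2) =
      Real.pi ^ 2 * G (a, b) := by
  have hsq : MemLp G 2 (volume.restrict bidisc) := by
    refine ⟨hm, ?_⟩
    rw [eLpNorm_lt_top_iff_lintegral_rpow_enorm_lt_top (by norm_num) (by norm_num)]
    simpa using h2
  have hfin : IsFiniteMeasure ((volume : Measure (ℂ × ℂ)).restrict bidisc) := by
    rw [restrict_bidisc]
    have : IsFiniteMeasure ((volume : Measure ℂ).restrict (ball (0 : ℂ) 1)) :=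
      ⟨by rw [Measure.restrict_apply_univ]; exact measure_ball_lt_top⟩
    infer_instance
  have hGi : Integrable G (volume.restrict bidisc) := hsq.integrable (by norm_num)
  have ha' : 0 < 1 - ‖a‖ := sub_pos.2 (mem_ball_zero_iff.1 ha)
  have hb' : 0 < 1 - ‖b‖ := sub_pos.2 (mem_ball_zero_iff.1 hb)
  have hFi : Integrable
      (fun w : ℂ × ℂ => G w / ((1 - a * conj w.1) ^ 2 * (1 - b * conj w.2) ^ 2))
      (volume.restrict bidisc) := by
    have hk : Measurable fun w : ℂ × ℂ => ((1 - a * conj w.1) ^ 2 * (1 - b * conj w.2) ^ 2)⁻¹ := by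
      fun_prop
    refine Integrable.mono' (hGi.norm.const_mul (((1 - ‖a‖) ^ 2 * (1 - ‖b‖) ^ 2)⁻¹))
      (by simp_rw [div_eq_mul_inv]; exact hm.mul hk.aestronglyMeasurable) ?_
    filter_upwards [ae_restrict_mem measurableSet_bidisc] with w hw
    have e1 := one_sub_norm_le (a := a) (mem_ball_zero_iff.1 hw.1).le
    have e2 := one_sub_norm_le (a := b) (mem_ball_zero_iff.1 hw.2).le
    rw [norm_div, norm_mul, norm_pow, norm_pow, div_eq_inv_mul]
    gcongr
  rw [restrict_bidisc] at h2 hFi hm ⊢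
  rw [integral_prod_symm _ hFi]
  rw [lintegral_prod_symm _ (hm.enorm.pow_const 2)] at h2
  have hfinae := ae_lt_top' (AEMeasurable.lintegral_prod_left' (hm.enorm.pow_const 2)) h2.ne
  have hinner : ∀ᵐ y ∂(volume.restrict (ball (0 : ℂ) 1)),
      ∫ x in ball (0 : ℂ) 1, G (x, y) / ((1 - a * conj x) ^ 2 * (1 - b * conj y) ^ 2) =
      Real.pi * (G (a, y) / (1 - b * conj y) ^ 2) := by
    filter_upwards [hfinae, ae_ball_ne_zero] with y hy hy0
    have hd := hG1 y hy0.1 hy0.2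
    have hi := integrableOn_of_lintegral_sq measure_ball_lt_top
      (hd.continuousOn.aestronglyMeasurable isOpen_ball.measurableSet) hy
    rw [← mul_div_assoc, ← disc_reproducing hd hi ha, ← integral_div]
    simp_rw [div_div]
  rw [integral_congr_ae hinner, integral_const_mul]
  -- The slice at the prescribed point a has measure zero, so Fubini says nothing about it;
  -- integrating the point-evaluation bound in y does.
  have hL2 : ∫⁻ y in ball (0 : ℂ) 1, ‖G (a, y)‖ₑ ^ 2 < ∞ := by
    refine lt_of_le_of_lt (lintegral_mono_ae (g := fun y => (ENNReal.ofReal ((1 - ‖a‖) ^ 2)⁻¹) ^ 2 *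
        ∫⁻ x in ball (0 : ℂ) 1, ‖G (x, y)‖ₑ ^ 2) ?_) ?_
    · filter_upwards [ae_ball_ne_zero] with y hy
      exact enorm_sq_le_lintegral (hG1 y hy.1 hy.2) ha
    · rw [lintegral_const_mul'' _ (AEMeasurable.lintegral_prod_left' (hm.enorm.pow_const 2))]
      exact ENNReal.mul_lt_top (ENNReal.pow_lt_top ENNReal.ofReal_lt_top) h2
  rw [punctured_reproducing (hG2 a ha) hL2 hb hb0]
  ring

theorem lintegral_sq_chart {h : ℂ × ℂ → ℂ}
    (hm : AEStronglyMeasurable h (volume.restrict triangle)) :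
    ∫⁻ w in bidisc, ‖w.2 * h (chart w)‖ₑ ^ 2 = ∫⁻ w in triangle, ‖h w‖ₑ ^ 2 := by
  have hac : uMeasure ≪ volume.restrict triangle := withDensity_absolutelyContinuous _ _
  have hmeas : AEMeasurable (fun w : ℂ × ℂ => ‖w.2 * h w‖ₑ ^ 2) uMeasure :=
    (((measurable_snd (α := ℂ) (β := ℂ)).aemeasurable.mul
      (hm.mono_ac hac).aemeasurable).enorm).pow_const 2
  have h1 : ∫⁻ w in bidisc, ‖w.2 * h (chart w)‖ₑ ^ 2 = ∫⁻ w, ‖w.2 * h w‖ₑ ^ 2 ∂uMeasure := by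
    rw [uMeasure_eq_map] at hmeas ⊢
    rw [lintegral_map' hmeas measurable_chart.aemeasurable]
    rfl
  have hd : Measurable fun w : ℂ × ℂ => ENNReal.ofReal ((‖w.2‖ ^ 2)⁻¹) := by fun_prop
  rw [h1, uMeasure, weightMeasure, lintegral_withDensity_eq_lintegral_mul₀' hd.aemeasurable hmeas]
  refine setLIntegral_congr_fun measurableSet_triangle fun w hw => ?_
  have hw0 : 0 < ‖w.2‖ := norm_pos_iff.2 (snd_ne_zero hw)
  simp only [Pi.mul_apply]
  rw [enorm_mul, mul_pow, ← mul_assoc, ← ofReal_norm w.2, ← ENNReal.ofReal_pow hw0.le,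
    ← ENNReal.ofReal_mul (by positivity), inv_mul_cancel₀ (by positivity), ENNReal.ofReal_one,
    one_mul]

/-- The Jacobian |w₂|² = w₂ w̄₂ cancels the w̄₂ of the kernel and leaves the factor w₂ of the
isometry. At w₂ = 0 both sides are 0. -/
theorem kernel_chart_mul (z w : ℂ × ℂ) (c : ℂ) :
    (‖w.2‖ ^ 2 : ℝ) • (kernel z (chart w) * c) =
      (Real.pi ^ 2 * z.2)⁻¹ * (w.2 * c / ((1 - z.1 / z.2 * conj w.1) ^ 2 *
        (1 - z.2 * conj w.2) ^ 2)) := by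
  rcases eq_or_ne w.2 0 with h | h
  · simp [h]
  have hc : conj w.2 ≠ 0 := (map_ne_zero _).2 h
  have e1 : z.1 * conj (w.1 * w.2) / (z.2 * conj w.2) = z.1 / z.2 * conj w.1 := by
    rw [map_mul, ← mul_assoc, mul_div_mul_right _ _ hc, mul_div_right_comm]
  have e2 : ((‖w.2‖ ^ 2 : ℝ) : ℂ) = w.2 * conj w.2 := by
    rw [Complex.mul_conj, Complex.normSq_eq_norm_sq]
  simp only [kernel, chart]
  rw [Complex.real_smul, e1, e2]
  generalize (1 - z.1 / z.2 * conj w.1) ^ 2 = A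
  generalize (1 - z.2 * conj w.2) ^ 2 = B
  have e3 := mul_inv_cancel₀ hc
  simp only [mul_inv, div_eq_mul_inv]
  linear_combination (w.2 * ((Real.pi : ℂ) ^ 2)⁻¹ * z.2⁻¹ * A⁻¹ * B⁻¹ * c) * e3

theorem differentiableOn_comp_chart {h : ℂ × ℂ → ℂ} (hd : DifferentiableOn ℂ h triangle)
    {s : Set ℂ} {γ : ℂ → ℂ × ℂ} (hγ : Differentiable ℂ γ)
    (hs : ∀ x ∈ s, γ x ∈ bidisc ∧ (γ x).2 ≠ 0) :
    DifferentiableOn ℂ (fun x => (γ x).2 * h (chart (γ x))) s := by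
  have h1 : Differentiable ℂ fun x => chart (γ x) := by unfold chart; fun_prop
  exact hγ.snd.differentiableOn.mul (hd.comp h1.differentiableOn fun x hx =>
    (chart_mem_triangle_iff (hs x hx).2).2 (hs x hx).1)

theorem triangle_reproducing {h : ℂ × ℂ → ℂ} (hh : MemBergman triangle h) {z : ℂ × ℂ}
    (hz : z ∈ triangle) : ∫ w in triangle, kernel z w * h w = h z := by
  have hk : Measurable fun w => kernel z w := by unfold kernel; fun_prop
  rw [setIntegral_triangle_eq (fun w => kernel z w * h w)
    (hk.aestronglyMeasurable.mul hh.2.1)]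
  simp_rw [kernel_chart_mul]
  rw [integral_const_mul]
  have hz2 := snd_ne_zero hz
  have hac : uMeasure ≪ volume.restrict triangle := withDensity_absolutelyContinuous _ _
  have hchart : AEStronglyMeasurable (fun w => h (chart w)) (volume.restrict bidisc) := by
    have h3 := hh.2.1.mono_ac hac
    rw [uMeasure_eq_map] at h3
    exact h3.comp_measurable measurable_chart
  have hsq : ∫⁻ w in triangle, ‖h w‖ₑ ^ 2 < ∞ := by
    have := hh.2.2
    rw [eLpNorm_lt_top_iff_lintegral_rpow_enorm_lt_top (by norm_num) (by norm_num)] at this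
    simpa using this
  have key := bidisc_reproducing (G := fun w => w.2 * h (chart w))
    (a := z.1 / z.2) (b := z.2)
    (fun y hy hy0 => differentiableOn_comp_chart hh.1 (γ := fun x => (x, y)) (by fun_prop)
      fun x hx => ⟨⟨hx, hy⟩, hy0⟩)
    (fun x hx => differentiableOn_comp_chart hh.1 (γ := fun y => (x, y)) (by fun_prop)
      fun y hy => ⟨⟨hx, hy.1⟩, hy.2⟩)
    ((measurable_snd (α := ℂ) (β := ℂ)).aestronglyMeasurable.mul hchart)
    (by rw [lintegral_sq_chart hh.2.1]; exact hsq)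
    (mem_ball_zero_iff.2 (norm_fst_div_snd_lt hz)) (mem_ball_zero_iff.2 hz.2) hz2
  rw [key]
  have hpi : (Real.pi : ℂ) ≠ 0 := Complex.ofReal_ne_zero.2 Real.pi_ne_zero
  simp only [chart, div_mul_cancel₀ _ hz2]
  field_simp

/-! ### The Bergman projection of the Hartogs triangle -/

/-- Directional derivatives are almost everywhere limits of difference quotients, and a linear map
on ℂ² is assembled from its values on two basis vectors. -/
theorem aestronglyMeasurable_fderiv {X : Type*} [MeasurableSpace X] {μ : Measure X}
    {F : ℂ × ℂ → X → ℂ} {z : ℂ × ℂ} (hm : ∀ z, AEStronglyMeasurable (F z) μ)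
    (hd : ∀ᵐ w ∂μ, DifferentiableAt ℂ (fun z => F z w) z) :
    AEStronglyMeasurable (fun w => fderiv ℂ (fun z => F z w) z) μ := by
  have hdir : ∀ v : ℂ × ℂ, AEStronglyMeasurable (fun w => fderiv ℂ (fun z => F z w) z v) μ := by
    intro v
    have hc : Tendsto (fun n : ℕ => ‖((n : ℝ) : ℂ)‖) atTop atTop := by
      simpa using tendsto_natCast_atTop_atTop (R := ℝ)
    refine aestronglyMeasurable_of_tendsto_ae atTop
      (f := fun (n : ℕ) w => ((n : ℝ) : ℂ) • (F (z + (((n : ℝ) : ℂ))⁻¹ • v) w - F z w))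
      (fun n => ((hm (z + (((n : ℝ) : ℂ))⁻¹ • v)).sub (hm z)).const_smul ((n : ℝ) : ℂ)) ?_
    filter_upwards [hd] with w hw using hw.hasFDerivAt.lim v hc
  have e : (fun w => fderiv ℂ (fun z => F z w) z) = fun w =>
      (fderiv ℂ (fun z => F z w) z (1, 0)) • ContinuousLinearMap.fst ℂ ℂ ℂ +
      (fderiv ℂ (fun z => F z w) z (0, 1)) • ContinuousLinearMap.snd ℂ ℂ ℂ := by
    ext w <;> simp
  rw [e]
  exact ((hdir _).smul_const _).add ((hdir _).smul_const _)

/-- Differentiation under the integral needs no separate bound on derivatives: Cauchy's estimate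
turns the locally uniform size bound into one. -/
theorem differentiableOn_integral {X : Type*} [MeasurableSpace X] {μ : Measure X}
    {U : Set (ℂ × ℂ)} (hU : IsOpen U) {F : ℂ × ℂ → X → ℂ} {b : ℂ × ℂ → ℝ} {g : X → ℝ}
    (hm : ∀ z, AEStronglyMeasurable (F z) μ)
    (hd : ∀ᵐ w ∂μ, DifferentiableOn ℂ (fun z => F z w) U)
    (hb : ContinuousOn b U) (hg : Integrable g μ) (hg0 : ∀ w, 0 ≤ g w)
    (hle : ∀ᵐ w ∂μ, ∀ z ∈ U, ‖F z w‖ ≤ b z * g w) :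
    DifferentiableOn ℂ (fun z => ∫ w, F z w ∂μ) U := by
  intro z₀ hz₀
  have hev : ∀ᶠ z in 𝓝 z₀, z ∈ U ∧ b z < b z₀ + 1 :=
    (show ∀ᶠ z in 𝓝 z₀, z ∈ U from hU.mem_nhds hz₀).and ((hb.continuousAt (hU.mem_nhds hz₀)).eventually
      (gt_mem_nhds (lt_add_one _)))
  obtain ⟨ε, hε, hball⟩ := Metric.eventually_nhds_iff_ball.1 hev
  have hε2 : 0 < ε / 2 := half_pos hε
  have hsub : ∀ z ∈ ball z₀ (ε / 2), ball z (ε / 2) ⊆ ball z₀ ε := fun z hz =>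
    ball_subset_ball' (by linarith [mem_ball.1 hz])
  -- Near z₀ the integrand is at most M = (b z₀ + 1) g, so its oscillation is at most 2M. Cauchy's
  -- estimate on discs of radius ε/2 bounds the derivative by 2M/(ε/2).
  refine (hasFDerivAt_integral_of_dominated_of_fderiv_le (𝕜 := ℂ)
    (F' := fun z w => fderiv ℂ (fun z => F z w) z)
    (bound := fun w => 2 * ((b z₀ + 1) * g w) / (ε / 2)) (ball_mem_nhds z₀ hε2)
    (Eventually.of_forall hm) ?_ ?_ ?_ ?_ ?_).differentiableAt.differentiableWithinAt
  · refine Integrable.mono' (hg.const_mul (b z₀)) (hm z₀) ?_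
    filter_upwards [hle] with w hw using hw z₀ hz₀
  · refine aestronglyMeasurable_fderiv hm ?_
    filter_upwards [hd] with w hw using hw.differentiableAt (hU.mem_nhds hz₀)
  · filter_upwards [hd, hle] with w hw hlew z hz
    refine Complex.norm_fderiv_le_div_of_mapsTo_ball
      (hw.mono fun x hx => (hball x (hsub z hz hx)).1) (fun x hx => ?_) hε2
    have hbd : ∀ y ∈ ball z₀ ε, ‖F y w‖ ≤ (b z₀ + 1) * g w := fun y hy =>
      (hlew y (hball y hy).1).trans
        (mul_le_mul_of_nonneg_right (hball y hy).2.le (hg0 w))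
    rw [mem_closedBall, dist_eq_norm]
    have h1 := hbd x (hsub z hz hx)
    have h2 := hbd z (hsub z hz (mem_ball_self hε2))
    linarith [norm_sub_le (F x w) (F z w)]
  · exact ((hg.const_mul _).const_mul 2).div_const _
  · filter_upwards [hd] with w hw z hz
    exact (hw.differentiableAt (hU.mem_nhds (hball z (hsub z hz (mem_ball_self hε2))).1)).hasFDerivAt

theorem differentiableOn_proj {f : ℂ × ℂ → ℂ}
    (hf : AEStronglyMeasurable f (volume.restrict triangle))
    (hi : Integrable (fun w => ‖w.2‖⁻¹ * ‖f w‖) (volume.restrict triangle)) :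
    DifferentiableOn ℂ (proj f) triangle := by
  have hk : ∀ z, Measurable fun w => kernel z w := fun z => by unfold kernel; fun_prop
  refine differentiableOn_integral isOpen_triangle
    (fun z => (hk z).aestronglyMeasurable.mul hf) ?_ continuousOn_kernelBound hi
    (fun w => by positivity) ?_
  · filter_upwards [ae_restrict_mem measurableSet_triangle] with w hw
    exact (differentiableOn_kernel hw).mul_const _
  · filter_upwards [ae_restrict_mem measurableSet_triangle] with w hw z hz
    rw [norm_mul, ← mul_assoc]
    exact mul_le_mul_of_nonneg_right (norm_kernel_le hz hw) (norm_nonneg _)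

theorem differentiableOn_proj_of_memLp {f : ℂ × ℂ → ℂ}
    (hf : MemLp f 2 (volume.restrict triangle)) : DifferentiableOn ℂ (proj f) triangle :=
  differentiableOn_proj hf.1 (memLp_inv_norm_snd.integrable_mul hf.norm)

/-- Square-integrable functions on the Hartogs triangle. -/
abbrev TriangleL2 : Type := Lp ℂ 2 ((volume : Measure (ℂ × ℂ)).restrict triangle)

/-- The class in `L²` of `w ↦ conj (kernel z w)`. -/
def kernelLp {z : ℂ × ℂ} (hz : z ∈ triangle) : TriangleL2 := (memBergman_kernel hz).2.toLp

theorem inner_kernelLp {z : ℂ × ℂ} (hz : z ∈ triangle) (v : TriangleL2) :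
    inner ℂ (kernelLp hz) v = proj v z := by
  rw [L2.inner_def, proj]
  refine integral_congr_ae ?_
  filter_upwards [(memBergman_kernel hz).2.coeFn_toLp] with w hw
  rw [kernelLp, hw]
  simp [mul_comm]

/-- The Bergman space of the Hartogs triangle as a subspace of `L²`. -/
def bergmanSpace : Submodule ℂ TriangleL2 where
  carrier := {v | ∃ h, MemBergman triangle h ∧ v =ᵐ[volume.restrict triangle] h}
  add_mem' := by
    rintro u v ⟨h, hh, hu⟩ ⟨k, hk, hv⟩
    exact ⟨h + k, ⟨hh.1.add hk.1, hh.2.add hk.2⟩, (Lp.coeFn_add u v).trans (hu.add hv)⟩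
  zero_mem' := ⟨0, ⟨differentiableOn_const 0, MemLp.zero⟩, Lp.coeFn_zero _ _ _⟩
  smul_mem' := by
    rintro c v ⟨h, hh, hv⟩
    exact ⟨c • h, ⟨hh.1.const_smul c, hh.2.const_smul c⟩,
      (Lp.coeFn_smul c v).trans (hv.const_smul c)⟩

theorem proj_congr {f g : ℂ × ℂ → ℂ} (h : f =ᵐ[volume.restrict triangle] g) :
    proj f = proj g := by
  ext z
  exact integral_congr_ae (h.mono fun w hw => by simp only [hw])

theorem ae_eq_proj_of_mem {v : TriangleL2} (hv : v ∈ bergmanSpace) :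
    v =ᵐ[volume.restrict triangle] proj v := by
  obtain ⟨h, hh, hvh⟩ := hv
  rw [proj_congr hvh]
  filter_upwards [hvh, ae_restrict_mem measurableSet_triangle] with z h1 hz
  rw [h1, proj, triangle_reproducing hh hz]

/-- Elements of the space agree almost everywhere with their `proj`, and `proj` at a point is an
inner product with a fixed vector, hence continuous in L². Comparing this with almost everywhere
convergence of a subsequence shows that a limit equals its own, holomorphic, `proj`. -/
theorem isClosed_bergmanSpace : IsClosed (bergmanSpace : Set TriangleL2) := by
  refine IsSeqClosed.isClosed fun v u hv hlim => ?_
  have hae : u =ᵐ[volume.restrict triangle] proj u := by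
    obtain ⟨ns, hns, hconv⟩ := (tendstoInMeasure_of_tendsto_Lp hlim).exists_seq_tendsto_ae
    have hall := ae_all_iff.2 fun n => ae_eq_proj_of_mem (hv n)
    filter_upwards [hconv, hall, ae_restrict_mem measurableSet_triangle] with z h1 h2 hz
    refine tendsto_nhds_unique h1 ?_
    simp_rw [h2, ← inner_kernelLp hz]
    exact (((continuous_const.inner continuous_id).tendsto u).comp hlim).comp hns.tendsto_atTop
  exact ⟨proj u, ⟨differentiableOn_proj_of_memLp (Lp.memLp u), (memLp_congr_ae hae).1 (Lp.memLp u)⟩,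
    hae⟩

/-- Split f = u + v with u in the Bergman space and v orthogonal to it. The kernel vectors lie in
the space, so `proj` annihilates v, and it reproduces u. -/
theorem isBergmanKernel_kernel : IsBergmanKernel triangle kernel := by
  refine ⟨fun z hz => memBergman_kernel hz, fun f hf => ?_⟩
  change IsBergmanProjection triangle f (proj f)
  have : IsClosed (bergmanSpace : Set TriangleL2) := isClosed_bergmanSpace
  have : CompleteSpace bergmanSpace := this.completeSpace_coe
  obtain ⟨u, hu, v, hv, huv⟩ := bergmanSpace.exists_add_mem_mem_orthogonal hf.toLp
  have hproj : ∀ z ∈ triangle, proj f z = proj u z := by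
    intro z hz
    rw [← proj_congr hf.coeFn_toLp, ← inner_kernelLp hz, huv, inner_add_right,
      ← inner_kernelLp hz u]
    rw [hv (kernelLp hz) ⟨_, memBergman_kernel hz, (memBergman_kernel hz).2.coeFn_toLp⟩,
      add_zero]
  have hae : proj f =ᵐ[volume.restrict triangle] u := by
    filter_upwards [ae_eq_proj_of_mem hu, ae_restrict_mem measurableSet_triangle] with z h1 hz
    rw [hproj z hz, h1]
  refine ⟨⟨differentiableOn_proj_of_memLp hf, (memLp_congr_ae hae).2 (Lp.memLp u)⟩,
    fun h hh => ?_⟩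
  have hort := hv hh.2.toLp ⟨h, hh, hh.2.coeFn_toLp⟩
  rw [L2.inner_def] at hort
  rw [← hort]
  refine integral_congr_ae ?_
  have hsum : (hf.toLp : ℂ × ℂ → ℂ) =ᵐ[volume.restrict triangle] fun z => u z + v z := by
    rw [huv]; exact Lp.coeFn_add u v
  filter_upwards [hae, hsum, hf.coeFn_toLp, hh.2.coeFn_toLp] with z h1 h2 h3 h4
  rw [h1, ← h3, h2, h4]
  simp

/-! ### Carleson tents -/

/-- Makes a Carleson tent a Euclidean disc about a boundary point intersected with 𝔻. -/
theorem norm_one_sub_conj_mul {η : ℂ} (hη : ‖η‖ = 1) (w : ℂ) : ‖1 - conj w * η‖ = ‖w - η‖ := by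
  have h1 : conj η * η = 1 := by
    rw [mul_comm, Complex.mul_conj, Complex.normSq_eq_norm_sq, hη]; norm_num
  have h : 1 - conj w * η = conj (η - w) * η := by rw [map_sub, sub_mul, h1]
  rw [h, norm_mul, Complex.norm_conj, hη, mul_one, norm_sub_rev]

theorem norm_div_norm {z : ℂ} (hz : z ≠ 0) : ‖z / (‖z‖ : ℂ)‖ = 1 := by
  rw [norm_div, Complex.norm_real, norm_norm, div_self (norm_ne_zero_iff.2 hz)]

theorem carlesonTent_zero : carlesonTent 0 = ball 0 1 := if_pos rfl

theorem carlesonTent_of_ne_zero {z : ℂ} (hz : z ≠ 0) :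
    carlesonTent z = ball (z / (‖z‖ : ℂ)) (1 - ‖z‖) ∩ ball 0 1 := by
  rw [carlesonTent, if_neg hz]
  ext w
  rw [mem_ofPred_eq, norm_one_sub_conj_mul (norm_div_norm hz), mem_inter_iff, ← dist_eq_norm,
    ← mem_ball]
  exact and_comm

theorem carlesonTent_smul {η : ℂ} (hη : ‖η‖ = 1) {δ : ℝ} (h1 : δ < 1) :
    carlesonTent ((1 - δ : ℝ) * η) = ball η δ ∩ ball 0 1 := by
  have h2 : (0 : ℝ) < 1 - δ := sub_pos.2 h1
  have hn : ‖((1 - δ : ℝ) : ℂ) * η‖ = 1 - δ := by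
    rw [norm_mul, hη, mul_one, Complex.norm_real, Real.norm_eq_abs, abs_of_pos h2]
  have hne : ((1 - δ : ℝ) : ℂ) ≠ 0 := Complex.ofReal_ne_zero.2 h2.ne'
  rw [carlesonTent_of_ne_zero (norm_pos_iff.1 (h2.trans_eq hn.symm)), hn, mul_div_cancel_left₀ _ hne,
    sub_sub_cancel]

theorem smul_mem_ball {η : ℂ} (hη : ‖η‖ = 1) {δ : ℝ} (h0 : 0 < δ) (h1 : δ < 1) :
    ((1 - δ : ℝ) * η : ℂ) ∈ ball (0 : ℂ) 1 := by
  rw [mem_ball_zero_iff, norm_mul, hη, mul_one, Complex.norm_real, Real.norm_eq_abs,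
    abs_of_pos (sub_pos.2 h1)]
  linarith

theorem carlesonTent_subset (z : ℂ) : carlesonTent z ⊆ ball 0 1 := by
  rcases eq_or_ne z 0 with h | h
  · rw [h, carlesonTent_zero]
  · rw [carlesonTent_of_ne_zero h]; exact inter_subset_right

theorem measurableSet_carlesonTent (z : ℂ) : MeasurableSet (carlesonTent z) := by
  rcases eq_or_ne z 0 with h | h
  · rw [h, carlesonTent_zero]; exact isOpen_ball.measurableSet
  · rw [carlesonTent_of_ne_zero h]
    exact isOpen_ball.measurableSet.inter isOpen_ball.measurableSet

theorem volume_ball_eq (a : ℂ) {r : ℝ} (hr : 0 ≤ r) :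
    volume (ball a r) = ENNReal.ofReal (Real.pi * r ^ 2) := by
  rw [Complex.volume_ball, ← ENNReal.ofReal_pow hr, mul_comm Real.pi,
    ENNReal.ofReal_mul (by positivity), ← NNReal.coe_real_pi, ENNReal.ofReal_coe_nnreal]

/-- A Carleson tent of size `δ` contains a disc of radius `δ / 2`. -/
theorem le_volume_carlesonTent {z : ℂ} (hz : z ∈ ball (0 : ℂ) 1) :
    ENNReal.ofReal (Real.pi * ((1 - ‖z‖) / 2) ^ 2) ≤ volume (carlesonTent z) := by
  have hz1 : ‖z‖ < 1 := mem_ball_zero_iff.1 hz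
  rcases eq_or_ne z 0 with rfl | h
  · rw [carlesonTent_zero, volume_ball_eq _ zero_le_one]
    refine ENNReal.ofReal_le_ofReal ?_
    rw [norm_zero]
    nlinarith [Real.pi_pos]
  · rw [carlesonTent_of_ne_zero h,
      ← volume_ball_eq (((1 + ‖z‖) / 2 : ℝ) * (z / (‖z‖ : ℂ))) (by linarith)]
    have hn := norm_div_norm h
    set η := z / (‖z‖ : ℂ)
    refine measure_mono (subset_inter (ball_subset_ball' ?_) (ball_subset_ball' ?_))
    · rw [dist_eq_norm, show (((1 + ‖z‖) / 2 : ℝ) : ℂ) * η - η = (((‖z‖ - 1) / 2 : ℝ) : ℂ) * η by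
        push_cast; ring, norm_mul, hn, Complex.norm_real, Real.norm_eq_abs,
        abs_of_nonpos (by linarith)]
      linarith
    · rw [dist_zero_right, norm_mul, hn, Complex.norm_real, Real.norm_eq_abs,
        abs_of_nonneg (by positivity)]
      linarith

/-- Two points of the disc lie in a common Carleson tent of area `≲ |1 - z w̄|²`. -/
theorem exists_carlesonTent {z w : ℂ} (hz : z ∈ ball (0 : ℂ) 1) (hw : w ∈ ball (0 : ℂ) 1) :
    ∃ ζ ∈ ball (0 : ℂ) 1, z ∈ carlesonTent ζ ∧ w ∈ carlesonTent ζ ∧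
      volume (carlesonTent ζ) ≤ ENNReal.ofReal (9 * Real.pi * ‖1 - z * conj w‖ ^ 2) := by
  have hz1 : ‖z‖ < 1 := mem_ball_zero_iff.1 hz
  have hw1 : ‖w‖ < 1 := mem_ball_zero_iff.1 hw
  set s := ‖1 - z * conj w‖ with hs
  -- The tent used for small s has size 3s, which must be below 1. When s ≥ 1/3 the whole disc
  -- suffices because 9 s² ≥ 1.
  rcases le_or_gt (1 / 3) s with h | h
  · refine ⟨0, mem_ball_self one_pos, ?_⟩
    rw [carlesonTent_zero, volume_ball_eq _ zero_le_one]
    refine ⟨hz, hw, ENNReal.ofReal_le_ofReal ?_⟩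
    have : 1 ≤ 9 * s ^ 2 := by nlinarith
    nlinarith [Real.pi_pos]
  · have hz0 : z ≠ 0 := by
      rintro rfl
      simp at hs
      linarith
    have hn := norm_div_norm hz0
    have hle : 1 - ‖z‖ ≤ s := one_sub_norm_le hw1.le
    have hspos : 0 < s := (sub_pos.2 hz1).trans_le hle
    set η := z / (‖z‖ : ℂ) with hη
    have hzη : ‖z - η‖ = 1 - ‖z‖ := by
      have : z = (‖z‖ : ℂ) * η := by
        rw [hη, mul_div_cancel₀]; exact Complex.ofReal_ne_zero.2 (norm_ne_zero_iff.2 hz0)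
      have h2 : z - η = ((‖z‖ - 1 : ℝ) : ℂ) * η := by
        nth_rewrite 1 [this]; push_cast; ring
      rw [h2, norm_mul, hn, Complex.norm_real, Real.norm_eq_abs, abs_of_nonpos (by linarith)]
      ring
    have hwη : ‖w - η‖ ≤ 2 * s := by
      rw [← norm_one_sub_conj_mul hn]
      have : 1 - conj w * η = (1 - z * conj w) + conj w * (z - η) := by ring
      rw [this]
      refine (norm_add_le _ _).trans ?_
      rw [norm_mul, Complex.norm_conj, hzη, ← hs]
      nlinarith [norm_nonneg w]
    -- About η = z/|z| the point z is at distance at most s and w at distance at most 2s, so radius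
    -- 3s captures both strictly.
    refine ⟨((1 - 3 * s : ℝ) : ℂ) * η, smul_mem_ball hn (by linarith) (by linarith), ?_⟩
    rw [carlesonTent_smul hn (by linarith)]
    refine ⟨⟨?_, hz⟩, ⟨?_, hw⟩, ?_⟩
    · rw [mem_ball, dist_eq_norm]; linarith
    · rw [mem_ball, dist_eq_norm]; linarith
    · refine (measure_mono inter_subset_left).trans ?_
      rw [volume_ball_eq _ (by linarith)]
      exact ENNReal.ofReal_le_ofReal (le_of_eq (by ring))

/-! ### Kubes and dyadic tents -/

theorem step_pos : 0 < step := half_pos (Real.log_pos one_lt_two)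

theorem tanh_pos {x : ℝ} (hx : 0 < x) : 0 < Real.tanh x := by
  rw [Real.tanh_eq_sinh_div_cosh]
  exact div_pos (Real.sinh_pos_iff.2 hx) (Real.cosh_pos x)

theorem lt_of_tanh_lt {x y : ℝ} (h : Real.tanh x < Real.tanh y) : x < y := by
  rwa [← Real.artanh_lt_artanh_iff ⟨Real.neg_one_lt_tanh x, Real.tanh_lt_one x⟩
    ⟨Real.neg_one_lt_tanh y, Real.tanh_lt_one y⟩, Real.artanh_tanh, Real.artanh_tanh] at h

/-- The step is half of log 2, so exp(2k · step) = 2ᵏ. Generation k therefore lives at Euclidean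
distance comparable to 2⁻ᵏ from the circle. -/
theorem tanh_mul_step (k : ℕ) : Real.tanh (k * step) = 1 - 2 / (2 ^ k + 1) := by
  have ht : Real.exp (k * step) * Real.exp (k * step) = 2 ^ k := by
    rw [← Real.exp_add, step, show (k : ℝ) * (Real.log 2 / 2) + k * (Real.log 2 / 2) =
      k * Real.log 2 by ring, Real.exp_nat_mul, Real.exp_log two_pos]
  rw [Real.tanh_eq_sinh_div_cosh, Real.sinh_eq, Real.cosh_eq, Real.exp_neg, ← ht]
  have := Real.exp_pos (k * step)
  set t := Real.exp (k * step)
  field_simp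
  ring

theorem bergmanDist_zero_left (z : ℂ) : bergmanDist 0 z = Real.artanh ‖z‖ := by
  simp [bergmanDist]

theorem le_bergmanDist_iff {z : ℂ} (hz : z ∈ ball (0 : ℂ) 1) (x : ℝ) :
    x ≤ bergmanDist 0 z ↔ Real.tanh x ≤ ‖z‖ := by
  have hz1 : ‖z‖ < 1 := mem_ball_zero_iff.1 hz
  rw [bergmanDist_zero_left, ← Real.artanh_le_artanh_iff
    ⟨Real.neg_one_lt_tanh x, Real.tanh_lt_one x⟩ ⟨by linarith [norm_nonneg z], hz1⟩,
    Real.artanh_tanh]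

/-- The point `e^{2πiθ}` of the unit circle. -/
def turn (θ : ℝ) : ℂ := Complex.exp (2 * Real.pi * θ * Complex.I)

theorem turn_eq (θ : ℝ) : turn θ = Complex.exp ((2 * Real.pi * θ : ℝ) * Complex.I) := by
  rw [turn]; push_cast; rfl

theorem norm_turn (θ : ℝ) : ‖turn θ‖ = 1 := by rw [turn_eq, Complex.norm_exp_ofReal_mul_I]

theorem turn_ne_zero (θ : ℝ) : turn θ ≠ 0 := norm_pos_iff.1 (by rw [norm_turn]; exact one_pos)

theorem continuous_turn : Continuous turn := by unfold turn; fun_prop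

theorem turn_add (θ φ : ℝ) : turn (θ + φ) = turn θ * turn φ := by
  rw [turn, turn, turn, ← Complex.exp_add]; push_cast; ring_nf

theorem turn_eq_turn_iff {θ φ : ℝ} : turn θ = turn φ ↔ ∃ n : ℤ, θ = φ + n := by
  rw [turn, turn, Complex.exp_eq_exp_iff_exists_int]
  refine exists_congr fun n => ?_
  have h2 : (2 * Real.pi * Complex.I : ℂ) ≠ 0 := by simp [Real.pi_ne_zero]
  constructor
  · intro h
    have : (2 * Real.pi * Complex.I : ℂ) * θ = (2 * Real.pi * Complex.I) * (φ + n) := by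
      linear_combination h
    exact_mod_cast mul_left_cancel₀ h2 this
  · intro h
    rw [h]; push_cast; ring

theorem norm_turn_sub_turn_le (θ φ : ℝ) : ‖turn θ - turn φ‖ ≤ 2 * Real.pi * |θ - φ| := by
  have h : turn θ - turn φ = turn φ * (turn (θ - φ) - 1) := by
    rw [mul_sub, ← turn_add, mul_one]; ring_nf
  rw [h, norm_mul, norm_turn, one_mul, turn_eq, mul_comm _ Complex.I]
  refine (Real.norm_exp_I_mul_ofReal_sub_one_le).trans (le_of_eq ?_)
  rw [Real.norm_eq_abs, abs_mul, abs_of_pos (by positivity)]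

/-- An angle is at most π/2 times its chord; dividing by 2π to measure in turns gives the factor
1/4. -/
theorem exists_turn_near {x : ℂ} (hx : ‖x‖ = 1) (φ : ℝ) :
    ∃ θ : ℝ, x = turn θ ∧ |θ - φ| ≤ ‖x - turn φ‖ / 4 := by
  have hx0 : x ≠ 0 := norm_pos_iff.1 (hx ▸ one_pos)
  set t := (x / turn φ).arg with ht
  have hnorm : ‖x / turn φ‖ = 1 := by rw [norm_div, hx, norm_turn, div_one]
  have hang : |t| ≤ Real.pi / 2 * ‖x - turn φ‖ := by
    rw [ht, ← Complex.angle_eq_abs_arg hx0 (turn_ne_zero φ)]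
    exact Complex.angle_le_mul_norm_sub hx (norm_turn φ)
  refine ⟨φ + t / (2 * Real.pi), ?_, ?_⟩
  · have h1 := Complex.norm_mul_exp_arg_mul_I (x / turn φ)
    rw [hnorm, Complex.ofReal_one, one_mul, ← ht] at h1
    rw [turn_add, turn_eq (t / _), mul_div_cancel₀ _ (by positivity), h1,
      mul_div_cancel₀ _ (turn_ne_zero φ)]
  · rw [add_sub_cancel_left, abs_div, abs_of_pos (by positivity : 0 < 2 * Real.pi),
      div_le_iff₀ (by positivity)]
    linarith

theorem exists_turn_Ico {x : ℂ} (hx : ‖x‖ = 1) (l : ℝ) :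
    ∃ θ : ℝ, l ≤ θ ∧ θ < l + 1 ∧ x = turn θ := by
  obtain ⟨θ, h, -⟩ := exists_turn_near hx 0
  refine ⟨l + Int.fract (θ - l), by linarith [Int.fract_nonneg (θ - l)],
    by linarith [Int.fract_lt_one (θ - l)], ?_⟩
  rw [h, turn_eq_turn_iff]
  exact ⟨⌊θ - l⌋, by linarith [Int.floor_add_fract (θ - l)]⟩

/-! ### Kubes and the tree order in terms of radius and angle. -/

theorem mem_arc_iff {l : ℝ} {a : Index} {ζ : ℂ} : ζ ∈ arc l a ↔
    ∃ θ : ℝ, ((a.2 : ℕ) : ℝ) / 2 ^ a.1 + l ≤ θ ∧ θ < (((a.2 : ℕ) : ℝ) + 1) / 2 ^ a.1 + l ∧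
    ζ = turn θ := Iff.rfl

theorem norm_of_mem_arc {l : ℝ} {a : Index} {ζ : ℂ} (h : ζ ∈ arc l a) : ‖ζ‖ = 1 := by
  obtain ⟨θ, -, -, rfl⟩ := h
  exact norm_turn θ

theorem radialProj_of_norm_one {ζ : ℂ} (h : ‖ζ‖ = 1) (ρ : ℝ) :
    radialProj ρ ζ = (Real.tanh ρ : ℂ) * ζ := by
  rw [radialProj, h, Complex.ofReal_one, div_one]

theorem radialProj_zero (z : ℂ) : radialProj 0 z = 0 := by simp [radialProj]

theorem arc_nonempty (l : ℝ) (a : Index) : (arc l a).Nonempty :=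
  ⟨turn (((a.2 : ℕ) : ℝ) / 2 ^ a.1 + l), _, le_rfl, by gcongr; linarith, rfl⟩

theorem radialProj_mem_iff {l : ℝ} {a : Index} (ha : a.1 ≠ 0) (z : ℂ) :
    radialProj (a.1 * step) z ∈ radialProj (a.1 * step) '' arc l a ↔
      z / (‖z‖ : ℂ) ∈ arc l a := by
  have hk : (0 : ℝ) < a.1 := by exact_mod_cast Nat.pos_of_ne_zero ha
  have ht : (Real.tanh (a.1 * step) : ℂ) ≠ 0 :=
    Complex.ofReal_ne_zero.2 (tanh_pos (mul_pos hk step_pos)).ne'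
  constructor
  · rintro ⟨ζ, hζ, h⟩
    rw [radialProj_of_norm_one (norm_of_mem_arc hζ), radialProj] at h
    rwa [← mul_left_cancel₀ ht h]
  · intro h
    exact ⟨_, h, by rw [radialProj_of_norm_one (norm_of_mem_arc h), radialProj]⟩

/-- The circle of radius 0 is a point, so at the root the angular condition is empty. -/
theorem radialProj_mem_of_eq_zero {l : ℝ} {a : Index} (ha : a.1 = 0) (z : ℂ) :
    radialProj (a.1 * step) z ∈ radialProj (a.1 * step) '' arc l a := by
  obtain ⟨ζ, hζ⟩ := arc_nonempty l a
  exact ⟨ζ, hζ, by simp [ha, radialProj_zero]⟩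

theorem mem_kube_iff {l : ℝ} {a : Index} {z : ℂ} : z ∈ kube l a ↔ z ∈ ball (0 : ℂ) 1 ∧
    Real.tanh (a.1 * step) ≤ ‖z‖ ∧ ‖z‖ < Real.tanh (((a.1 + 1 : ℕ) : ℝ) * step) ∧
    (a.1 ≠ 0 → z / (‖z‖ : ℂ) ∈ arc l a) := by
  have hd : ((a.1 : ℝ) + 1) * step = ((a.1 + 1 : ℕ) : ℝ) * step := by push_cast; rfl
  rw [kube, mem_ofPred_eq, hd]
  refine and_congr_right fun hz => ?_
  rw [le_bergmanDist_iff hz, ← not_le, le_bergmanDist_iff hz, not_le]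
  refine and_congr_right fun _ => and_congr_right fun _ => ?_
  by_cases ha : a.1 = 0
  · exact iff_of_true (radialProj_mem_of_eq_zero ha z) fun h => absurd ha h
  · rw [radialProj_mem_iff ha]
    exact ⟨fun h _ => h, fun h => h ha⟩

theorem center_div_norm {l : ℝ} {b : Index} (hb : b.1 ≠ 0) : center l b / (‖center l b‖ : ℂ) =
    turn ((((b.2 : ℕ) : ℝ) + 1 / 2) / 2 ^ b.1 + l) := by
  have h : center l b = (Real.tanh (((b.1 : ℝ) + 1 / 2) * step) : ℂ) *
      turn ((((b.2 : ℕ) : ℝ) + 1 / 2) / 2 ^ b.1 + l) := by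
    rw [center, if_neg hb]
    exact radialProj_of_norm_one (norm_turn _) _
  have hpos : 0 < Real.tanh (((b.1 : ℝ) + 1 / 2) * step) :=
    tanh_pos (mul_pos (by positivity) step_pos)
  rw [h, norm_mul, norm_turn, mul_one, Complex.norm_real, Real.norm_eq_abs, abs_of_pos hpos,
    mul_div_cancel_left₀ _ (Complex.ofReal_ne_zero.2 hpos.ne')]

theorem treeLE_iff {l : ℝ} {a b : Index} : TreeLE l a b ↔ a.1 ≤ b.1 ∧
    (a.1 ≠ 0 → turn ((((b.2 : ℕ) : ℝ) + 1 / 2) / 2 ^ b.1 + l) ∈ arc l a) := by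
  rw [TreeLE]
  refine and_congr_right fun hab => ?_
  by_cases ha : a.1 = 0
  · exact iff_of_true (radialProj_mem_of_eq_zero ha _) fun h => absurd ha h
  · rw [radialProj_mem_iff ha, center_div_norm (by omega)]
    exact ⟨fun h _ => h, fun h => h ha⟩

theorem treeLE_refl (l : ℝ) (a : Index) : TreeLE l a a := by
  refine treeLE_iff.2 ⟨le_rfl, fun _ => ⟨_, ?_, ?_, rfl⟩⟩
  · gcongr; linarith
  · gcongr; norm_num

theorem kube_subset_dyadicTent (l : ℝ) (a : Index) : kube l a ⊆ dyadicTent l a :=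
  subset_biUnion_of_mem (u := kube l) (treeLE_refl l a)

theorem dyadicTent_subset_ball (l : ℝ) (a : Index) : dyadicTent l a ⊆ ball 0 1 :=
  iUnion₂_subset fun _ _ _ h => h.1

theorem index_div_lt_one (a : Index) : (((a.2 : ℕ) : ℝ) + 1) / 2 ^ a.1 ≤ 1 := by
  rw [div_le_one (by positivity)]
  exact_mod_cast a.2.2

/-- The modulus determines the generation. The angle then determines the position, since all arcs of
a generation fill one period [l, l + 1). -/
theorem disjoint_kube {l : ℝ} {a b : Index} (hab : a ≠ b) : Disjoint (kube l a) (kube l b) := by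
  rw [Set.disjoint_left]
  intro z ha hb
  have hmono : ∀ {m n : ℕ}, Real.tanh (m * step) < Real.tanh (n * step) → m < n := by
    intro m n h
    have := lt_of_tanh_lt h
    exact_mod_cast lt_of_mul_lt_mul_right this step_pos.le
  rw [mem_kube_iff] at ha hb
  have h1 := hmono (ha.2.1.trans_lt hb.2.2.1)
  have h2 := hmono (hb.2.1.trans_lt ha.2.2.1)
  obtain ⟨k, i⟩ := a
  obtain ⟨k', j⟩ := b
  obtain rfl : k = k' := by simp only at h1 h2; omega
  refine hab ?_
  congr 1
  by_cases hk : k = 0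
  · subst hk
    exact Subsingleton.elim (α := Fin 1) i j
  obtain ⟨θ, hθ1, hθ2, hθ⟩ := ha.2.2.2 hk
  obtain ⟨φ, hφ1, hφ2, hφ⟩ := hb.2.2.2 hk
  simp only at hθ1 hθ2 hφ1 hφ2
  obtain ⟨n, hn⟩ := turn_eq_turn_iff.1 (show turn θ = turn φ from hθ.symm.trans hφ)
  have hi := index_div_lt_one ⟨k, i⟩
  have hj := index_div_lt_one ⟨k, j⟩
  simp only at hi hj
  have hi0 : (0 : ℝ) ≤ ((i : ℕ) : ℝ) / 2 ^ k := by positivity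
  have hj0 : (0 : ℝ) ≤ ((j : ℕ) : ℝ) / 2 ^ k := by positivity
  -- Both angles lie in [l, l + 1), so the whole number of turns between them is 0.
  have hn1 : (n : ℝ) < 1 := by linarith
  have hn2 : (-1 : ℝ) < n := by linarith
  have hn0 : n = 0 := by
    have : n < 1 := by exact_mod_cast hn1
    have : -1 < n := by exact_mod_cast hn2
    omega
  rw [hn0, Int.cast_zero, add_zero] at hn
  subst hn
  have e1 : ((i : ℕ) : ℝ) / 2 ^ k < (((j : ℕ) : ℝ) + 1) / 2 ^ k := by linarith
  have e2 : ((j : ℕ) : ℝ) / 2 ^ k < (((i : ℕ) : ℝ) + 1) / 2 ^ k := by linarith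
  rw [div_lt_div_iff_of_pos_right (by positivity)] at e1 e2
  have e1' : (i : ℕ) < (j : ℕ) + 1 := by exact_mod_cast e1
  have e2' : (j : ℕ) < (i : ℕ) + 1 := by exact_mod_cast e2
  exact Fin.ext (by omega)

/-- A half-open arc is a countable union of images of compact intervals. -/
theorem measurableSet_arc (l : ℝ) (a : Index) : MeasurableSet (arc l a) := by
  have h : arc l a = ⋃ n : ℕ, turn '' Icc (((a.2 : ℕ) : ℝ) / 2 ^ a.1 + l)
      ((((a.2 : ℕ) : ℝ) + 1) / 2 ^ a.1 + l - 1 / (n + 1)) := by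
    ext ζ
    simp only [mem_arc_iff, mem_iUnion, mem_image, mem_Icc]
    constructor
    · rintro ⟨θ, h1, h2, rfl⟩
      obtain ⟨n, hn⟩ := exists_nat_one_div_lt (sub_pos.2 h2)
      exact ⟨n, θ, ⟨h1, by linarith⟩, rfl⟩
    · rintro ⟨n, θ, ⟨h1, h2⟩, rfl⟩
      refine ⟨θ, h1, h2.trans_lt ?_, rfl⟩
      have : (0 : ℝ) < 1 / (n + 1) := by positivity
      linarith
  rw [h]
  exact MeasurableSet.iUnion fun n => (isCompact_Icc.image continuous_turn).measurableSet

theorem measurableSet_kube (l : ℝ) (a : Index) : MeasurableSet (kube l a) := by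
  have h : kube l a = {z : ℂ | z ∈ ball (0 : ℂ) 1 ∧ Real.tanh (a.1 * step) ≤ ‖z‖ ∧
      ‖z‖ < Real.tanh (((a.1 + 1 : ℕ) : ℝ) * step) ∧
      (a.1 ≠ 0 → z / (‖z‖ : ℂ) ∈ arc l a)} := by
    ext z; exact mem_kube_iff
  have hm : Measurable fun z : ℂ => z / (‖z‖ : ℂ) := by fun_prop
  have hlast : MeasurableSet {z : ℂ | a.1 ≠ 0 → z / (‖z‖ : ℂ) ∈ arc l a} := by
    by_cases ha : a.1 = 0
    · rw [show {z : ℂ | a.1 ≠ 0 → z / (‖z‖ : ℂ) ∈ arc l a} = univ from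
        eq_univ_of_forall fun _ h => absurd ha h]
      exact MeasurableSet.univ
    · rw [show {z : ℂ | a.1 ≠ 0 → z / (‖z‖ : ℂ) ∈ arc l a} =
        (fun z : ℂ => z / (‖z‖ : ℂ)) ⁻¹' arc l a from
        Set.ext fun _ => ⟨fun h => h ha, fun h _ => h⟩]
      exact hm (measurableSet_arc l a)
  rw [h]
  refine isOpen_ball.measurableSet.inter ((measurableSet_le measurable_const measurable_norm).inter
    ((measurableSet_lt measurable_norm measurable_const).inter hlast))

theorem measurableSet_dyadicTent (l : ℝ) (a : Index) : MeasurableSet (dyadicTent l a) :=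
  MeasurableSet.biUnion (to_countable _) fun b _ => measurableSet_kube l b

/-- A dyadic tent of generation `k` lies in a disc of radius `16 · 2⁻ᵏ` about a boundary point. -/
theorem dyadicTent_subset_ball_turn (l : ℝ) (a : Index) :
    dyadicTent l a ⊆ ball (turn (((a.2 : ℕ) : ℝ) / 2 ^ a.1 + l)) (16 / 2 ^ a.1) := by
  refine iUnion₂_subset fun b hb z hz => ?_
  have hb' := treeLE_iff.1 hb
  rw [mem_kube_iff] at hz
  obtain ⟨hz1, hz2, -, hz4⟩ := hz
  rw [mem_ball_zero_iff] at hz1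
  rw [mem_ball, dist_eq_norm]
  by_cases ha : a.1 = 0
  · have h16 : (16 : ℝ) / 2 ^ a.1 = 16 := by simp [ha]
    have := norm_sub_le z (turn (((a.2 : ℕ) : ℝ) / 2 ^ a.1 + l))
    rw [norm_turn] at this
    linarith
  have hb0 : b.1 ≠ 0 := by omega
  have hpow : (1 : ℝ) / 2 ^ b.1 ≤ 1 / 2 ^ a.1 := by
    have : (2 : ℝ) ^ a.1 ≤ 2 ^ b.1 := pow_le_pow_right₀ one_le_two hb'.1
    gcongr
  obtain ⟨θ, hθ1, hθ2, hθ⟩ := hz4 hb0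
  obtain ⟨φ, hφ1, hφ2, hφ⟩ := hb'.2 ha
  have hz0 : z ≠ 0 := by
    rintro rfl
    rw [zero_div] at hθ
    exact turn_ne_zero θ hθ.symm
  have ht : z = (‖z‖ : ℂ) * turn θ := by
    rw [← show _ = turn θ from hθ, mul_div_cancel₀]; exact Complex.ofReal_ne_zero.2 (norm_ne_zero_iff.2 hz0)
  have h1 : ‖z - turn θ‖ ≤ 2 * (1 / 2 ^ a.1) := by
    have h2 : z - turn θ = ((‖z‖ - 1 : ℝ) : ℂ) * turn θ := by
      nth_rewrite 1 [ht]; push_cast; ring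
    rw [h2, norm_mul, norm_turn, Complex.norm_real, Real.norm_eq_abs, abs_of_nonpos (by linarith),
      mul_one]
    rw [tanh_mul_step] at hz2
    have : (2 : ℝ) / (2 ^ b.1 + 1) ≤ 2 * (1 / 2 ^ b.1) := by
      rw [mul_one_div]; gcongr; linarith
    linarith
  set c := (((b.2 : ℕ) : ℝ) + 1 / 2) / 2 ^ b.1 + l with hc
  have h3 : ‖turn θ - turn c‖ ≤ 2 * Real.pi * (1 / 2 ^ a.1) := by
    refine (norm_turn_sub_turn_le θ c).trans ?_
    gcongr
    refine le_trans ?_ hpow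
    rw [hc]
    rw [add_div] at hθ2 ⊢
    have : (1 / 2 : ℝ) / 2 ^ b.1 = (1 / 2 ^ b.1) / 2 := by ring
    have hp : (0 : ℝ) < 1 / 2 ^ b.1 := by positivity
    rw [abs_le]
    constructor <;> linarith
  have h4 : ‖turn c - turn (((a.2 : ℕ) : ℝ) / 2 ^ a.1 + l)‖ ≤ 2 * Real.pi * (1 / 2 ^ a.1) := by
    rw [show turn c = turn φ from hφ]
    refine (norm_turn_sub_turn_le φ _).trans ?_
    gcongr
    rw [add_div] at hφ2
    rw [abs_le]
    have hp : (0 : ℝ) < 1 / 2 ^ a.1 := by positivity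
    constructor <;> linarith
  -- The three displacements, radial, along the arc of b and along the arc of a, total at most (2 +
  -- 4π) 2⁻ᵏ < 16 · 2⁻ᵏ, k being the generation of a.
  have h5 : z - turn (((a.2 : ℕ) : ℝ) / 2 ^ a.1 + l) = (z - turn θ) + (turn θ - turn c) +
      (turn c - turn (((a.2 : ℕ) : ℝ) / 2 ^ a.1 + l)) := by ring
  rw [h5]
  have h6 := norm_add₃_le (a := z - turn θ) (b := turn θ - turn c)
    (c := turn c - turn (((a.2 : ℕ) : ℝ) / 2 ^ a.1 + l))
  have hp : (0 : ℝ) < 1 / 2 ^ a.1 := by positivity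
  have h7 : (16 : ℝ) / 2 ^ a.1 = 16 * (1 / 2 ^ a.1) := by ring
  rw [h7]
  nlinarith [Real.pi_lt_d2]

/-- A kube of generation `k` contains a disc of radius `2⁻ᵏ / 6`. -/
theorem exists_ball_subset_kube (l : ℝ) (a : Index) :
    ∃ c : ℂ, ball c ((1 / 2 ^ a.1) / 6) ⊆ kube l a := by
  by_cases ha : a.1 = 0
  · refine ⟨0, fun z hz => mem_kube_iff.2 ?_⟩
    rw [mem_ball_zero_iff, ha] at hz
    rw [mem_ball_zero_iff, ha, tanh_mul_step, tanh_mul_step]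
    norm_num at hz ⊢
    exact ⟨by linarith, by linarith⟩
  set q : ℝ := 1 / 2 ^ a.1 with hq
  have hqpos : 0 < q := by positivity
  have hqinv : (2 : ℝ) ^ a.1 * q = 1 := by rw [hq, mul_one_div_cancel]; positivity
  have hq2 : q ≤ 1 / 2 := by
    have : (2 : ℝ) ^ 1 ≤ 2 ^ a.1 := pow_le_pow_right₀ one_le_two (Nat.pos_of_ne_zero ha)
    rw [hq]
    gcongr
    linarith
  have e1 : Real.tanh (a.1 * step) = 1 - 2 * q / (1 + q) := by
    rw [tanh_mul_step, show (2 : ℝ) ^ a.1 = 1 / q by rw [hq, one_div_one_div]]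
    field_simp
  have e2 : Real.tanh (((a.1 + 1 : ℕ) : ℝ) * step) = 1 - 2 * q / (2 + q) := by
    rw [tanh_mul_step, pow_succ, show (2 : ℝ) ^ a.1 = 1 / q by rw [hq, one_div_one_div]]
    field_simp
  set ρ₁ := 1 - 2 * q / (1 + q) with hρ₁
  set ρ₂ := 1 - 2 * q / (2 + q) with hρ₂
  -- The annulus of the kube has width at least q/3, so a disc of radius q/6 about its middle circle
  -- stays inside it.
  have hdiff : ρ₁ + q / 3 ≤ ρ₂ := by
    have : 2 * q / (1 + q) - 2 * q / (2 + q) - q / 3 =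
        q * (6 - (1 + q) * (2 + q)) / (3 * (1 + q) * (2 + q)) := by
      field_simp; ring
    have h2 : 0 ≤ q * (6 - (1 + q) * (2 + q)) / (3 * (1 + q) * (2 + q)) := by
      apply div_nonneg _ (by positivity)
      apply mul_nonneg hqpos.le
      nlinarith
    linarith
  have hρ1lower : 1 / 3 ≤ ρ₁ := by
    have : 2 * q / (1 + q) ≤ 2 / 3 := by
      rw [div_le_div_iff₀ (by positivity) (by positivity)]; linarith
    linarith
  have hρ2upper : ρ₂ < 1 := by
    have : 0 < 2 * q / (2 + q) := by positivity
    linarith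
  set φ := (((a.2 : ℕ) : ℝ) + 1 / 2) / 2 ^ a.1 + l with hφ
  set ρ := (ρ₁ + ρ₂) / 2 with hρ
  have hρpos : 0 < ρ := by rw [hρ]; linarith
  refine ⟨(ρ : ℂ) * turn φ, fun z hz => mem_kube_iff.2 ?_⟩
  rw [mem_ball, dist_eq_norm] at hz
  have hcn : ‖(ρ : ℂ) * turn φ‖ = ρ := by
    rw [norm_mul, norm_turn, mul_one, Complex.norm_real, Real.norm_eq_abs, abs_of_pos hρpos]
  have hrad := (abs_norm_sub_norm_le z ((ρ : ℂ) * turn φ)).trans_lt hz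
  rw [hcn, abs_lt] at hrad
  have hlow : ρ₁ ≤ ‖z‖ := by linarith
  have hup : ‖z‖ < ρ₂ := by linarith
  rw [e1, e2, mem_ball_zero_iff]
  refine ⟨by linarith, hlow, hup, fun _ => ?_⟩
  have hz0 : 0 < ‖z‖ := by linarith
  have hzne : z ≠ 0 := norm_pos_iff.1 hz0
  have hu := norm_div_norm hzne
  set u := z / (‖z‖ : ℂ) with hudef
  have hzu : z = (‖z‖ : ℂ) * u := by
    rw [hudef, mul_div_cancel₀]; exact Complex.ofReal_ne_zero.2 hz0.ne'
  -- Two errors of size q/6 arise, from z and from its radius. As ρ ≥ 1/3 the directions differ by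
  -- less than q, hence by less than q/4 in turns, within the half-width q/2 of the arc.
  have hdist : ρ * ‖u - turn φ‖ < q / 3 := by
    have h1 : (ρ : ℂ) * (u - turn φ) = (z - (ρ : ℂ) * turn φ) + ((ρ - ‖z‖ : ℝ) : ℂ) * u := by
      push_cast; linear_combination -hzu
    have h2 : ‖(ρ : ℂ) * (u - turn φ)‖ = ρ * ‖u - turn φ‖ := by
      rw [norm_mul, Complex.norm_real, Real.norm_eq_abs, abs_of_pos hρpos]
    rw [← h2, h1]
    refine (norm_add_le _ _).trans_lt ?_
    rw [norm_mul, hu, mul_one, Complex.norm_real, Real.norm_eq_abs]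
    have : |ρ - ‖z‖| < q / 6 := by rw [abs_lt]; constructor <;> linarith
    linarith
  have hdist2 : ‖u - turn φ‖ < q := by
    have : 1 / 3 * ‖u - turn φ‖ ≤ ρ * ‖u - turn φ‖ := by
      gcongr; rw [hρ]; linarith
    linarith
  obtain ⟨θ, hθ, hθφ⟩ := exists_turn_near hu φ
  rw [abs_le] at hθφ
  have hφ' : φ = ((a.2 : ℕ) : ℝ) / 2 ^ a.1 + l + q / 2 := by rw [hφ, hq]; ring
  refine ⟨θ, by linarith, ?_, hθ⟩
  have : (((a.2 : ℕ) : ℝ) + 1) / 2 ^ a.1 + l = ((a.2 : ℕ) : ℝ) / 2 ^ a.1 + l + q := by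
    rw [hq]; ring
  rw [this]
  linarith

/-- The kube containing z is found by taking integer parts of its hyperbolic distance and of its
angle; nesting of dyadic intervals makes it a descendant of a. -/
theorem mem_dyadicTent {l : ℝ} {a : Index} {z : ℂ} (hz : z ∈ ball (0 : ℂ) 1) {θ : ℝ}
    (hzθ : z / (‖z‖ : ℂ) = turn θ) (hrad : Real.tanh (a.1 * step) ≤ ‖z‖)
    (h1 : ((a.2 : ℕ) : ℝ) / 2 ^ a.1 + l ≤ θ)
    (h2 : θ < (((a.2 : ℕ) : ℝ) + 1) / 2 ^ a.1 + l) : z ∈ dyadicTent l a := by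
  set K := ⌊bergmanDist 0 z / step⌋₊ with hK
  have hd := (le_bergmanDist_iff hz _).2 hrad
  have hd0 : 0 ≤ bergmanDist 0 z := le_trans (mul_nonneg a.1.cast_nonneg step_pos.le) hd
  have hkK : a.1 ≤ K := Nat.le_floor ((le_div_iff₀ step_pos).2 hd)
  have hK1 : (K : ℝ) * step ≤ bergmanDist 0 z :=
    (le_div_iff₀ step_pos).1 (Nat.floor_le (div_nonneg hd0 step_pos.le))
  have hK2 : bergmanDist 0 z < ((K : ℝ) + 1) * step :=
    (div_lt_iff₀ step_pos).1 (Nat.lt_floor_add_one _)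
  have hj0 : (0 : ℝ) ≤ ((a.2 : ℕ) : ℝ) / 2 ^ a.1 := by positivity
  have hj1 := index_div_lt_one a
  have hpos : (0 : ℝ) < 2 ^ K := by positivity
  have ht0 : 0 ≤ (θ - l) * 2 ^ K := mul_nonneg (by linarith) hpos.le
  set j := ⌊(θ - l) * 2 ^ K⌋₊ with hj
  have hf1 : (j : ℝ) ≤ (θ - l) * 2 ^ K := Nat.floor_le ht0
  have hf2 : (θ - l) * 2 ^ K < j + 1 := Nat.lt_floor_add_one _
  have hjlt : j < 2 ^ K := by
    rw [Nat.floor_lt ht0]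
    push_cast
    nlinarith
  have hzero : K ≠ 0 → z ≠ 0 := by
    rintro - rfl
    rw [zero_div] at hzθ
    exact turn_ne_zero θ hzθ.symm
  let b : Index := ⟨K, ⟨j, hjlt⟩⟩
  have hzb : z ∈ kube l b := by
    refine mem_kube_iff.2 ⟨hz, (le_bergmanDist_iff hz _).1 hK1, ?_, fun _ => ⟨θ, ?_, ?_, hzθ⟩⟩
    · rw [← not_le, ← le_bergmanDist_iff hz, not_le]
      push_cast
      exact hK2
    · rw [← le_sub_iff_add_le, div_le_iff₀ hpos]; exact hf1
    · rw [← sub_lt_iff_lt_add, lt_div_iff₀ hpos]; exact hf2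
  refine mem_biUnion (x := b) (treeLE_iff.2 ⟨hkK, fun _ => ⟨_, ?_, ?_, rfl⟩⟩) hzb
  -- With 2ᴷ = 2ᵏ · 2ᵈ (k the generation of a), the integer j satisfies a.2 · 2ᵈ ≤ j < (a.2 + 1) ·
  -- 2ᵈ, so the midpoint j + 1/2 lies in the parent interval.
  all_goals
    obtain ⟨d, hd⟩ := Nat.exists_eq_add_of_le hkK
    have hpow : (2 : ℝ) ^ K = 2 ^ a.1 * 2 ^ d := by rw [hd, pow_add]
    have hpa : (0 : ℝ) < 2 ^ a.1 := by positivity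
    have hpd : (0 : ℝ) < 2 ^ d := by positivity
  · have : (a.2 : ℕ) * 2 ^ d ≤ j := by
      refine Nat.le_floor ?_
      push_cast
      rw [← le_sub_iff_add_le, div_le_iff₀ hpa] at h1
      rw [hpow, ← mul_assoc]
      exact mul_le_mul_of_nonneg_right h1 hpd.le
    have this' : ((a.2 : ℕ) : ℝ) * 2 ^ d ≤ j := by exact_mod_cast this
    change ((a.2 : ℕ) : ℝ) / 2 ^ a.1 + l ≤ ((j : ℝ) + 1 / 2) / 2 ^ K + l
    rw [hpow, ← mul_div_mul_right _ _ hpd.ne']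
    gcongr
    linarith
  · have : j < ((a.2 : ℕ) + 1) * 2 ^ d := by
      rw [Nat.floor_lt ht0]
      push_cast
      rw [← sub_lt_iff_lt_add, lt_div_iff₀ hpa] at h2
      rw [hpow, ← mul_assoc]
      exact mul_lt_mul_of_pos_right h2 hpd
    have this' : (j : ℝ) + 1 ≤ (((a.2 : ℕ) : ℝ) + 1) * 2 ^ d := by exact_mod_cast this
    change ((j : ℝ) + 1 / 2) / 2 ^ K + l < (((a.2 : ℕ) : ℝ) + 1) / 2 ^ a.1 + l
    rw [hpow, ← mul_div_mul_right (((a.2 : ℕ) : ℝ) + 1) _ hpd.ne']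
    gcongr
    linarith

theorem ball_subset_dyadicTent {l : ℝ} {a : Index} (ha : a.1 = 0) :
    ball (0 : ℂ) 1 ⊆ dyadicTent l a := by
  intro z hz
  have htanh : Real.tanh (a.1 * step) = 0 := by rw [ha]; simp
  rcases eq_or_ne z 0 with rfl | h
  · refine kube_subset_dyadicTent l a (mem_kube_iff.2 ⟨hz, ?_, ?_, fun h => absurd ha h⟩)
    · rw [htanh, norm_zero]
    · rw [norm_zero]
      exact tanh_pos (mul_pos (by positivity) step_pos)
  · obtain ⟨θ, h1, h2, hθ⟩ := exists_turn_Ico (norm_div_norm h) l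
    have hj : (a.2 : ℕ) = 0 := by
      have := a.2.2
      have hp : 2 ^ a.1 = 1 := by rw [ha, pow_zero]
      omega
    have hp : (2 : ℝ) ^ a.1 = 1 := by rw [ha, pow_zero]
    refine mem_dyadicTent hz hθ (htanh ▸ norm_nonneg z) ?_ ?_
    · rw [hj, hp]; simpa using h1
    · rw [hj, hp]; simpa [add_comm] using h2

/-- The one-third trick: a short arc lies in a dyadic arc of one of two systems. -/
theorem exists_dyadic_arc (n : ℕ) (φ : ℝ) {δ : ℝ} (hδ : 3 * δ * 2 ^ n ≤ 1) :
    ∃ l ∈ ({0, 1 / 3} : Finset ℝ), ∃ a : Index, a.1 = n ∧ ∃ q : ℤ, ∀ θ : ℝ, |θ - φ| < δ / 2 →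
      ((a.2 : ℕ) : ℝ) / 2 ^ a.1 + l ≤ θ - q ∧ θ - q < (((a.2 : ℕ) : ℝ) + 1) / 2 ^ a.1 + l := by
  have hpos : (0 : ℝ) < 2 ^ n := by positivity
  have hfin : ∀ l : ℝ, (φ + δ / 2 - l) * 2 ^ n ≤ ⌊(φ - δ / 2 - l) * 2 ^ n⌋ + 1 →
      ∃ a : Index, a.1 = n ∧ ∃ q : ℤ, ∀ θ : ℝ, |θ - φ| < δ / 2 →
      ((a.2 : ℕ) : ℝ) / 2 ^ a.1 + l ≤ θ - q ∧
        θ - q < (((a.2 : ℕ) : ℝ) + 1) / 2 ^ a.1 + l := by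
    intro l hl
    set J := ⌊(φ - δ / 2 - l) * 2 ^ n⌋ with hJ
    have hJ1 : (J : ℝ) ≤ (φ - δ / 2 - l) * 2 ^ n := Int.floor_le _
    have hN : (0 : ℤ) < 2 ^ n := by positivity
    have hm0 := Int.emod_nonneg J hN.ne'
    have hm1 := Int.emod_lt_of_pos J hN
    have hdm := Int.emod_add_mul_ediv J (2 ^ n)
    set m := J % 2 ^ n with hm
    have hmn : ((m.toNat : ℕ) : ℤ) = m := Int.toNat_of_nonneg hm0
    have hlt : m.toNat < 2 ^ n := by
      have : ((m.toNat : ℕ) : ℤ) < ((2 ^ n : ℕ) : ℤ) := by rw [hmn]; push_cast; exact hm1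
      exact_mod_cast this
    -- Positions are taken modulo 2ⁿ; the quotient counts the whole turns to be removed from θ.
    refine ⟨⟨n, ⟨m.toNat, hlt⟩⟩, rfl, J / 2 ^ n, fun θ hθ => ?_⟩
    set q := J / 2 ^ n with hq
    have hmr : ((m.toNat : ℕ) : ℝ) = J - 2 ^ n * q := by
      have h1 : (((m.toNat : ℕ) : ℤ) : ℝ) = ((J - 2 ^ n * q : ℤ) : ℝ) := by
        rw [hmn]; congr 1; linarith
      push_cast at h1
      exact h1
    rw [abs_lt] at hθ
    change ((m.toNat : ℕ) : ℝ) / 2 ^ n + l ≤ θ - q ∧ θ - q < (((m.toNat : ℕ) : ℝ) + 1) / 2 ^ n + l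
    rw [hmr, ← le_sub_iff_add_le, ← sub_lt_iff_lt_add, div_le_iff₀ hpos, lt_div_iff₀ hpos]
    constructor <;> nlinarith
  by_cases h0 : (φ + δ / 2 - 0) * 2 ^ n ≤ ⌊(φ - δ / 2 - 0) * 2 ^ n⌋ + 1
  · exact ⟨0, by simp, hfin 0 h0⟩
  refine ⟨1 / 3, by simp, hfin _ ?_⟩
  -- If both systems fail, a grid point of each lies in a common interval of length at most 2⁻ⁿ/3.
  -- This forces |3(J - J') - 2ⁿ| < 1, so 3 would divide a power of 2.
  by_contra h1
  push Not at h0 h1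
  set J := ⌊(φ - δ / 2 - 0) * 2 ^ n⌋ with hJ
  set J' := ⌊(φ - δ / 2 - 1 / 3) * 2 ^ n⌋ with hJ'
  have e1 : (φ - δ / 2 - 0) * 2 ^ n < J + 1 := Int.lt_floor_add_one _
  have e2 : (φ - δ / 2 - 1 / 3) * 2 ^ n < J' + 1 := Int.lt_floor_add_one _
  have f1 : (3 * (J - J') - 2 ^ n : ℝ) < 1 := by linarith
  have f2 : (-1 : ℝ) < 3 * (J - J') - 2 ^ n := by linarith
  have g1 : 3 * (J - J') - 2 ^ n < 1 := by exact_mod_cast f1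
  have g2 : -1 < 3 * (J - J') - 2 ^ n := by exact_mod_cast f2
  have g3 : (2 : ℤ) ^ n = 3 * (J - J') := by omega
  have g4 : (3 : ℤ) ∣ 2 := Int.prime_three.dvd_of_dvd_pow (g3 ▸ dvd_mul_right 3 _)
  omega

/-- A tent of size δ spans an arc of length comparable to δ. It therefore fits in a dyadic tent of
generation n with 2ⁿ ≈ 1/(3δ) in one of the two systems of `exists_dyadic_arc`. -/
theorem exists_isAdmissible : ∃ L : Finset ℝ, IsAdmissible L := by
  refine ⟨{0, 1 / 3}, 36864, fun z hz => ?_⟩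
  have hz1 : ‖z‖ < 1 := mem_ball_zero_iff.1 hz
  set δ := 1 - ‖z‖ with hδ
  have hδ0 : 0 < δ := sub_pos.2 hz1
  have hlow := le_volume_carlesonTent hz
  rw [← hδ] at hlow
  have harea : ∀ {s : Set ℂ} {r : ℝ}, volume s ≤ ENNReal.ofReal (Real.pi * r ^ 2) →
      r ^ 2 ≤ 36864 * (δ / 2) ^ 2 →
      volume s ≤ ((36864 : ℝ≥0) : ℝ≥0∞) * volume (carlesonTent z) := by
    intro s r hs hr
    refine hs.trans (le_trans ?_ (mul_le_mul_right hlow _))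
    rw [show ((36864 : ℝ≥0) : ℝ≥0∞) = ENNReal.ofReal 36864 by simp,
      ← ENNReal.ofReal_mul (by norm_num)]
    refine ENNReal.ofReal_le_ofReal ?_
    nlinarith [Real.pi_pos]
  rcases le_or_gt (1 / 3) δ with h | h
  · refine ⟨0, by simp, ⟨0, 0⟩, (carlesonTent_subset z).trans (ball_subset_dyadicTent rfl),
      harea (r := 1) ((measure_mono (dyadicTent_subset_ball _ _)).trans_eq
        (volume_ball_eq _ zero_le_one)) ?_⟩
    nlinarith
  have hz0 : z ≠ 0 := by
    rintro rfl
    rw [norm_zero] at hδ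
    linarith
  obtain ⟨n, hn1, hn2⟩ := exists_nat_pow_near
    (show 1 ≤ 1 / (3 * δ) by rw [le_div_iff₀ (by positivity)]; linarith) (one_lt_two (α := ℝ))
  rw [le_div_iff₀ (by positivity)] at hn1
  rw [div_lt_iff₀ (by positivity), pow_succ] at hn2
  obtain ⟨φ, hφ, -⟩ := exists_turn_near (norm_div_norm hz0) 0
  obtain ⟨l, hl, a, rfl, q, ha⟩ := exists_dyadic_arc n φ (δ := δ) (by linarith)
  have hp : (1 : ℝ) ≤ 2 ^ a.1 := one_le_pow₀ one_le_two
  refine ⟨l, hl, a, fun w hw => ?_, harea (r := 16 / 2 ^ a.1)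
    ((measure_mono (dyadicTent_subset_ball_turn l a)).trans_eq
      (volume_ball_eq _ (by positivity))) ?_⟩
  · rw [carlesonTent_of_ne_zero hz0, hφ, ← hδ] at hw
    have hwd : ‖w - turn φ‖ < δ := mem_ball_iff_norm.1 hw.1
    have hw1 : ‖w‖ < 1 := mem_ball_zero_iff.1 hw.2
    have hwn : 1 - δ < ‖w‖ := by
      have := norm_sub_norm_le (turn φ) w
      rw [norm_turn, norm_sub_rev] at this
      linarith
    have hw0 : w ≠ 0 := norm_pos_iff.1 (by linarith)
    have hu := norm_div_norm hw0
    -- Projecting w to the circle costs at most another δ; `exists_turn_near` converts the chord 2δ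
    -- into δ/2 turns, the tolerance in `exists_dyadic_arc`.
    have huw : ‖w / (‖w‖ : ℂ) - turn φ‖ < 2 * δ := by
      have e1 : w / (‖w‖ : ℂ) - turn φ = ((1 - ‖w‖ : ℝ) : ℂ) * (w / (‖w‖ : ℂ)) +
          (w - turn φ) := by
        have : (‖w‖ : ℂ) * (w / (‖w‖ : ℂ)) = w :=
          mul_div_cancel₀ _ (Complex.ofReal_ne_zero.2 (norm_ne_zero_iff.2 hw0))
        push_cast
        linear_combination this
      rw [e1]
      refine (norm_add_le _ _).trans_lt ?_
      rw [norm_mul, hu, Complex.norm_real, Real.norm_eq_abs, abs_of_pos (by linarith)]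
      linarith
    obtain ⟨θ, hθ, hθφ⟩ := exists_turn_near hu φ
    obtain ⟨h1, h2⟩ := ha θ (by linarith)
    refine mem_dyadicTent hw.2 (θ := θ - q) ?_ ?_ h1 h2
    · rw [hθ, turn_eq_turn_iff]
      exact ⟨q, by ring⟩
    · rw [tanh_mul_step]
      have : δ ≤ 2 / (2 ^ a.1 + 1) := by
        rw [le_div_iff₀ (by positivity)]
        nlinarith
      linarith
  -- The maximal choice of n gives 2⁻ⁿ < 6δ, and (96δ)² = 36864 (δ/2)².
  · have : 16 / 2 ^ a.1 ≤ 96 * δ := by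
      rw [div_le_iff₀ (by positivity)]
      linarith
    have h2 : (16 / 2 ^ a.1) ^ 2 ≤ (96 * δ) ^ 2 := by gcongr
    linarith

/-! ### Comparison of areas -/

/-- The constant is (16 · 6)² = 9216, the area ratio of the disc around the tent and the disc inside
the kube. -/
theorem le_volume_kube (l : ℝ) (a : Index) :
    ENNReal.ofReal (Real.pi * (16 / 2 ^ a.1) ^ 2) ≤ 9216 * volume (kube l a) := by
  obtain ⟨c, hc⟩ := exists_ball_subset_kube l a
  have h := measure_mono (μ := volume) hc
  rw [volume_ball_eq _ (by positivity)] at h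
  refine le_trans ?_ (mul_le_mul_right h _)
  rw [show (9216 : ℝ≥0∞) = ENNReal.ofReal 9216 by simp, ← ENNReal.ofReal_mul (by norm_num)]
  exact ENNReal.ofReal_le_ofReal (le_of_eq (by ring))

theorem volume_dyadicTent_le (l : ℝ) (a : Index) :
    volume (dyadicTent l a) ≤ 9216 * volume (kube l a) :=
  ((measure_mono (dyadicTent_subset_ball_turn l a)).trans_eq
    (volume_ball_eq _ (by positivity))).trans (le_volume_kube l a)

theorem volume_kube_pos (l : ℝ) (a : Index) : 0 < volume (kube l a) := by
  obtain ⟨c, hc⟩ := exists_ball_subset_kube l a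
  exact (measure_ball_pos _ _ (by positivity)).trans_le (measure_mono hc)

/-- Converse to admissibility, valid for every shift: it transfers the characteristic, defined with
Carleson tents, to dyadic tents. Once 16 · 2⁻ᵏ ≥ 1 the whole disc serves. -/
theorem exists_carlesonTent_of_dyadicTent (l : ℝ) (a : Index) : ∃ ζ ∈ ball (0 : ℂ) 1,
    dyadicTent l a ⊆ carlesonTent ζ ∧ volume (carlesonTent ζ) ≤ 9216 * volume (kube l a) := by
  have hlow := le_volume_kube l a
  rcases lt_or_ge (16 / 2 ^ a.1 : ℝ) 1 with h | h
  · refine ⟨_, smul_mem_ball (norm_turn (((a.2 : ℕ) : ℝ) / 2 ^ a.1 + l)) (by positivity) h, ?_⟩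
    rw [carlesonTent_smul (norm_turn _) h]
    exact ⟨subset_inter (dyadicTent_subset_ball_turn l a) (dyadicTent_subset_ball l a),
      ((measure_mono inter_subset_left).trans_eq (volume_ball_eq _ (by positivity))).trans hlow⟩
  · refine ⟨0, mem_ball_self one_pos, ?_⟩
    rw [carlesonTent_zero]
    refine ⟨dyadicTent_subset_ball l a, le_trans (le_of_eq (volume_ball_eq _ zero_le_one))
      (le_trans (ENNReal.ofReal_le_ofReal ?_) hlow)⟩
    gcongr

open Function

/-! ### The abstract sparse estimate -/

/-- Write ab/u = [(b/u)(a/u)^{p-1}] · u^{p-1} a^{2-p}. Since p ≥ 2, the exponent 2 - p is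
nonpositive, so a may be lowered to a', while u is replaced by κ u'. The Hölder bound on u' then
makes the exponents collapse to 1/p and 1/q. -/
theorem mul_div_le_of_characteristic_le {p q a b u a' b' u' κ Q : ℝ} (hpq : p.HolderConjugate q)
    (hp : 2 ≤ p) (hb : 0 < b) (hu : 0 < u) (ha' : 0 < a') (hb' : 0 < b')
    (hu' : 0 < u') (hκ : 0 ≤ κ) (haa : a' ≤ a) (huu : u ≤ κ * u')
    (hE : u' ≤ a' ^ (1 / q) * b' ^ (1 / p)) (hQ : b / u * (a / u) ^ (p - 1) ≤ Q) :
    a * b / u ≤ κ ^ (p - 1) * Q * (a' ^ (1 / p) * b' ^ (1 / q)) := by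
  have ha : 0 < a := ha'.trans_le haa
  have hp0 : 0 < p := by linarith
  have hQ0 : 0 ≤ Q := le_trans (by positivity) hQ
  have e1 : a * b / u = (b / u * (a / u) ^ (p - 1)) * (u ^ (p - 1) * a ^ (2 - p)) := by
    rw [Real.div_rpow ha.le hu.le, show (2 - p) = 1 - (p - 1) by ring, Real.rpow_sub ha 1 (p - 1),
      Real.rpow_one]
    field_simp
  have h1 : u ^ (p - 1) ≤ κ ^ (p - 1) * u' ^ (p - 1) := by
    rw [← Real.mul_rpow hκ hu'.le]
    exact Real.rpow_le_rpow hu.le huu (by linarith)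
  have h2 : a ^ (2 - p) ≤ a' ^ (2 - p) := Real.rpow_le_rpow_of_nonpos ha' haa (by linarith)
  have h3 : u' ^ (p - 1) ≤ (a' ^ (1 / q) * b' ^ (1 / p)) ^ (p - 1) :=
    Real.rpow_le_rpow hu'.le hE (by linarith)
  have hq1 : 1 / q = 1 - 1 / p := by
    have := hpq.inv_add_inv_eq_one
    rw [one_div, one_div]; linarith
  have e2 : (a' ^ (1 / q) * b' ^ (1 / p)) ^ (p - 1) * a' ^ (2 - p) =
      a' ^ (1 / p) * b' ^ (1 / q) := by
    rw [Real.mul_rpow (by positivity) (by positivity), ← Real.rpow_mul ha'.le,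
      ← Real.rpow_mul hb'.le, mul_right_comm, ← Real.rpow_add ha', hq1]
    congr 2
    · field_simp
      ring
    · field_simp
  rw [e1]
  calc (b / u * (a / u) ^ (p - 1)) * (u ^ (p - 1) * a ^ (2 - p))
      ≤ Q * ((κ ^ (p - 1) * (a' ^ (1 / q) * b' ^ (1 / p)) ^ (p - 1)) * a' ^ (2 - p)) := by
        gcongr
        exact h1.trans (by gcongr)
    _ = κ ^ (p - 1) * Q * ((a' ^ (1 / q) * b' ^ (1 / p)) ^ (p - 1) * a' ^ (2 - p)) := by ring
    _ = _ := by rw [e2]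

/-- The real inequality transported to extended reals. Positivity of a' and b' is forced by the
Hölder bound, as u' is nonzero. -/
theorem mul_mul_inv_le_of_characteristic_le {p q : ℝ} {a b u a' b' u' κ Q : ℝ≥0∞}
    (hpq : p.HolderConjugate q) (hp : 2 ≤ p) (ha : a ≠ ∞) (hb : b ≠ ∞) (hu : u ≠ ∞)
    (hκ : κ ≠ ∞) (hQt : Q ≠ ∞) (hu' : u' ≠ 0) (haa : a' ≤ a) (hbb : b' ≤ b) (huu' : u' ≤ u)
    (huu : u ≤ κ * u') (hE : u' ≤ a' ^ (1 / q) * b' ^ (1 / p))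
    (hQ : b / u * (a / u) ^ (p - 1) ≤ Q) :
    u⁻¹ * a * b ≤ κ ^ (p - 1) * Q * (a' ^ (1 / p) * b' ^ (1 / q)) := by
  have hp0 : 0 < p := hpq.pos
  have hq0 : 0 < q := hpq.symm.pos
  have hp1 : 0 ≤ p - 1 := by linarith
  have ha'0 : a' ≠ 0 := by
    rintro rfl
    rw [ENNReal.zero_rpow_of_pos (by positivity), zero_mul] at hE
    exact hu' (le_zero_iff.1 hE)
  have hb'0 : b' ≠ 0 := by
    rintro rfl
    rw [ENNReal.zero_rpow_of_pos (by positivity), mul_zero] at hE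
    exact hu' (le_zero_iff.1 hE)
  have ha't := ne_top_of_le_ne_top ha haa
  have hb't := ne_top_of_le_ne_top hb hbb
  have hu't := ne_top_of_le_ne_top hu huu'
  have hu0 : u ≠ 0 := fun h => hu' (le_zero_iff.1 (h ▸ huu'))
  have hb0 : b ≠ 0 := fun h => hb'0 (le_zero_iff.1 (h ▸ hbb))
  have hrp : ∀ {x : ℝ≥0∞} {r : ℝ}, x ≠ ∞ → 0 ≤ r → x ^ r ≠ ∞ := fun hx hr =>
    ENNReal.rpow_ne_top_of_nonneg hr hx
  have hr : κ ^ (p - 1) * Q * (a' ^ (1 / p) * b' ^ (1 / q)) ≠ ∞ :=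
    ENNReal.mul_ne_top (ENNReal.mul_ne_top (hrp hκ hp1) hQt)
      (ENNReal.mul_ne_top (hrp ha't (by positivity)) (hrp hb't (by positivity)))
  have hl : u⁻¹ * a * b ≠ ∞ :=
    ENNReal.mul_ne_top (ENNReal.mul_ne_top (ENNReal.inv_ne_top.2 hu0) ha) hb
  have hE' := ENNReal.toReal_mono (ENNReal.mul_ne_top (hrp ha't (by positivity))
    (hrp hb't (by positivity))) hE
  have hQ' := ENNReal.toReal_mono hQt hQ
  have huu1 := ENNReal.toReal_mono (ENNReal.mul_ne_top hκ hu't) huu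
  rw [← ENNReal.toReal_le_toReal hl hr]
  simp only [ENNReal.toReal_mul, ENNReal.toReal_inv, ENNReal.toReal_div,
    ← ENNReal.toReal_rpow] at hE' hQ' huu1 ⊢
  refine le_trans (le_of_eq (by ring)) (mul_div_le_of_characteristic_le (a := a.toReal)
    (b := b.toReal) (u := u.toReal) hpq hp (ENNReal.toReal_pos hb0 hb)
    (ENNReal.toReal_pos hu0 hu) (ENNReal.toReal_pos ha'0 ha't) (ENNReal.toReal_pos hb'0 hb't)
    (ENNReal.toReal_pos hu' hu't) ENNReal.toReal_nonneg (ENNReal.toReal_mono ha haa) huu1 hE' hQ')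

theorem tsum_mul_le_Lp_mul_Lq {ι : Type*} {p q : ℝ} (hpq : p.HolderConjugate q)
    (f g : ι → ℝ≥0∞) :
    ∑' i, f i * g i ≤ (∑' i, f i ^ p) ^ (1 / p) * (∑' i, g i ^ q) ^ (1 / q) := by
  let _ : MeasurableSpace ι := ⊤
  have h := ENNReal.lintegral_mul_le_Lp_mul_Lq Measure.count hpq
    (measurable_from_top (f := f)).aemeasurable (measurable_from_top (f := g)).aemeasurable
  simpa [lintegral_count] using h

/-- The only use of disjointness: the average m i is controlled by M on E i, and the integrals over
the E i add up. -/
theorem tsum_rpow_mul_measure_le {X ι : Type*} [MeasurableSpace X] [Countable ι] {N : Measure X}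
    {E : ι → Set X} (hE : ∀ i, MeasurableSet (E i)) (hdisj : Pairwise (Disjoint on E))
    {M : X → ℝ≥0∞} {m : ι → ℝ≥0∞} (hM : ∀ i, ∀ x ∈ E i, m i ≤ M x) {p : ℝ} (hp : 0 ≤ p) :
    ∑' i, m i ^ p * N (E i) ≤ ∫⁻ x, M x ^ p ∂N := by
  calc ∑' i, m i ^ p * N (E i) ≤ ∑' i, ∫⁻ x in E i, M x ^ p ∂N := by
        refine ENNReal.tsum_le_tsum fun i => ?_
        rw [← setLIntegral_const]
        exact setLIntegral_mono_ae' (hE i) (ae_of_all _ fun x hx =>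
          ENNReal.rpow_le_rpow (hM i x hx) hp)
    _ = ∫⁻ x in ⋃ i, E i, M x ^ p ∂N := (lintegral_iUnion hE hdisj _).symm
    _ ≤ _ := setLIntegral_le_lintegral _ _

/-- Data for the sparse estimate: sets `T i` with pairwise disjoint large parts `E i ⊆ T i`, and
two weighted measures `N`, `S` whose geometric mean dominates the reference measure `U`. -/
structure SparseFamily {X : Type*} [MeasurableSpace X] {ι : Type*} (U N S : Measure X)
    (T E : ι → Set X) (κ : ℝ≥0∞) (p q : ℝ) : Prop where
  measurableSet : ∀ i, MeasurableSet (E i)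
  disjoint : Pairwise (Disjoint on E)
  subset : ∀ i, E i ⊆ T i
  measure_le : ∀ i, U (T i) ≤ κ * U (E i)
  measure_ne_zero : ∀ i, U (E i) ≠ 0
  ne_top : ∀ i, U (T i) ≠ ∞ ∧ N (T i) ≠ ∞ ∧ S (T i) ≠ ∞
  le_geom_mean : ∀ i, U (E i) ≤ N (E i) ^ (1 / q) * S (E i) ^ (1 / p)

theorem SparseFamily.symm {X : Type*} [MeasurableSpace X] {ι : Type*} {U N S : Measure X}
    {T E : ι → Set X} {κ : ℝ≥0∞} {p q : ℝ} (h : SparseFamily U N S T E κ p q) :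
    SparseFamily U S N T E κ q p where
  measurableSet := h.measurableSet
  disjoint := h.disjoint
  subset := h.subset
  measure_le := h.measure_le
  measure_ne_zero := h.measure_ne_zero
  ne_top i := ⟨(h.ne_top i).1, (h.ne_top i).2.2, (h.ne_top i).2.1⟩
  le_geom_mean i := (h.le_geom_mean i).trans_eq (mul_comm _ _)

/-- Factor each integral as average times mass. The masses over T i are moved to E i by the
characteristic, and Hölder for sums separates the two families of averages. -/
theorem SparseFamily.tsum_le_of_two_le {X : Type*} [MeasurableSpace X] {ι : Type*} [Countable ι]
    {U N S : Measure X} {T E : ι → Set X} {κ Q : ℝ≥0∞} {p q : ℝ}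
    (h : SparseFamily U N S T E κ p q) (hpq : p.HolderConjugate q) (hp : 2 ≤ p) (hκ : κ ≠ ∞)
    (hQt : Q ≠ ∞) (hQ : ∀ i, S (T i) / U (T i) * (N (T i) / U (T i)) ^ (p - 1) ≤ Q)
    {A B : ι → ℝ≥0∞} {MF MG : X → ℝ≥0∞}
    (hMF : ∀ i, ∀ x ∈ E i, A i / N (T i) ≤ MF x) (hMG : ∀ i, ∀ x ∈ E i, B i / S (T i) ≤ MG x) :
    ∑' i, (U (T i))⁻¹ * A i * B i ≤ κ ^ (p - 1) * Q *
      ((∫⁻ x, MF x ^ p ∂N) ^ (1 / p) * (∫⁻ x, MG x ^ q ∂S) ^ (1 / q)) := by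
  have hp0 := hpq.pos
  have hq0 := hpq.symm.pos
  have hne : ∀ i, N (E i) ≠ 0 ∧ S (E i) ≠ 0 := by
    intro i
    have h1 := h.le_geom_mean i
    refine ⟨fun h0 => h.measure_ne_zero i ?_, fun h0 => h.measure_ne_zero i ?_⟩
    · rw [h0, ENNReal.zero_rpow_of_pos (by positivity), zero_mul] at h1
      exact le_zero_iff.1 h1
    · rw [h0, ENNReal.zero_rpow_of_pos (by positivity), mul_zero] at h1
      exact le_zero_iff.1 h1
  have hterm : ∀ i, (U (T i))⁻¹ * A i * B i ≤ κ ^ (p - 1) * Q *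
      ((A i / N (T i) * N (E i) ^ (1 / p)) * (B i / S (T i) * S (E i) ^ (1 / q))) := by
    intro i
    obtain ⟨hUt, hNt, hSt⟩ := h.ne_top i
    have hN0 : N (T i) ≠ 0 := fun h0 => (hne i).1 (measure_mono_null (h.subset i) h0)
    have hS0 : S (T i) ≠ 0 := fun h0 => (hne i).2 (measure_mono_null (h.subset i) h0)
    have key := mul_mul_inv_le_of_characteristic_le hpq hp hNt hSt hUt hκ hQt
      (h.measure_ne_zero i) (measure_mono (h.subset i)) (measure_mono (h.subset i))
      (measure_mono (h.subset i)) (h.measure_le i) (h.le_geom_mean i) (hQ i)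
    calc (U (T i))⁻¹ * A i * B i = (U (T i))⁻¹ * (A i / N (T i) * N (T i)) *
          (B i / S (T i) * S (T i)) := by
          rw [ENNReal.div_mul_cancel hN0 hNt, ENNReal.div_mul_cancel hS0 hSt]
      _ = (A i / N (T i)) * (B i / S (T i)) * ((U (T i))⁻¹ * N (T i) * S (T i)) := by ring
      _ ≤ (A i / N (T i)) * (B i / S (T i)) *
          (κ ^ (p - 1) * Q * (N (E i) ^ (1 / p) * S (E i) ^ (1 / q))) := by gcongr
      _ = _ := by ring
  have hpow : ∀ (x y : ℝ≥0∞) {r : ℝ}, 0 < r → (x * y ^ (1 / r)) ^ r = x ^ r * y := by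
    intro x y r hr
    rw [ENNReal.mul_rpow_of_nonneg _ _ hr.le, ← ENNReal.rpow_mul, one_div_mul_cancel hr.ne',
      ENNReal.rpow_one]
  calc ∑' i, (U (T i))⁻¹ * A i * B i
      ≤ ∑' i, κ ^ (p - 1) * Q * ((A i / N (T i) * N (E i) ^ (1 / p)) *
          (B i / S (T i) * S (E i) ^ (1 / q))) := ENNReal.tsum_le_tsum hterm
    _ ≤ κ ^ (p - 1) * Q * ((∑' i, (A i / N (T i) * N (E i) ^ (1 / p)) ^ p) ^ (1 / p) *
          (∑' i, (B i / S (T i) * S (E i) ^ (1 / q)) ^ q) ^ (1 / q)) := by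
        rw [ENNReal.tsum_mul_left]
        gcongr
        exact tsum_mul_le_Lp_mul_Lq hpq _ _
    _ ≤ _ := by
        simp_rw [hpow _ _ hp0, hpow _ _ hq0]
        gcongr
        · exact tsum_rpow_mul_measure_le h.measurableSet h.disjoint hMF hp0.le
        · exact tsum_rpow_mul_measure_le h.measurableSet h.disjoint hMG hq0.le

/-- For p ≤ 2 the hypotheses are symmetric under exchanging N with S and p with q. The
characteristic then enters raised to the power 1/(p-1), which accounts for the exponent. -/
theorem SparseFamily.tsum_le {X : Type*} [MeasurableSpace X] {ι : Type*} [Countable ι]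
    {U N S : Measure X} {T E : ι → Set X} {κ Q : ℝ≥0∞} {p q : ℝ}
    (h : SparseFamily U N S T E κ p q) (hpq : p.HolderConjugate q) (hκ : κ ≠ ∞)
    (hQt : Q ≠ ∞) (hQ : ∀ i, S (T i) / U (T i) * (N (T i) / U (T i)) ^ (p - 1) ≤ Q)
    {A B : ι → ℝ≥0∞} {MF MG : X → ℝ≥0∞}
    (hMF : ∀ i, ∀ x ∈ E i, A i / N (T i) ≤ MF x) (hMG : ∀ i, ∀ x ∈ E i, B i / S (T i) ≤ MG x) :
    ∑' i, (U (T i))⁻¹ * A i * B i ≤ κ ^ (max p q - 1) * Q ^ max 1 (1 / (p - 1)) *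
      ((∫⁻ x, MF x ^ p ∂N) ^ (1 / p) * (∫⁻ x, MG x ^ q ∂S) ^ (1 / q)) := by
  have hp1 : 0 < p - 1 := hpq.sub_one_pos
  have hq : q = p / (p - 1) := hpq.conjugate_eq
  have hq1 : q - 1 = 1 / (p - 1) := by rw [hq]; field_simp; ring
  rcases le_total 2 p with hp | hp
  · have h1 : max p q = p := max_eq_left (by
      rw [hq, div_le_iff₀ hp1]; nlinarith)
    have h2 : max 1 (1 / (p - 1)) = 1 := max_eq_left (by rw [div_le_one hp1]; linarith)
    rw [h1, h2, ENNReal.rpow_one]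
    exact h.tsum_le_of_two_le hpq hp hκ hQt hQ hMF hMG
  · have hq2 : 2 ≤ q := by rw [hq, le_div_iff₀ hp1]; linarith
    have h1 : max p q = q := max_eq_right (hp.trans hq2)
    have h2 : max 1 (1 / (p - 1)) = 1 / (p - 1) := max_eq_right (by
      rw [le_div_iff₀ hp1]; linarith)
    have hQ' : ∀ i, N (T i) / U (T i) * (S (T i) / U (T i)) ^ (q - 1) ≤ Q ^ (1 / (p - 1)) := by
      intro i
      have := ENNReal.rpow_le_rpow (hQ i) (one_div_pos.2 hp1).le
      rw [ENNReal.mul_rpow_of_nonneg _ _ (one_div_pos.2 hp1).le, ← ENNReal.rpow_mul,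
        mul_one_div_cancel hp1.ne', ENNReal.rpow_one, mul_comm] at this
      rwa [hq1]
    have key := h.symm.tsum_le_of_two_le hpq.symm hq2 hκ
      (ENNReal.rpow_ne_top_of_nonneg (one_div_pos.2 hp1).le hQt) hQ' hMG hMF
    rw [h1, h2]
    calc _ = ∑' i, (U (T i))⁻¹ * B i * A i := by simp_rw [mul_right_comm]
      _ ≤ _ := key
      _ = _ := by rw [mul_comm (_ ^ (1 / q))]

/-! ### Operator norms and duality -/

theorem eLpNorm_ofReal {X ε : Type*} [MeasurableSpace X] [ENorm ε] (f : X → ε) (M : Measure X)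
    {p : ℝ} (hp : 0 < p) :
    eLpNorm f (ENNReal.ofReal p) M = (∫⁻ x, ‖f x‖ₑ ^ p ∂M) ^ (1 / p) := by
  rw [eLpNorm_eq_lintegral_rpow_enorm_toReal (by simpa using hp) ENNReal.ofReal_ne_top,
    ENNReal.toReal_ofReal hp.le]

/-- The infimum is attained because the norm of f is finite: unless it is 0, one may divide by it.
-/
theorem eLpNorm_le_operatorNorm {F : Type} [ENorm F] {p : ℝ} {ω : Measure (ℂ × ℂ)}
    {T : (ℂ × ℂ → ℂ) → (ℂ × ℂ → F)} (hT : operatorNorm p ω T < ∞) {f : ℂ × ℂ → ℂ}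
    (hf : MemLp f (ENNReal.ofReal p) ω) :
    eLpNorm (T f) (ENNReal.ofReal p) ω ≤
      operatorNorm p ω T * eLpNorm f (ENNReal.ofReal p) ω := by
  rcases eq_or_ne (eLpNorm f (ENNReal.ofReal p) ω) 0 with h | h
  · obtain ⟨C, hC, -⟩ := sInf_lt_iff.1 hT
    have := hC f hf
    rw [h, mul_zero] at this ⊢
    exact this
  · rw [← ENNReal.div_le_iff_le_mul (Or.inl h) (Or.inl hf.2.ne)]
    exact le_sInf fun C hC =>
      (ENNReal.div_le_iff_le_mul (Or.inl h) (Or.inl hf.2.ne)).2 (hC f hf)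

/-- Test against γ = min(P, n)^{p-1}, whose q-th power is min(P, n)^p, cancel, and let n tend to
infinity. -/
theorem lintegral_rpow_le_of_dual {X : Type*} [MeasurableSpace X] {M : Measure X}
    [IsFiniteMeasure M] {P : X → ℝ≥0∞} (hP : AEMeasurable P M) {p q : ℝ}
    (hpq : p.HolderConjugate q) {B : ℝ≥0∞}
    (h : ∀ γ : X → ℝ≥0, AEMeasurable γ M → (∫⁻ x, (γ x : ℝ≥0∞) ^ q ∂M < ∞) →
      ∫⁻ x, P x * γ x ∂M ≤ B * (∫⁻ x, (γ x : ℝ≥0∞) ^ q ∂M) ^ (1 / q)) :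
    (∫⁻ x, P x ^ p ∂M) ^ (1 / p) ≤ B := by
  have hp0 := hpq.pos
  have hp1 := hpq.sub_one_pos
  have hpow : ∀ x : ℝ≥0∞, x ^ p = x * x ^ (p - 1) := fun x => by
    nth_rewrite 2 [← ENNReal.rpow_one x]
    rw [← ENNReal.rpow_add_of_nonneg _ _ zero_le_one hp1.le, add_sub_cancel]
  have hI : ∀ n : ℕ, ∫⁻ x, min (P x) n ^ p ∂M ≤ B ^ p := by
    intro n
    set I := ∫⁻ x, min (P x) n ^ p ∂M with hIdef
    -- Truncation and finiteness of M are needed here: the cancellation of I^{1/q} below requires I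
    -- to be finite.
    have hfin : I < ∞ := by
      refine lt_of_le_of_lt (lintegral_mono (g := fun _ => (n : ℝ≥0∞) ^ p) fun x => ?_) ?_
      · exact ENNReal.rpow_le_rpow (min_le_right _ _) hp0.le
      · rw [lintegral_const]
        exact ENNReal.mul_lt_top (ENNReal.rpow_lt_top_of_nonneg hp0.le
          (ENNReal.natCast_ne_top n)) (measure_lt_top M univ)
    have hne : ∀ x, min (P x) n ≠ ∞ := fun x =>
      ne_top_of_le_ne_top (ENNReal.natCast_ne_top n) (min_le_right _ _)
    have hγ : ∀ x, (((min (P x) n).toNNReal ^ (p - 1) : ℝ≥0) : ℝ≥0∞) = min (P x) n ^ (p - 1) :=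
      fun x => by
        rw [ENNReal.coe_rpow_of_nonneg _ hp1.le, ENNReal.coe_toNNReal (hne x)]
    have hγq : ∀ x, (min (P x) n ^ (p - 1)) ^ q = min (P x) n ^ p := fun x => by
      rw [← ENNReal.rpow_mul, hpq.sub_one_mul_conj]
    have key := h (fun x => (min (P x) n).toNNReal ^ (p - 1))
      ((hP.min aemeasurable_const).ennreal_toNNReal.pow_const _)
      (by simp_rw [hγ, hγq]; exact hfin)
    simp_rw [hγ, hγq] at key
    have hle : I ≤ B * I ^ (1 / q) := by
      refine le_trans (lintegral_mono fun x => ?_) key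
      rw [hpow]
      gcongr
      exact min_le_left _ _
    rcases eq_or_ne I 0 with h0 | h0
    · rw [h0]; exact zero_le
    have hIq0 : I ^ (1 / q) ≠ 0 := by
      rw [ne_eq, ENNReal.rpow_eq_zero_iff_of_pos (one_div_pos.2 hpq.symm.pos)]
      exact h0
    have hIqt : I ^ (1 / q) ≠ ∞ :=
      ENNReal.rpow_ne_top_of_nonneg (one_div_pos.2 hpq.symm.pos).le hfin.ne
    have hsplit : I = I ^ (1 / p) * I ^ (1 / q) := by
      rw [← ENNReal.rpow_add _ _ h0 hfin.ne, one_div, one_div, hpq.inv_add_inv_eq_one,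
        ENNReal.rpow_one]
    have h1 : I ^ (1 / p) ≤ B :=
      (ENNReal.mul_le_mul_iff_left hIq0 hIqt).1 (hsplit.symm.trans_le hle)
    calc I = (I ^ (1 / p)) ^ p := by
          rw [← ENNReal.rpow_mul, one_div_mul_cancel hp0.ne', ENNReal.rpow_one]
      _ ≤ B ^ p := ENNReal.rpow_le_rpow h1 hp0.le
  have hsup : ∫⁻ x, P x ^ p ∂M = ⨆ n : ℕ, ∫⁻ x, min (P x) n ^ p ∂M := by
    rw [← lintegral_iSup' (fun n => (hP.min aemeasurable_const).pow_const _)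
      (ae_of_all _ fun x m n hmn =>
        ENNReal.rpow_le_rpow (min_le_min_left _ (Nat.cast_le.2 hmn)) hp0.le)]
    refine lintegral_congr fun x => le_antisymm ?_ (iSup_le fun n =>
      ENNReal.rpow_le_rpow (min_le_left _ _) hp0.le)
    rcases eq_or_ne (P x) ∞ with hx | hx
    · have h2 : ∀ n : ℕ, (n : ℝ≥0∞) ≤ ⨆ n : ℕ, min (P x) n ^ p := by
        intro n
        refine le_trans ?_ (le_iSup (fun n : ℕ => min (P x) n ^ p) n)
        rw [hx, min_eq_right le_top]
        rcases Nat.eq_zero_or_pos n with rfl | hn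
        · simp
        · exact ENNReal.le_rpow_self_of_one_le (by exact_mod_cast hn)
            (by linarith)
      have h3 : ⨆ n : ℕ, min (P x) n ^ p = ∞ := ENNReal.eq_top_of_forall_nnreal_le fun r => by
        obtain ⟨n, hn⟩ := exists_nat_ge r
        exact le_trans (by exact_mod_cast hn) (h2 n)
      rw [h3]
      exact le_top
    · obtain ⟨n, hn⟩ := ENNReal.exists_nat_gt hx
      refine le_trans ?_ (le_iSup (fun n : ℕ => min (P x) n ^ p) n)
      rw [min_eq_left hn.le]
  rw [hsup, one_div, ENNReal.rpow_inv_le_iff hp0]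
  exact iSup_le hI

/-! ### Weights on the Hartogs triangle -/

theorem setLIntegral_weightMeasure {ρ : ℂ × ℂ → ℝ}
    (hρ : AEMeasurable ρ (volume.restrict triangle)) {s : Set (ℂ × ℂ)} (hs : MeasurableSet s)
    (F : ℂ × ℂ → ℝ≥0∞) : ∫⁻ x in s, F x ∂(weightMeasure ρ) =
      ∫⁻ x in s, ENNReal.ofReal (ρ x) * F x ∂(volume.restrict triangle) :=
  setLIntegral_withDensity_eq_setLIntegral_mul_non_measurable₀ _ hρ.ennreal_ofReal.restrict _ hs
    (ae_of_all _ fun _ => ENNReal.ofReal_lt_top)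

theorem lintegral_weightMeasure {ρ : ℂ × ℂ → ℝ}
    (hρ : AEMeasurable ρ (volume.restrict triangle)) (F : ℂ × ℂ → ℝ≥0∞) :
    ∫⁻ x, F x ∂(weightMeasure ρ) = ∫⁻ x in triangle, ENNReal.ofReal (ρ x) * F x := by
  have := setLIntegral_weightMeasure hρ MeasurableSet.univ F
  rwa [Measure.restrict_univ, Measure.restrict_univ] at this

theorem weightMeasure_apply (ρ : ℂ × ℂ → ℝ) {s : Set (ℂ × ℂ)} (hs : MeasurableSet s) :
    weightMeasure ρ s = ∫⁻ x in s, ENNReal.ofReal (ρ x) ∂(volume.restrict triangle) :=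
  withDensity_apply _ hs

theorem weightMeasure_absolutelyContinuous (ρ : ℂ × ℂ → ℝ) :
    weightMeasure ρ ≪ volume.restrict triangle := withDensity_absolutelyContinuous _ _

theorem absolutelyContinuous_weightMeasure {ρ : ℂ × ℂ → ℝ}
    (hρ : AEMeasurable ρ (volume.restrict triangle)) (hpos : ∀ z ∈ triangle, 0 < ρ z) :
    volume.restrict triangle ≪ weightMeasure ρ := by
  refine withDensity_absolutelyContinuous' hρ.ennreal_ofReal ?_
  filter_upwards [ae_restrict_mem measurableSet_triangle] with z hz
  exact (ENNReal.ofReal_pos.2 (hpos z hz)).ne'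

/-- The weight `|w₂|⁻ᵖ μ`. -/
def companionWeight (p : ℝ) (μ : ℂ × ℂ → ℝ) (w : ℂ × ℂ) : ℝ := ‖w.2‖ ^ (-p) * μ w

theorem aemeasurable_dualWeight {μ : ℂ × ℂ → ℝ} (p : ℝ)
    (hμ : AEMeasurable μ (volume.restrict triangle)) :
    AEMeasurable (dualWeight p μ) (volume.restrict triangle) := by
  have h : Measurable fun w : ℂ × ℂ => ‖w.2‖ ^ (-p.conjExponent) := by fun_prop
  exact h.aemeasurable.mul (hμ.pow_const _)

theorem aemeasurable_companionWeight {μ : ℂ × ℂ → ℝ} (p : ℝ)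
    (hμ : AEMeasurable μ (volume.restrict triangle)) :
    AEMeasurable (companionWeight p μ) (volume.restrict triangle) := by
  have h : Measurable fun w : ℂ × ℂ => ‖w.2‖ ^ (-p) := by fun_prop
  exact h.aemeasurable.mul hμ

/-! ### Pointwise identities between the weight, its dual and its companion. -/

section Pointwise

variable {p : ℝ} {μ : ℂ × ℂ → ℝ} {w : ℂ × ℂ}

theorem dualWeight_pos (hw : w ∈ triangle) (hμ : 0 < μ w) : 0 < dualWeight p μ w :=
  mul_pos (Real.rpow_pos_of_pos (norm_pos_iff.2 (snd_ne_zero hw)) _) (Real.rpow_pos_of_pos hμ _)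

theorem companionWeight_pos (hw : w ∈ triangle) (hμ : 0 < μ w) : 0 < companionWeight p μ w :=
  mul_pos (Real.rpow_pos_of_pos (norm_pos_iff.2 (snd_ne_zero hw)) _) hμ

theorem dualWeight_mul_companionWeight (hp : 1 < p) (hw : w ∈ triangle) (hμ : 0 < μ w) :
    dualWeight p μ w ^ (1 / p.conjExponent) * companionWeight p μ w ^ (1 / p) =
      (‖w.2‖ ^ 2)⁻¹ := by
  have hpq := Real.HolderConjugate.conjExponent hp
  have ht : 0 < ‖w.2‖ := norm_pos_iff.2 (snd_ne_zero hw)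
  have hp0 := hpq.ne_zero
  have hq0 := hpq.symm.ne_zero
  rw [dualWeight, companionWeight, Real.mul_rpow (by positivity) (by positivity),
    Real.mul_rpow (by positivity) (by positivity), ← Real.rpow_mul ht.le, ← Real.rpow_mul ht.le,
    ← Real.rpow_mul hμ.le]
  have e1 : -p.conjExponent * (1 / p.conjExponent) = -1 := by field_simp
  have e2 : -p.conjExponent / p * (1 / p.conjExponent) = -(1 / p) := by field_simp
  have e3 : -p * (1 / p) = -1 := by field_simp
  rw [e1, e2, e3, Real.rpow_neg hμ.le, Real.rpow_neg_one]
  have : μ w ^ (1 / p) ≠ 0 := (Real.rpow_pos_of_pos hμ _).ne'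
  field_simp

theorem inv_sq_mul_eq_companionWeight (hw : w ∈ triangle) :
    (‖w.2‖ ^ 2)⁻¹ * (μ w * ‖w.2‖ ^ (2 - p)) = companionWeight p μ w := by
  have ht : 0 < ‖w.2‖ := norm_pos_iff.2 (snd_ne_zero hw)
  rw [companionWeight, Real.rpow_sub ht, Real.rpow_neg ht.le, Real.rpow_two]
  field_simp

theorem dualWeight_rpow_one_sub (hp : 1 < p) (hw : w ∈ triangle) (hμ : 0 < μ w) :
    dualWeight p μ w ^ (1 - p) = ‖w.2‖ ^ p * μ w := by
  have hpq := Real.HolderConjugate.conjExponent hp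
  have ht : 0 < ‖w.2‖ := norm_pos_iff.2 (snd_ne_zero hw)
  have hp0 := hpq.ne_zero
  rw [dualWeight, Real.mul_rpow (by positivity) (by positivity), ← Real.rpow_mul ht.le,
    ← Real.rpow_mul hμ.le]
  have e1 : -p.conjExponent * (1 - p) = p := by linarith [hpq.sub_one_mul_conj]
  have e2 : -p.conjExponent / p * (1 - p) = 1 := by
    rw [div_mul_eq_mul_div, e1, div_self hp0]
  rw [e1, e2, Real.rpow_one]

theorem dualWeight_mul_rpow (hp : 1 < p) (hw : w ∈ triangle) (hμ : 0 < μ w) {x : ℝ}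
    (hx : 0 ≤ x) : dualWeight p μ w * (‖w.2‖⁻¹ * x / dualWeight p μ w) ^ p = μ w * x ^ p := by
  have ht : 0 < ‖w.2‖ := norm_pos_iff.2 (snd_ne_zero hw)
  have hν := dualWeight_pos (p := p) hw hμ
  have h1 := dualWeight_rpow_one_sub hp hw hμ
  rw [Real.rpow_sub hν, Real.rpow_one] at h1
  rw [Real.div_rpow (by positivity) hν.le, Real.mul_rpow (by positivity) hx,
    Real.inv_rpow ht.le]
  have h2 : dualWeight p μ w * ((‖w.2‖ ^ p)⁻¹ * x ^ p / dualWeight p μ w ^ p) =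
      (dualWeight p μ w / dualWeight p μ w ^ p) * ((‖w.2‖ ^ p)⁻¹ * x ^ p) := by ring
  have h3 : ‖w.2‖ ^ p ≠ 0 := (Real.rpow_pos_of_pos ht _).ne'
  rw [h2, h1]
  field_simp

theorem companionWeight_mul_rpow (hp : 1 < p) (hw : w ∈ triangle) {x : ℝ} (hx : 0 ≤ x) :
    companionWeight p μ w * (‖w.2‖ ^ (p - 1) * x) ^ p.conjExponent =
      μ w * x ^ p.conjExponent := by
  have hpq := Real.HolderConjugate.conjExponent hp
  have ht : 0 < ‖w.2‖ := norm_pos_iff.2 (snd_ne_zero hw)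
  rw [companionWeight, Real.mul_rpow (by positivity) hx, ← Real.rpow_mul ht.le,
    hpq.sub_one_mul_conj, Real.rpow_neg ht.le]
  have h3 : ‖w.2‖ ^ p ≠ 0 := (Real.rpow_pos_of_pos ht _).ne'
  field_simp

theorem companionWeight_mul (hw : w ∈ triangle) (x : ℝ) :
    companionWeight p μ w * (‖w.2‖ ^ (p - 1) * x) = ‖w.2‖⁻¹ * (μ w * x) := by
  have ht : 0 < ‖w.2‖ := norm_pos_iff.2 (snd_ne_zero hw)
  have h3 : ‖w.2‖ ^ p ≠ 0 := (Real.rpow_pos_of_pos ht _).ne'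
  rw [companionWeight, Real.rpow_sub_one ht.ne', Real.rpow_neg ht.le]
  field_simp

/-- As |w₂| < 1, finiteness of the companion measure passes to μ dV, as the duality argument
requires. -/
theorem le_companionWeight (hp : 0 ≤ p) (hw : w ∈ triangle) (hμ : 0 < μ w) :
    μ w ≤ companionWeight p μ w := by
  have ht : 0 < ‖w.2‖ := norm_pos_iff.2 (snd_ne_zero hw)
  refine le_mul_of_one_le_left hμ.le (Real.one_le_rpow_of_pos_of_le_one_of_nonpos ht hw.2.le ?_)
  linarith

end Pointwise

/-- The subset of the Hartogs triangle induced by a product of dyadic tents. -/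
def tent (m n : ℝ) (i : Index × Index) : Set (ℂ × ℂ) :=
  induced (dyadicTent m i.1) (dyadicTent n i.2)

/-- The subset of the Hartogs triangle induced by a product of kubes. -/
def tentCore (m n : ℝ) (i : Index × Index) : Set (ℂ × ℂ) := induced (kube m i.1) (kube n i.2)

theorem measurableSet_tent (m n : ℝ) (i : Index × Index) : MeasurableSet (tent m n i) :=
  measurableSet_induced (measurableSet_dyadicTent m i.1) (measurableSet_dyadicTent n i.2)

theorem measurableSet_tentCore (m n : ℝ) (i : Index × Index) : MeasurableSet (tentCore m n i) :=
  measurableSet_induced (measurableSet_kube m i.1) (measurableSet_kube n i.2)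

theorem uMeasure_tent (m n : ℝ) (i : Index × Index) :
    uMeasure (tent m n i) = volume (dyadicTent m i.1) * volume (dyadicTent n i.2) :=
  uMeasure_induced (measurableSet_dyadicTent m i.1) (measurableSet_dyadicTent n i.2)
    (dyadicTent_subset_ball m i.1) (dyadicTent_subset_ball n i.2)

theorem uMeasure_tentCore (m n : ℝ) (i : Index × Index) :
    uMeasure (tentCore m n i) = volume (kube m i.1) * volume (kube n i.2) :=
  uMeasure_induced (measurableSet_kube m i.1) (measurableSet_kube n i.2)
    ((kube_subset_dyadicTent m i.1).trans (dyadicTent_subset_ball m i.1))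
    ((kube_subset_dyadicTent n i.2).trans (dyadicTent_subset_ball n i.2))

theorem tentCore_subset_tent (m n : ℝ) (i : Index × Index) : tentCore m n i ⊆ tent m n i :=
  induced_mono (kube_subset_dyadicTent m i.1) (kube_subset_dyadicTent n i.2)

theorem pairwise_disjoint_tentCore (m n : ℝ) :
    Pairwise (Function.onFun Disjoint (tentCore m n)) := by
  intro i j hij
  rw [Function.onFun, Set.disjoint_left]
  intro w hi hj
  by_cases h1 : i.1 = j.1
  · have h2 : i.2 ≠ j.2 := fun h2 => hij (Prod.ext h1 h2)
    exact Set.disjoint_left.1 (disjoint_kube h2) hi.2.2 hj.2.2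
  · exact Set.disjoint_left.1 (disjoint_kube h1) hi.2.1 hj.2.1

theorem uMeasure_ne_top (s : Set (ℂ × ℂ)) : uMeasure s ≠ ∞ :=
  ((measure_mono (subset_univ s)).trans_lt uMeasure_univ_lt_top).ne

theorem uMeasure_tentCore_ne_zero (m n : ℝ) (i : Index × Index) :
    uMeasure (tentCore m n i) ≠ 0 := by
  rw [uMeasure_tentCore]
  exact mul_ne_zero (volume_kube_pos m i.1).ne' (volume_kube_pos n i.2).ne'

theorem uMeasure_tent_le (m n : ℝ) (i : Index × Index) :
    uMeasure (tent m n i) ≤ 9216 ^ 2 * uMeasure (tentCore m n i) := by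
  rw [uMeasure_tent, uMeasure_tentCore]
  calc _ ≤ (9216 * volume (kube m i.1)) * (9216 * volume (kube n i.2)) :=
        mul_le_mul' (volume_dyadicTent_le m i.1) (volume_dyadicTent_le n i.2)
    _ = _ := by ring

/-! ### Masses of tents, the characteristic and sparseness. -/

section Weights

variable {p : ℝ} {μ : ℂ × ℂ → ℝ}

/-- Hölder with exponents p' and p, since ν^{1/p'} ψ^{1/p} is exactly the density |w₂|⁻² of u. -/
theorem uMeasure_le_geom_mean (hp : 1 < p) (hm : AEMeasurable μ (volume.restrict triangle))
    (hpos : ∀ z ∈ triangle, 0 < μ z) {s : Set (ℂ × ℂ)} (hs : MeasurableSet s) :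
    uMeasure s ≤ weightMeasure (dualWeight p μ) s ^ (1 / p.conjExponent) *
      weightMeasure (companionWeight p μ) s ^ (1 / p) := by
  have hpq := Real.HolderConjugate.conjExponent hp
  have hν := (aemeasurable_dualWeight p hm).ennreal_ofReal.restrict (s := s)
  have hψ := (aemeasurable_companionWeight p hm).ennreal_ofReal.restrict (s := s)
  have h := ENNReal.lintegral_mul_le_Lp_mul_Lq _ hpq.symm (hν.pow_const (1 / p.conjExponent))
    (hψ.pow_const (1 / p))
  simp only [Pi.mul_apply, ← ENNReal.rpow_mul, one_div_mul_cancel hpq.ne_zero,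
    one_div_mul_cancel hpq.symm.ne_zero, ENNReal.rpow_one] at h
  rw [weightMeasure_apply _ hs, weightMeasure_apply _ hs, uMeasure, weightMeasure_apply _ hs]
  refine le_trans (lintegral_mono_ae ?_) h
  filter_upwards [ae_restrict_of_ae (ae_restrict_mem measurableSet_triangle)] with w hw
  rw [ENNReal.ofReal_rpow_of_pos (dualWeight_pos hw (hpos w hw)),
    ENNReal.ofReal_rpow_of_pos (companionWeight_pos hw (hpos w hw)), ← ENNReal.ofReal_mul
    (Real.rpow_nonneg (dualWeight_pos hw (hpos w hw)).le _),
    dualWeight_mul_companionWeight hp hw (hpos w hw)]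

theorem setLIntegral_uMeasure {s : Set (ℂ × ℂ)} (hs : MeasurableSet s) {f g : ℂ × ℂ → ℝ}
    (h : ∀ w ∈ triangle, (‖w.2‖ ^ 2)⁻¹ * f w = g w) :
    ∫⁻ w in s, ENNReal.ofReal (f w) ∂uMeasure = weightMeasure g s := by
  have hm : Measurable fun w : ℂ × ℂ => (‖w.2‖ ^ 2)⁻¹ := by fun_prop
  rw [uMeasure, setLIntegral_weightMeasure hm.aemeasurable hs, weightMeasure_apply _ hs]
  refine lintegral_congr_ae ?_
  filter_upwards [ae_restrict_of_ae (ae_restrict_mem measurableSet_triangle)] with w hw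
  rw [← ENNReal.ofReal_mul (by positivity), h w hw]

theorem le_characteristic (z₁ z₂ : ℂ) (h₁ : z₁ ∈ ball (0 : ℂ) 1) (h₂ : z₂ ∈ ball (0 : ℂ) 1) :
    weightMeasure (companionWeight p μ) (induced (carlesonTent z₁) (carlesonTent z₂)) /
        uMeasure (induced (carlesonTent z₁) (carlesonTent z₂)) *
      (weightMeasure (dualWeight p μ) (induced (carlesonTent z₁) (carlesonTent z₂)) /
        uMeasure (induced (carlesonTent z₁) (carlesonTent z₂))) ^ (p - 1) ≤
      characteristic p μ (dualWeight p μ) := by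
  have hs := measurableSet_induced (measurableSet_carlesonTent z₁) (measurableSet_carlesonTent z₂)
  rw [← setLIntegral_uMeasure hs (f := fun w => μ w * ‖w.2‖ ^ (2 - p))
      fun w hw => inv_sq_mul_eq_companionWeight hw,
    ← setLIntegral_uMeasure hs (f := fun w => ‖w.2‖ ^ 2 * dualWeight p μ w) fun w hw => by
      have : ‖w.2‖ ≠ 0 := norm_ne_zero_iff.2 (snd_ne_zero hw)
      rw [← mul_assoc, inv_mul_cancel₀ (pow_ne_zero _ this), one_mul],
    ← setLAverage_eq, ← setLAverage_eq, characteristic]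
  exact le_iSup₂_of_le z₁ h₁ (le_iSup₂_of_le z₂ h₂ le_rfl)

theorem induced_ball_ball : induced (ball 0 1) (ball 0 1) = triangle :=
  Set.Subset.antisymm (induced_subset_triangle _ _) fun _ hw =>
    ⟨hw, mem_ball_zero_iff.2 (norm_fst_div_snd_lt hw), mem_ball_zero_iff.2 hw.2⟩

theorem weightMeasure_triangle (ρ : ℂ × ℂ → ℝ) :
    weightMeasure ρ triangle = weightMeasure ρ univ := by
  rw [weightMeasure_apply _ measurableSet_triangle, weightMeasure_apply _ MeasurableSet.univ,
    Measure.restrict_restrict measurableSet_triangle, inter_self, Measure.restrict_univ]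

/-- The tent T₀ × T₀ induces the whole triangle, so the characteristic already contains both total
masses. -/
theorem weightMeasure_univ_lt_top (hp : 1 < p)
    (hm : AEMeasurable μ (volume.restrict triangle)) (hpos : ∀ z ∈ triangle, 0 < μ z)
    (hchar : characteristic p μ (dualWeight p μ) < ∞) :
    weightMeasure (dualWeight p μ) univ < ∞ ∧ weightMeasure (companionWeight p μ) univ < ∞ := by
  have hpq := Real.HolderConjugate.conjExponent hp
  have hu0 : uMeasure triangle ≠ 0 := by
    rw [← induced_ball_ball, uMeasure_induced isOpen_ball.measurableSet isOpen_ball.measurableSet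
      subset_rfl subset_rfl]
    exact mul_ne_zero (measure_ball_pos _ _ one_pos).ne' (measure_ball_pos _ _ one_pos).ne'
  have hut := uMeasure_ne_top triangle
  have hgeom := uMeasure_le_geom_mean hp hm hpos measurableSet_triangle
  have hc := (le_characteristic (p := p) (μ := μ) 0 0 (mem_ball_self one_pos)
    (mem_ball_self one_pos)).trans_lt hchar
  rw [carlesonTent_zero, induced_ball_ball] at hc
  rw [← weightMeasure_triangle, ← weightMeasure_triangle]
  set N := weightMeasure (dualWeight p μ) triangle
  set S := weightMeasure (companionWeight p μ) triangle
  -- Because 0 · ∞ = 0, a finite product bounds each factor only once both masses are known to be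
  -- nonzero; the geometric-mean inequality provides this.
  have hN0 : N ≠ 0 := by
    intro h0
    rw [h0, ENNReal.zero_rpow_of_pos (one_div_pos.2 hpq.symm.pos), zero_mul] at hgeom
    exact hu0 (le_zero_iff.1 hgeom)
  have hS0 : S ≠ 0 := by
    intro h0
    rw [h0, ENNReal.zero_rpow_of_pos (one_div_pos.2 hpq.pos), mul_zero] at hgeom
    exact hu0 (le_zero_iff.1 hgeom)
  constructor
  · by_contra hN
    rw [not_lt, top_le_iff] at hN
    rw [hN, ENNReal.top_div_of_ne_top hut, ENNReal.top_rpow_of_pos hpq.sub_one_pos,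
      ENNReal.mul_top (ENNReal.div_pos hS0 hut).ne'] at hc
    exact lt_irrefl _ hc
  · by_contra hS
    rw [not_lt, top_le_iff] at hS
    rw [hS, ENNReal.top_div_of_ne_top hut, ENNReal.top_mul] at hc
    · exact lt_irrefl _ hc
    · rw [ne_eq, ENNReal.rpow_eq_zero_iff_of_pos hpq.sub_one_pos]
      exact (ENNReal.div_pos hN0 hut).ne'

/-- Each average loses the factor 9216² in passing to the enclosing Carleson tents, and the averages
enter with total exponent 1 + (p - 1) = p. -/
theorem tent_characteristic_le (hp : 1 < p) (m n : ℝ) (i : Index × Index) :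
    weightMeasure (companionWeight p μ) (tent m n i) / uMeasure (tent m n i) *
      (weightMeasure (dualWeight p μ) (tent m n i) / uMeasure (tent m n i)) ^ (p - 1) ≤
      (9216 ^ 2) ^ p * characteristic p μ (dualWeight p μ) := by
  have hp1 : 0 ≤ p - 1 := by linarith
  obtain ⟨z₁, h₁, hs₁, hv₁⟩ := exists_carlesonTent_of_dyadicTent m i.1
  obtain ⟨z₂, h₂, hs₂, hv₂⟩ := exists_carlesonTent_of_dyadicTent n i.2
  set T := induced (carlesonTent z₁) (carlesonTent z₂) with hT
  have hsub : tent m n i ⊆ T := induced_mono hs₁ hs₂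
  have hU : uMeasure T ≤ 9216 ^ 2 * uMeasure (tent m n i) := by
    refine le_trans ?_ (mul_le_mul_right (measure_mono (tentCore_subset_tent m n i)) _)
    rw [hT, uMeasure_induced (measurableSet_carlesonTent z₁) (measurableSet_carlesonTent z₂)
      (carlesonTent_subset z₁) (carlesonTent_subset z₂), uMeasure_tentCore]
    calc _ ≤ (9216 * volume (kube m i.1)) * (9216 * volume (kube n i.2)) := mul_le_mul' hv₁ hv₂
      _ = _ := by ring
  have hinv : (uMeasure (tent m n i))⁻¹ ≤ 9216 ^ 2 * (uMeasure T)⁻¹ := by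
    have h9 : (9216 ^ 2 : ℝ≥0∞) ≠ 0 := by norm_num
    have h9t : (9216 ^ 2 : ℝ≥0∞) ≠ ∞ := by finiteness
    calc (uMeasure (tent m n i))⁻¹ =
          9216 ^ 2 * (9216 ^ 2 * uMeasure (tent m n i))⁻¹ := by
          rw [ENNReal.mul_inv (Or.inl h9) (Or.inl h9t), ← mul_assoc,
            ENNReal.mul_inv_cancel h9 h9t, one_mul]
      _ ≤ _ := by gcongr
  have hdiv : ∀ M : Measure (ℂ × ℂ), M (tent m n i) / uMeasure (tent m n i) ≤
      9216 ^ 2 * (M T / uMeasure T) := by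
    intro M
    rw [div_eq_mul_inv, div_eq_mul_inv]
    calc _ ≤ M T * (9216 ^ 2 * (uMeasure T)⁻¹) := mul_le_mul' (measure_mono hsub) hinv
      _ = _ := by ring
  calc _ ≤ (9216 ^ 2 * (weightMeasure (companionWeight p μ) T / uMeasure T)) *
        (9216 ^ 2 * (weightMeasure (dualWeight p μ) T / uMeasure T)) ^ (p - 1) := by
        gcongr
        · exact hdiv _
        · exact hdiv _
    _ = (9216 ^ 2 * (9216 ^ 2) ^ (p - 1)) *
        ((weightMeasure (companionWeight p μ) T / uMeasure T) *
        (weightMeasure (dualWeight p μ) T / uMeasure T) ^ (p - 1)) := by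
        rw [ENNReal.mul_rpow_of_nonneg _ _ hp1]; ring
    _ = (9216 ^ 2) ^ p * ((weightMeasure (companionWeight p μ) T / uMeasure T) *
        (weightMeasure (dualWeight p μ) T / uMeasure T) ^ (p - 1)) := by
        congr 1
        nth_rewrite 1 [← ENNReal.rpow_one (9216 ^ 2)]
        rw [← ENNReal.rpow_add_of_nonneg _ _ zero_le_one hp1, add_sub_cancel]
    _ ≤ _ := by
        gcongr
        exact le_characteristic z₁ z₂ h₁ h₂

theorem sparseFamily_tent (hp : 1 < p) (hm : AEMeasurable μ (volume.restrict triangle))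
    (hpos : ∀ z ∈ triangle, 0 < μ z) (hchar : characteristic p μ (dualWeight p μ) < ∞)
    (m n : ℝ) : SparseFamily uMeasure (weightMeasure (dualWeight p μ))
      (weightMeasure (companionWeight p μ)) (tent m n) (tentCore m n) (9216 ^ 2) p
      p.conjExponent where
  measurableSet := measurableSet_tentCore m n
  disjoint := pairwise_disjoint_tentCore m n
  subset := tentCore_subset_tent m n
  measure_le := uMeasure_tent_le m n
  measure_ne_zero := uMeasure_tentCore_ne_zero m n
  ne_top i := by
    obtain ⟨h1, h2⟩ := weightMeasure_univ_lt_top hp hm hpos hchar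
    exact ⟨uMeasure_ne_top _, ((measure_mono (subset_univ _)).trans_lt h1).ne,
      ((measure_mono (subset_univ _)).trans_lt h2).ne⟩
  le_geom_mean i := uMeasure_le_geom_mean hp hm hpos (measurableSet_tentCore m n i)

end Weights

/-! ### Domination of the kernel -/

/-- Admissibility applied to the Carleson tent of `exists_carlesonTent`: the disc kernel is
dominated by the reciprocal area of a dyadic tent holding both points. -/
theorem exists_dyadicTent_bound {L : Finset ℝ} (hL : IsAdmissible L) : ∃ c : ℝ≥0,
    ∀ z ∈ ball (0 : ℂ) 1, ∀ w ∈ ball (0 : ℂ) 1, ∃ m ∈ L, ∃ a : Index,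
      z ∈ dyadicTent m a ∧ w ∈ dyadicTent m a ∧
      ENNReal.ofReal ((‖1 - z * conj w‖ ^ 2)⁻¹) ≤ c * (volume (dyadicTent m a))⁻¹ := by
  obtain ⟨c, hc⟩ := hL
  refine ⟨c * (9 * NNReal.pi), fun z hz w hw => ?_⟩
  obtain ⟨ζ, hζ, hzζ, hwζ, hvol⟩ := exists_carlesonTent hz hw
  obtain ⟨m, hm, a, hsub, hle⟩ := hc ζ hζ
  refine ⟨m, hm, a, hsub hzζ, hsub hwζ, ?_⟩
  have hs : 0 < ‖1 - z * conj w‖ := norm_pos_iff.2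
    (one_sub_mul_conj_ne_zero (mem_ball_zero_iff.1 hz) (mem_ball_zero_iff.1 hw).le)
  have hv0 : volume (dyadicTent m a) ≠ 0 :=
    ((volume_kube_pos m a).trans_le (measure_mono (kube_subset_dyadicTent m a))).ne'
  have hvt : volume (dyadicTent m a) ≠ ∞ :=
    ((measure_mono (dyadicTent_subset_ball m a)).trans_lt measure_ball_lt_top).ne
  rw [← div_eq_mul_inv, ENNReal.le_div_iff_mul_le (Or.inl hv0) (Or.inl hvt)]
  have h9 : ENNReal.ofReal (9 * Real.pi * ‖1 - z * conj w‖ ^ 2) =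
      ((9 * NNReal.pi : ℝ≥0) : ℝ≥0∞) * ENNReal.ofReal (‖1 - z * conj w‖ ^ 2) := by
    rw [ENNReal.ofReal_mul (by positivity)]
    congr 1
    rw [← ENNReal.ofReal_coe_nnreal]
    simp
  calc ENNReal.ofReal ((‖1 - z * conj w‖ ^ 2)⁻¹) * volume (dyadicTent m a)
      ≤ ENNReal.ofReal ((‖1 - z * conj w‖ ^ 2)⁻¹) *
        (c * (((9 * NNReal.pi : ℝ≥0) : ℝ≥0∞) * ENNReal.ofReal (‖1 - z * conj w‖ ^ 2))) := by
        rw [← h9]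
        gcongr
        exact hle.trans (by gcongr)
    _ = (c * ((9 * NNReal.pi : ℝ≥0) : ℝ≥0∞)) * (ENNReal.ofReal ((‖1 - z * conj w‖ ^ 2)⁻¹) *
        ENNReal.ofReal (‖1 - z * conj w‖ ^ 2)) := by ring
    _ = _ := by
        rw [← ENNReal.ofReal_mul (by positivity), inv_mul_cancel₀ (by positivity),
          ENNReal.ofReal_one, mul_one, ENNReal.coe_mul c]

/-- The disc bound is used once at w₁/w₂ and once at w₂; the two areas multiply to the u-measure of
the induced tent. -/
theorem exists_tent_bound {L : Finset ℝ} (hL : IsAdmissible L) : ∃ C : ℝ≥0,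
    ∀ z ∈ triangle, ∀ w ∈ triangle, ∃ x : L × L, ∃ i : Index × Index,
      z ∈ tent x.1 x.2 i ∧ w ∈ tent x.1 x.2 i ∧
      ‖kernel z w‖ₑ ≤ C * ENNReal.ofReal ‖z.2‖⁻¹ * ENNReal.ofReal ‖w.2‖⁻¹ *
        (uMeasure (tent x.1 x.2 i))⁻¹ := by
  obtain ⟨c, hc⟩ := exists_dyadicTent_bound hL
  refine ⟨c * c, fun z hz w hw => ?_⟩
  obtain ⟨m, hm, a, hza, hwa, hka⟩ := hc _ (mem_ball_zero_iff.2 (norm_fst_div_snd_lt hz)) _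
    (mem_ball_zero_iff.2 (norm_fst_div_snd_lt hw))
  obtain ⟨n, hn, b, hzb, hwb, hkb⟩ := hc _ (mem_ball_zero_iff.2 hz.2) _
    (mem_ball_zero_iff.2 hw.2)
  refine ⟨(⟨m, hm⟩, ⟨n, hn⟩), (a, b), ⟨hz, hza, hzb⟩, ⟨hw, hwa, hwb⟩, ?_⟩
  have hpi : (Real.pi ^ 2)⁻¹ ≤ 1 := inv_le_one_of_one_le₀ (by nlinarith [Real.pi_gt_three])
  have hvt : ∀ (l : ℝ) (a : Index), volume (dyadicTent l a) ≠ ∞ := fun l a =>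
    ((measure_mono (dyadicTent_subset_ball l a)).trans_lt measure_ball_lt_top).ne
  rw [uMeasure_tent, ENNReal.mul_inv (Or.inr (hvt _ _)) (Or.inl (hvt _ _)), ← ofReal_norm,
    norm_kernel, ENNReal.ofReal_mul (by positivity), ENNReal.ofReal_mul (by positivity),
    ENNReal.ofReal_mul (by positivity), ENNReal.ofReal_mul (by positivity)]
  calc _ ≤ 1 * ENNReal.ofReal ‖z.2‖⁻¹ * ENNReal.ofReal ‖w.2‖⁻¹ *
        (c * (volume (dyadicTent m a))⁻¹) * (c * (volume (dyadicTent n b))⁻¹) := by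
        gcongr
        exact ENNReal.ofReal_le_one.2 hpi
    _ = _ := by push_cast; ring

/-- The positive integral operator with kernel `|kernel z w|`, applied to `|f|`. -/
def absProj (f : ℂ × ℂ → ℂ) (z : ℂ × ℂ) : ℝ≥0∞ := ∫⁻ w in triangle, ‖kernel z w‖ₑ * ‖f w‖ₑ

/-- The tent in `hC` varies with the pair of points. Bounding by the sum over all tents of all pairs
of trees removes any measurable choice and lets Tonelli split the double integral. -/
theorem lintegral_absProj_mul_le {L : Finset ℝ} {C : ℝ≥0}
    (hC : ∀ z ∈ triangle, ∀ w ∈ triangle, ∃ x : L × L, ∃ i : Index × Index,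
      z ∈ tent x.1 x.2 i ∧ w ∈ tent x.1 x.2 i ∧
      ‖kernel z w‖ₑ ≤ C * ENNReal.ofReal ‖z.2‖⁻¹ * ENNReal.ofReal ‖w.2‖⁻¹ *
        (uMeasure (tent x.1 x.2 i))⁻¹)
    {f : ℂ × ℂ → ℂ} (hf : AEStronglyMeasurable f (volume.restrict triangle))
    {g : ℂ × ℂ → ℝ≥0∞} (hg : AEMeasurable g (volume.restrict triangle)) :
    ∫⁻ z in triangle, absProj f z * g z ≤ C * ∑' x : L × L, ∑' i,
      (uMeasure (tent x.1 x.2 i))⁻¹ *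
      (∫⁻ w in tent x.1 x.2 i, ENNReal.ofReal ‖w.2‖⁻¹ * ‖f w‖ₑ ∂(volume.restrict triangle)) *
      ∫⁻ z in tent x.1 x.2 i, ENNReal.ofReal ‖z.2‖⁻¹ * g z ∂(volume.restrict triangle) := by
  have hb : Measurable fun w : ℂ × ℂ => ENNReal.ofReal ‖w.2‖⁻¹ := by fun_prop
  have hbf : AEMeasurable (fun w : ℂ × ℂ => ENNReal.ofReal ‖w.2‖⁻¹ * ‖f w‖ₑ)
      (volume.restrict triangle) := hb.aemeasurable.mul hf.enorm
  have hbg : AEMeasurable (fun w : ℂ × ℂ => ENNReal.ofReal ‖w.2‖⁻¹ * g w)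
      (volume.restrict triangle) := hb.aemeasurable.mul hg
  let J := (L × L) × (Index × Index)
  let T : J → Set (ℂ × ℂ) := fun j => tent j.1.1 j.1.2 j.2
  have hT : ∀ j, MeasurableSet (T j) := fun j => measurableSet_tent _ _ _
  let A : J → ℝ≥0∞ := fun j =>
    ∫⁻ w in T j, ENNReal.ofReal ‖w.2‖⁻¹ * ‖f w‖ₑ ∂(volume.restrict triangle)
  let B : J → ℝ≥0∞ := fun j =>
    ∫⁻ w in T j, ENNReal.ofReal ‖w.2‖⁻¹ * g w ∂(volume.restrict triangle)
  have h1 : ∀ z ∈ triangle, absProj f z * g z ≤ ∑' j, (C * (uMeasure (T j))⁻¹ * A j) *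
      (T j).indicator (fun z => ENNReal.ofReal ‖z.2‖⁻¹ * g z) z := by
    intro z hz
    have h2 : ∀ w ∈ triangle, ‖kernel z w‖ₑ * ‖f w‖ₑ * g z ≤
        ∑' j, (C * (uMeasure (T j))⁻¹ *
          (T j).indicator (fun z => ENNReal.ofReal ‖z.2‖⁻¹ * g z) z) *
          (T j).indicator (fun w => ENNReal.ofReal ‖w.2‖⁻¹ * ‖f w‖ₑ) w := by
      intro w hw
      obtain ⟨x, i, hzi, hwi, hk⟩ := hC z hz w hw
      refine le_trans ?_ (ENNReal.le_tsum (x, i))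
      rw [indicator_of_mem (show z ∈ T (x, i) from hzi),
        indicator_of_mem (show w ∈ T (x, i) from hwi)]
      calc _ ≤ (C * ENNReal.ofReal ‖z.2‖⁻¹ * ENNReal.ofReal ‖w.2‖⁻¹ *
            (uMeasure (tent x.1 x.2 i))⁻¹) * ‖f w‖ₑ * g z := by gcongr
        _ = _ := by ring
    have hk : Measurable fun w => ‖kernel z w‖ₑ := by
      have : Measurable fun w => kernel z w := by unfold kernel; fun_prop
      exact this.enorm
    have hkf : AEMeasurable (fun w => ‖kernel z w‖ₑ * ‖f w‖ₑ) (volume.restrict triangle) :=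
      hk.aemeasurable.mul hf.enorm
    rw [absProj, ← lintegral_mul_const'' _ hkf]
    refine (setLIntegral_mono_ae' measurableSet_triangle (ae_of_all _ h2)).trans (le_of_eq ?_)
    rw [lintegral_tsum fun j => (hbf.indicator (hT j)).const_mul _]
    refine tsum_congr fun j => ?_
    rw [lintegral_const_mul'' _ (hbf.indicator (hT j)), lintegral_indicator (hT j)]
    exact mul_right_comm _ _ _
  refine (setLIntegral_mono_ae' measurableSet_triangle (ae_of_all _ h1)).trans (le_of_eq ?_)
  rw [lintegral_tsum fun j => (hbg.indicator (hT j)).const_mul _, ← ENNReal.tsum_prod,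
    ← ENNReal.tsum_mul_left]
  refine tsum_congr fun j => ?_
  rw [lintegral_const_mul'' _ (hbg.indicator (hT j)), lintegral_indicator (hT j)]
  simp only [A, T, mul_assoc]

/-! ### The weighted estimate -/

theorem enorm_ofReal_of_nonneg {r : ℝ} (hr : 0 ≤ r) : ‖(r : ℂ)‖ₑ = ENNReal.ofReal r := by
  rw [← ofReal_norm, Complex.norm_of_nonneg hr]

theorem setLIntegral_div_le_maximal (m n : ℝ) (ρ : ℂ × ℂ → ℝ) (F : ℂ × ℂ → ℂ) (i : Index × Index)
    {x : ℂ × ℂ} (hx : x ∈ tentCore m n i) :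
    (∫⁻ w in tent m n i, ‖F w‖ₑ ∂(weightMeasure ρ)) / weightMeasure ρ (tent m n i) ≤
      maximal m n ρ F x := by
  rw [← setLAverage_eq, maximal]
  refine le_iSup₂_of_le i.1 i.2 ?_
  rw [indicator_of_mem (show x ∈ induced _ _ from tentCore_subset_tent m n i hx)]
  rfl

/-- The density of `|w₂|⁻¹ |f| dV` with respect to `ν dV`. -/
def dualDensity (p : ℝ) (μ : ℂ × ℂ → ℝ) (f : ℂ × ℂ → ℂ) (w : ℂ × ℂ) : ℂ :=
  ((‖w.2‖⁻¹ * ‖f w‖ / dualWeight p μ w : ℝ) : ℂ)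

/-- The density of `|w₂|⁻¹ γ μ dV` with respect to `|w₂|⁻ᵖ μ dV`. -/
def companionDensity (p : ℝ) (γ : ℂ × ℂ → ℝ≥0) (w : ℂ × ℂ) : ℂ :=
  ((‖w.2‖ ^ (p - 1) * γ w : ℝ) : ℂ)

section Weights

variable {p : ℝ} {μ : ℂ × ℂ → ℝ}

theorem lintegral_dualDensity_rpow (hp : 1 < p) (hm : AEMeasurable μ (volume.restrict triangle))
    (hpos : ∀ z ∈ triangle, 0 < μ z) (f : ℂ × ℂ → ℂ) :
    ∫⁻ w, ‖dualDensity p μ f w‖ₑ ^ p ∂(weightMeasure (dualWeight p μ)) =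
      ∫⁻ w, ‖f w‖ₑ ^ p ∂(weightMeasure μ) := by
  have hp0 : 0 ≤ p := by linarith
  rw [lintegral_weightMeasure (aemeasurable_dualWeight p hm), lintegral_weightMeasure hm]
  refine setLIntegral_congr_fun measurableSet_triangle fun w hw => ?_
  have hν := dualWeight_pos (p := p) hw (hpos w hw)
  have h0 : 0 ≤ ‖w.2‖⁻¹ * ‖f w‖ / dualWeight p μ w := by positivity
  simp only [dualDensity]
  rw [enorm_ofReal_of_nonneg h0, ENNReal.ofReal_rpow_of_nonneg h0 hp0, ← ENNReal.ofReal_mul hν.le,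
    dualWeight_mul_rpow hp hw (hpos w hw) (norm_nonneg _), ENNReal.ofReal_mul (hpos w hw).le,
    ← ENNReal.ofReal_rpow_of_nonneg (norm_nonneg _) hp0, ofReal_norm]

theorem setLIntegral_dualDensity (hm : AEMeasurable μ (volume.restrict triangle))
    (hpos : ∀ z ∈ triangle, 0 < μ z) (f : ℂ × ℂ → ℂ) {s : Set (ℂ × ℂ)} (hs : MeasurableSet s) :
    ∫⁻ w in s, ‖dualDensity p μ f w‖ₑ ∂(weightMeasure (dualWeight p μ)) =
      ∫⁻ w in s, ENNReal.ofReal ‖w.2‖⁻¹ * ‖f w‖ₑ ∂(volume.restrict triangle) := by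
  rw [setLIntegral_weightMeasure (aemeasurable_dualWeight p hm) hs]
  refine lintegral_congr_ae ?_
  filter_upwards [ae_restrict_of_ae (ae_restrict_mem measurableSet_triangle)] with w hw
  have hν := dualWeight_pos (p := p) hw (hpos w hw)
  rw [dualDensity, enorm_ofReal_of_nonneg (by positivity), ← ENNReal.ofReal_mul hν.le,
    mul_div_cancel₀ _ hν.ne', ENNReal.ofReal_mul (by positivity), ofReal_norm]

/-- Since ν^{1-p} = |w₂|ᵖ μ, dividing |w₂|⁻¹ |f| by ν preserves the norm from Lᵖ(μ) to Lᵖ(ν). -/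
theorem memLp_dualDensity (hp : 1 < p) (hm : AEMeasurable μ (volume.restrict triangle))
    (hpos : ∀ z ∈ triangle, 0 < μ z) {f : ℂ × ℂ → ℂ}
    (hf : MemLp f (ENNReal.ofReal p) (weightMeasure μ)) :
    MemLp (dualDensity p μ f) (ENNReal.ofReal p) (weightMeasure (dualWeight p μ)) ∧
      eLpNorm (dualDensity p μ f) (ENNReal.ofReal p) (weightMeasure (dualWeight p μ)) =
        eLpNorm f (ENNReal.ofReal p) (weightMeasure μ) := by
  have hp0 : 0 < p := by linarith
  have hE : eLpNorm (dualDensity p μ f) (ENNReal.ofReal p) (weightMeasure (dualWeight p μ)) =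
      eLpNorm f (ENNReal.ofReal p) (weightMeasure μ) := by
    rw [eLpNorm_ofReal _ _ hp0, eLpNorm_ofReal _ _ hp0, lintegral_dualDensity_rpow hp hm hpos]
  refine ⟨⟨AEMeasurable.aestronglyMeasurable ?_, hE ▸ hf.2⟩, hE⟩
  have hf' := (hf.1.mono_ac (absolutelyContinuous_weightMeasure hm hpos)).norm.aemeasurable
  have hb : Measurable fun w : ℂ × ℂ => ‖w.2‖⁻¹ := by fun_prop
  exact (Complex.measurable_ofReal.comp_aemeasurable ((hb.aemeasurable.mul hf').div
    (aemeasurable_dualWeight p hm))).mono_ac (weightMeasure_absolutelyContinuous _)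

theorem lintegral_companionDensity_rpow (hp : 1 < p)
    (hm : AEMeasurable μ (volume.restrict triangle)) (γ : ℂ × ℂ → ℝ≥0)
    (hpos : ∀ z ∈ triangle, 0 < μ z) :
    ∫⁻ w, ‖companionDensity p γ w‖ₑ ^ p.conjExponent ∂(weightMeasure (companionWeight p μ)) =
      ∫⁻ w, (γ w : ℝ≥0∞) ^ p.conjExponent ∂(weightMeasure μ) := by
  have hq0 := (Real.HolderConjugate.conjExponent hp).symm.nonneg
  rw [lintegral_weightMeasure (aemeasurable_companionWeight p hm), lintegral_weightMeasure hm]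
  refine setLIntegral_congr_fun measurableSet_triangle fun w hw => ?_
  have h0 : 0 ≤ ‖w.2‖ ^ (p - 1) * (γ w : ℝ) := by positivity
  simp only [companionDensity]
  rw [enorm_ofReal_of_nonneg h0, ENNReal.ofReal_rpow_of_nonneg h0 hq0,
    ← ENNReal.ofReal_mul (companionWeight_pos hw (hpos w hw)).le,
    companionWeight_mul_rpow hp hw (γ w).coe_nonneg, ENNReal.ofReal_mul (hpos w hw).le,
    ← ENNReal.ofReal_rpow_of_nonneg (γ w).coe_nonneg hq0, ENNReal.ofReal_coe_nnreal]

theorem setLIntegral_companionDensity (hm : AEMeasurable μ (volume.restrict triangle))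
    (hpos : ∀ z ∈ triangle, 0 < μ z) (γ : ℂ × ℂ → ℝ≥0) {s : Set (ℂ × ℂ)} (hs : MeasurableSet s) :
    ∫⁻ w in s, ‖companionDensity p γ w‖ₑ ∂(weightMeasure (companionWeight p μ)) =
      ∫⁻ w in s, ENNReal.ofReal ‖w.2‖⁻¹ * (ENNReal.ofReal (μ w) * γ w)
        ∂(volume.restrict triangle) := by
  rw [setLIntegral_weightMeasure (aemeasurable_companionWeight p hm) hs]
  refine lintegral_congr_ae ?_
  filter_upwards [ae_restrict_of_ae (ae_restrict_mem measurableSet_triangle)] with w hw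
  rw [companionDensity, enorm_ofReal_of_nonneg (by positivity),
    ← ENNReal.ofReal_mul (companionWeight_pos hw (hpos w hw)).le, companionWeight_mul hw,
    ENNReal.ofReal_mul (by positivity), ENNReal.ofReal_mul (hpos w hw).le,
    ENNReal.ofReal_coe_nnreal]

/-- The norm is preserved because (p - 1) p' = p, so the power of |w₂| cancels the |w₂|⁻ᵖ of the
companion weight. -/
theorem memLp_companionDensity (hp : 1 < p) (hm : AEMeasurable μ (volume.restrict triangle))
    (hpos : ∀ z ∈ triangle, 0 < μ z) {γ : ℂ × ℂ → ℝ≥0} (hγ : AEMeasurable γ (weightMeasure μ))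
    (hγq : ∫⁻ w, (γ w : ℝ≥0∞) ^ p.conjExponent ∂(weightMeasure μ) < ∞) :
    MemLp (companionDensity p γ) (ENNReal.ofReal p.conjExponent)
        (weightMeasure (companionWeight p μ)) ∧
      eLpNorm (companionDensity p γ) (ENNReal.ofReal p.conjExponent)
        (weightMeasure (companionWeight p μ)) =
        (∫⁻ w, (γ w : ℝ≥0∞) ^ p.conjExponent ∂(weightMeasure μ)) ^ (1 / p.conjExponent) := by
  have hq0 := (Real.HolderConjugate.conjExponent hp).symm.pos
  have hE := eLpNorm_ofReal (companionDensity p γ) (weightMeasure (companionWeight p μ)) hq0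
  rw [lintegral_companionDensity_rpow hp hm γ hpos] at hE
  refine ⟨⟨AEMeasurable.aestronglyMeasurable ?_, ?_⟩, hE⟩
  · have hγ' := (hγ.mono_ac (absolutelyContinuous_weightMeasure hm hpos)).coe_nnreal_real
    have hb : Measurable fun w : ℂ × ℂ => ‖w.2‖ ^ (p - 1) := by fun_prop
    exact (Complex.measurable_ofReal.comp_aemeasurable (hb.aemeasurable.mul hγ')).mono_ac
      (weightMeasure_absolutelyContinuous _)
  · rw [hE]
    exact ENNReal.rpow_lt_top_of_nonneg (one_div_pos.2 hq0).le hγq.ne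

/-- The sparse estimate with the dyadic maximal functions as majorants: on a kube product they
dominate the average over the corresponding tent. -/
theorem tsum_tent_le (hp : 1 < p) (hm : AEMeasurable μ (volume.restrict triangle))
    (hpos : ∀ z ∈ triangle, 0 < μ z) (hchar : characteristic p μ (dualWeight p μ) < ∞) {m n : ℝ}
    (hN : operatorNorm p (weightMeasure (dualWeight p μ)) (maximal m n (dualWeight p μ)) < ∞)
    (hS : operatorNorm p.conjExponent (weightMeasure (companionWeight p μ))
      (maximal m n (companionWeight p μ)) < ∞) {F G : ℂ × ℂ → ℂ}
    (hF : MemLp F (ENNReal.ofReal p) (weightMeasure (dualWeight p μ)))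
    (hG : MemLp G (ENNReal.ofReal p.conjExponent) (weightMeasure (companionWeight p μ))) :
    ∑' i, (uMeasure (tent m n i))⁻¹ *
      (∫⁻ w in tent m n i, ‖F w‖ₑ ∂(weightMeasure (dualWeight p μ))) *
      (∫⁻ w in tent m n i, ‖G w‖ₑ ∂(weightMeasure (companionWeight p μ))) ≤
    (9216 ^ 2) ^ (max p p.conjExponent - 1) *
      ((9216 ^ 2) ^ p * characteristic p μ (dualWeight p μ)) ^ max 1 (1 / (p - 1)) *
      ((operatorNorm p (weightMeasure (dualWeight p μ)) (maximal m n (dualWeight p μ)) *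
          eLpNorm F (ENNReal.ofReal p) (weightMeasure (dualWeight p μ))) *
        (operatorNorm p.conjExponent (weightMeasure (companionWeight p μ))
          (maximal m n (companionWeight p μ)) *
          eLpNorm G (ENNReal.ofReal p.conjExponent) (weightMeasure (companionWeight p μ)))) := by
  have hpq := Real.HolderConjugate.conjExponent hp
  have h1 := eLpNorm_le_operatorNorm hN hF
  have h2 := eLpNorm_le_operatorNorm hS hG
  rw [eLpNorm_ofReal (maximal m n _ F) _ hpq.pos] at h1
  rw [eLpNorm_ofReal (maximal m n _ G) _ hpq.symm.pos] at h2
  simp only [enorm_eq_self] at h1 h2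
  refine ((sparseFamily_tent hp hm hpos hchar m n).tsum_le hpq (by finiteness)
    (ENNReal.mul_ne_top (ENNReal.rpow_ne_top_of_nonneg hpq.nonneg (by finiteness)) hchar.ne)
    (tent_characteristic_le hp m n)
    (fun i x hx => setLIntegral_div_le_maximal m n _ F i hx)
    (fun i x hx => setLIntegral_div_le_maximal m n _ G i hx)).trans ?_
  gcongr

/-- The part of the constant in the weighted estimate that depends only on the exponent. -/
def exponentConstant (p : ℝ) : ℝ≥0 :=
  (9216 ^ 2) ^ (max p p.conjExponent - 1) * ((9216 ^ 2) ^ p) ^ max 1 (1 / (p - 1))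

theorem coe_exponentConstant_mul (hp : 1 < p) (Q : ℝ≥0∞) :
    (9216 ^ 2) ^ (max p p.conjExponent - 1) * ((9216 ^ 2) ^ p * Q) ^ max 1 (1 / (p - 1)) =
      (exponentConstant p : ℝ≥0∞) * Q ^ max 1 (1 / (p - 1)) := by
  have h1 : (0 : ℝ) ≤ max 1 (1 / (p - 1)) := le_max_of_le_left zero_le_one
  have h2 : 0 ≤ max p p.conjExponent - 1 := sub_nonneg.2 (le_max_of_le_left hp.le)
  rw [ENNReal.mul_rpow_of_nonneg _ _ h1, ← mul_assoc, exponentConstant, ENNReal.coe_mul,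
    ENNReal.coe_rpow_of_nonneg _ h2, ENNReal.coe_rpow_of_nonneg _ h1,
    ENNReal.coe_rpow_of_nonneg _ (by linarith)]
  norm_num

theorem aemeasurable_absProj {f : ℂ × ℂ → ℂ}
    (hf : AEStronglyMeasurable f (volume.restrict triangle)) :
    AEMeasurable (absProj f) (volume.restrict triangle) := by
  have h : AEMeasurable (fun q : (ℂ × ℂ) × (ℂ × ℂ) => ‖kernel q.1 q.2‖ₑ * ‖f q.2‖ₑ)
      ((volume.restrict triangle).prod (volume.restrict triangle)) :=
    measurable_kernel.enorm.aemeasurable.mul (hf.comp_snd (μ := volume.restrict triangle)).enorm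
  exact h.lintegral_prod_right'

theorem isFiniteMeasure_weightMeasure (hp : 1 < p)
    (hm : AEMeasurable μ (volume.restrict triangle)) (hpos : ∀ z ∈ triangle, 0 < μ z)
    (hchar : characteristic p μ (dualWeight p μ) < ∞) : IsFiniteMeasure (weightMeasure μ) := by
  refine ⟨lt_of_le_of_lt ?_ (weightMeasure_univ_lt_top hp hm hpos hchar).2⟩
  rw [weightMeasure_apply _ MeasurableSet.univ, weightMeasure_apply _ MeasurableSet.univ,
    Measure.restrict_univ]
  exact setLIntegral_mono_ae' measurableSet_triangle (ae_of_all _ fun z hz =>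
    ENNReal.ofReal_le_ofReal (le_companionWeight (by linarith) hz (hpos z hz)))

/-- Duality reduces the norm to a pairing with γ μ, which is dominated by one sparse form for each
pair of trees; their number gives the factor |L|². -/
theorem lintegral_absProj_rpow_le {L : Finset ℝ} {C : ℝ≥0}
    (hC : ∀ z ∈ triangle, ∀ w ∈ triangle, ∃ x : L × L, ∃ i : Index × Index,
      z ∈ tent x.1 x.2 i ∧ w ∈ tent x.1 x.2 i ∧
      ‖kernel z w‖ₑ ≤ C * ENNReal.ofReal ‖z.2‖⁻¹ * ENNReal.ofReal ‖w.2‖⁻¹ *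
        (uMeasure (tent x.1 x.2 i))⁻¹)
    (hp : 1 < p) (hm : AEMeasurable μ (volume.restrict triangle))
    (hpos : ∀ z ∈ triangle, 0 < μ z) (hchar : characteristic p μ (dualWeight p μ) < ∞)
    (hN : ∀ m ∈ L, ∀ n ∈ L,
      operatorNorm p (weightMeasure (dualWeight p μ)) (maximal m n (dualWeight p μ)) < ∞)
    (hS : ∀ m ∈ L, ∀ n ∈ L, operatorNorm p.conjExponent (weightMeasure (companionWeight p μ))
      (maximal m n (companionWeight p μ)) < ∞)
    {f : ℂ × ℂ → ℂ} (hf : MemLp f (ENNReal.ofReal p) (weightMeasure μ)) :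
    (∫⁻ z, absProj f z ^ p ∂(weightMeasure μ)) ^ (1 / p) ≤
      ((C * L.card ^ 2 * exponentConstant p : ℝ≥0) : ℝ≥0∞) * (⨆ m ∈ L, ⨆ n ∈ L,
        operatorNorm p (weightMeasure (dualWeight p μ)) (maximal m n (dualWeight p μ)) *
        operatorNorm p.conjExponent (weightMeasure (companionWeight p μ))
          (maximal m n (companionWeight p μ))) *
      characteristic p μ (dualWeight p μ) ^ max 1 (1 / (p - 1)) *
      eLpNorm f (ENNReal.ofReal p) (weightMeasure μ) := by
  have hpq := Real.HolderConjugate.conjExponent hp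
  have := isFiniteMeasure_weightMeasure hp hm hpos hchar
  have hac := absolutelyContinuous_weightMeasure hm hpos
  have hf' := hf.1.mono_ac hac
  obtain ⟨hF, hFn⟩ := memLp_dualDensity hp hm hpos hf
  set R := ⨆ m ∈ L, ⨆ n ∈ L,
    operatorNorm p (weightMeasure (dualWeight p μ)) (maximal m n (dualWeight p μ)) *
    operatorNorm p.conjExponent (weightMeasure (companionWeight p μ))
      (maximal m n (companionWeight p μ)) with hR
  set Q := characteristic p μ (dualWeight p μ) ^ max 1 (1 / (p - 1)) with hQ
  set a := eLpNorm f (ENNReal.ofReal p) (weightMeasure μ)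
  refine lintegral_rpow_le_of_dual ((aemeasurable_absProj hf').mono_ac
    (weightMeasure_absolutelyContinuous _)) hpq fun γ hγ hγq => ?_
  obtain ⟨hG, hGn⟩ := memLp_companionDensity hp hm hpos hγ hγq
  set b := (∫⁻ w, (γ w : ℝ≥0∞) ^ p.conjExponent ∂(weightMeasure μ)) ^ (1 / p.conjExponent)
  have hg : AEMeasurable (fun z => ENNReal.ofReal (μ z) * γ z) (volume.restrict triangle) :=
    hm.ennreal_ofReal.mul (hγ.mono_ac hac).coe_nnreal_ennreal
  have hterm : ∀ x : L × L, ∑' i, (uMeasure (tent x.1 x.2 i))⁻¹ *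
      (∫⁻ w in tent x.1 x.2 i, ENNReal.ofReal ‖w.2‖⁻¹ * ‖f w‖ₑ ∂(volume.restrict triangle)) *
      (∫⁻ z in tent x.1 x.2 i, ENNReal.ofReal ‖z.2‖⁻¹ * (ENNReal.ofReal (μ z) * γ z)
        ∂(volume.restrict triangle)) ≤ exponentConstant p * Q * (R * (a * b)) := by
    rintro ⟨⟨m, hmL⟩, ⟨n, hnL⟩⟩
    have h := tsum_tent_le hp hm hpos hchar (hN m hmL n hnL) (hS m hmL n hnL) hF hG
    simp only [setLIntegral_dualDensity hm hpos f (measurableSet_tent m n _),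
      setLIntegral_companionDensity hm hpos γ (measurableSet_tent m n _), hFn, hGn] at h
    refine h.trans ?_
    rw [coe_exponentConstant_mul hp, mul_mul_mul_comm _ a _ b]
    gcongr
    rw [hR]
    refine le_iSup₂_of_le m hmL ?_
    exact le_iSup₂_of_le n hnL le_rfl
  calc ∫⁻ z, absProj f z * γ z ∂(weightMeasure μ)
      = ∫⁻ z in triangle, absProj f z * (ENNReal.ofReal (μ z) * γ z) := by
        rw [lintegral_weightMeasure hm]
        exact lintegral_congr fun z => mul_left_comm _ _ _
    _ ≤ C * ∑' _ : L × L, exponentConstant p * Q * (R * (a * b)) :=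
        (lintegral_absProj_mul_le hC hf' hg).trans
          (mul_le_mul_right (ENNReal.tsum_le_tsum hterm) _)
    _ = _ := by
        rw [tsum_fintype, Finset.sum_const, Finset.card_univ, Fintype.card_prod, Fintype.card_coe,
          nsmul_eq_mul]
        push_cast
        ring

/-- This integral is that of the dual density against ν dV, a finite measure, on which Lᵖ is
contained in L¹. -/
theorem lintegral_inv_norm_mul_lt_top (hp : 1 < p)
    (hm : AEMeasurable μ (volume.restrict triangle)) (hpos : ∀ z ∈ triangle, 0 < μ z)
    (hchar : characteristic p μ (dualWeight p μ) < ∞) {f : ℂ × ℂ → ℂ}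
    (hf : MemLp f (ENNReal.ofReal p) (weightMeasure μ)) :
    ∫⁻ w in triangle, ENNReal.ofReal ‖w.2‖⁻¹ * ‖f w‖ₑ < ∞ := by
  have : IsFiniteMeasure (weightMeasure (dualWeight p μ)) :=
    ⟨(weightMeasure_univ_lt_top hp hm hpos hchar).1⟩
  have h := (memLp_dualDensity hp hm hpos hf).1.integrable (ENNReal.one_le_ofReal.2 hp.le)
  have h2 := setLIntegral_dualDensity (p := p) hm hpos f MeasurableSet.univ
  rw [Measure.restrict_univ, Measure.restrict_univ] at h2
  rw [← h2]
  exact h.2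

theorem integrableOn_kernel_mul (hp : 1 < p) (hm : AEMeasurable μ (volume.restrict triangle))
    (hpos : ∀ z ∈ triangle, 0 < μ z) (hchar : characteristic p μ (dualWeight p μ) < ∞)
    {f : ℂ × ℂ → ℂ} (hf : MemLp f (ENNReal.ofReal p) (weightMeasure μ)) {z : ℂ × ℂ}
    (hz : z ∈ triangle) : IntegrableOn (fun w => kernel z w * f w) triangle := by
  have hf' := hf.1.mono_ac (absolutelyContinuous_weightMeasure hm hpos)
  have hk : Measurable fun w => kernel z w := by unfold kernel; fun_prop
  have hb : Measurable fun w : ℂ × ℂ => ENNReal.ofReal ‖w.2‖⁻¹ := by fun_prop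
  have hbf : AEMeasurable (fun w : ℂ × ℂ => ENNReal.ofReal ‖w.2‖⁻¹ * ‖f w‖ₑ)
      (volume.restrict triangle) := hb.aemeasurable.mul hf'.enorm
  have hle : ∀ w ∈ triangle, ‖kernel z w * f w‖ₑ ≤
      ENNReal.ofReal (kernelBound z) * (ENNReal.ofReal ‖w.2‖⁻¹ * ‖f w‖ₑ) := fun w hw => by
    rw [enorm_mul, ← mul_assoc, ← ENNReal.ofReal_mul' (by positivity)]
    gcongr
    rw [← ofReal_norm]
    exact ENNReal.ofReal_le_ofReal (norm_kernel_le hz hw)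
  refine ⟨hk.aestronglyMeasurable.mul hf', ?_⟩
  rw [hasFiniteIntegral_iff_enorm]
  refine (setLIntegral_mono_ae' measurableSet_triangle (ae_of_all _ hle)).trans_lt ?_
  rw [lintegral_const_mul'' _ hbf]
  exact ENNReal.mul_lt_top ENNReal.ofReal_lt_top
    (lintegral_inv_norm_mul_lt_top hp hm hpos hchar hf)

end Weights

/-! ### From the dominating positive operator to P and P⁺. -/

theorem enorm_proj_le (f : ℂ × ℂ → ℂ) (z : ℂ × ℂ) : ‖proj f z‖ₑ ≤ absProj f z :=
  (enorm_integral_le_lintegral_enorm _).trans_eq (lintegral_congr fun _ => enorm_mul _ _)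

theorem enorm_projPlus_le (f : ℂ × ℂ → ℂ) (z : ℂ × ℂ) : ‖projPlus f z‖ₑ ≤ absProj f z := by
  refine (enorm_integral_le_lintegral_enorm _).trans_eq (lintegral_congr fun w => ?_)
  rw [enorm_mul, ← ofReal_norm, Complex.norm_real, norm_norm, ofReal_norm]

theorem aestronglyMeasurable_proj {f : ℂ × ℂ → ℂ}
    (hf : AEStronglyMeasurable f (volume.restrict triangle)) :
    AEStronglyMeasurable (proj f) (volume.restrict triangle) := by
  have h : AEStronglyMeasurable (fun q : (ℂ × ℂ) × (ℂ × ℂ) => kernel q.1 q.2 * f q.2)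
      ((volume.restrict triangle).prod (volume.restrict triangle)) :=
    measurable_kernel.aestronglyMeasurable.mul (hf.comp_snd (μ := volume.restrict triangle))
  exact h.integral_prod_right'

theorem aestronglyMeasurable_projPlus {f : ℂ × ℂ → ℂ}
    (hf : AEStronglyMeasurable f (volume.restrict triangle)) :
    AEStronglyMeasurable (projPlus f) (volume.restrict triangle) := by
  have h : AEStronglyMeasurable
      (fun q : (ℂ × ℂ) × (ℂ × ℂ) => (‖kernel q.1 q.2‖ : ℂ) * f q.2)
      ((volume.restrict triangle).prod (volume.restrict triangle)) :=
    (Complex.measurable_ofReal.comp measurable_kernel.norm).aestronglyMeasurable.mul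
      (hf.comp_snd (μ := volume.restrict triangle))
  exact h.integral_prod_right'

/-- No integrability is needed: the two integrands have the same absolute value, so if one integral
takes the default value 0, so does the other. -/
theorem norm_proj_le (f : ℂ × ℂ → ℂ) (z : ℂ × ℂ) :
    ‖proj f z‖ ≤ ‖projPlus (fun w => (‖f w‖ : ℂ)) z‖ := by
  have h : projPlus (fun w => (‖f w‖ : ℂ)) z = 
      ((∫ w in triangle, ‖kernel z w‖ * ‖f w‖ : ℝ) : ℂ) := by
    rw [projPlus, ← integral_complex_ofReal]
    simp only [Complex.ofReal_mul]
  rw [h, Complex.norm_of_nonneg (integral_nonneg fun _ => by positivity)]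
  refine (norm_integral_le_integral_norm _).trans_eq ?_
  simp only [norm_mul]

/-- Any constant admissible for P⁺ is admissible for P: replacing f by |f| keeps its norm. -/
theorem operatorNorm_proj_le (p : ℝ) (ω : Measure (ℂ × ℂ)) :
    operatorNorm p ω proj ≤ operatorNorm p ω projPlus := by
  refine sInf_le_sInf fun C hC f hf => ?_
  have h1 : eLpNorm (fun w => (‖f w‖ : ℂ)) (ENNReal.ofReal p) ω =
      eLpNorm f (ENNReal.ofReal p) ω := eLpNorm_congr_norm_ae (ae_of_all _ fun w => by simp)
  have h2 : MemLp (fun w => (‖f w‖ : ℂ)) (ENNReal.ofReal p) ω := hf.norm.ofReal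
  calc _ ≤ eLpNorm (projPlus fun w => (‖f w‖ : ℂ)) (ENNReal.ofReal p) ω :=
        eLpNorm_mono_ae (ae_of_all _ fun z => norm_proj_le f z)
    _ ≤ _ := h1 ▸ hC _ h2

theorem isBoundedOnLp_of_enorm_le {p : ℝ} (hp : 0 < p) {ω : Measure (ℂ × ℂ)}
    {T : (ℂ × ℂ → ℂ) → (ℂ × ℂ → ℂ)} {B : ℝ≥0∞} (hB : B < ∞)
    (hT : ∀ f, MemLp f (ENNReal.ofReal p) ω → AEStronglyMeasurable (T f) ω)
    (hle : ∀ f z, ‖T f z‖ₑ ≤ absProj f z)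
    (h : ∀ f, MemLp f (ENNReal.ofReal p) ω →
      (∫⁻ z, absProj f z ^ p ∂ω) ^ (1 / p) ≤ B * eLpNorm f (ENNReal.ofReal p) ω) :
    IsBoundedOnLp p ω T ∧ operatorNorm p ω T ≤ B := by
  have hb : ∀ f, MemLp f (ENNReal.ofReal p) ω →
      eLpNorm (T f) (ENNReal.ofReal p) ω ≤ B * eLpNorm f (ENNReal.ofReal p) ω := fun f hf => by
    refine le_trans ?_ (h f hf)
    rw [eLpNorm_ofReal _ _ hp]
    gcongr
    exact hle f _
  have hn : operatorNorm p ω T ≤ B := sInf_le hb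
  exact ⟨⟨fun f hf => ⟨hT f hf, (hb f hf).trans_lt (ENNReal.mul_lt_top hB hf.2)⟩,
    hn.trans_lt hB⟩, hn⟩

end Hartogs

end

/-! ### Assembly of the result. -/

theorem corollary5p2 :
    -- the explicit kernel is the Bergman kernel of the Hartogs triangle
    Hartogs.IsBergmanKernel Hartogs.triangle Hartogs.kernel ∧
    -- admissible finite collections of Bergman trees exist
    (∃ L : Finset ℝ, Hartogs.IsAdmissible L) ∧
    -- the estimate, for every admissible collection
    ∀ L : Finset ℝ, Hartogs.IsAdmissible L → ∀ p : ℝ, 1 < p → ∃ C : ℝ≥0,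
      ∀ μ ν ψ : ℂ × ℂ → ℝ,
        LocallyIntegrableOn μ Hartogs.triangle volume →
        (∀ z ∈ Hartogs.triangle, 0 < μ z) →
        ν = Hartogs.dualWeight p μ →
        ψ = (fun w => ‖w.2‖ ^ (-p) * μ w) →
        (∀ m ∈ L, ∀ n ∈ L,
          Hartogs.operatorNorm p (Hartogs.weightMeasure ν) (Hartogs.maximal m n ν) < ∞) →
        (∀ m ∈ L, ∀ n ∈ L,
          Hartogs.operatorNorm p.conjExponent (Hartogs.weightMeasure ψ)
            (Hartogs.maximal m n ψ) < ∞) →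
        Hartogs.characteristic p μ ν < ∞ →
        -- the defining integrals of `P f` and `P⁺ f` converge absolutely on the whole triangle
        (∀ f : ℂ × ℂ → ℂ, MemLp f (ENNReal.ofReal p) (Hartogs.weightMeasure μ) →
          ∀ z ∈ Hartogs.triangle,
            IntegrableOn (fun w => Hartogs.kernel z w * f w) Hartogs.triangle volume) ∧
        Hartogs.IsBoundedOnLp p (Hartogs.weightMeasure μ) Hartogs.proj ∧
        Hartogs.IsBoundedOnLp p (Hartogs.weightMeasure μ) Hartogs.projPlus ∧
        Hartogs.operatorNorm p (Hartogs.weightMeasure μ) Hartogs.proj ≤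
          Hartogs.operatorNorm p (Hartogs.weightMeasure μ) Hartogs.projPlus ∧
        Hartogs.operatorNorm p (Hartogs.weightMeasure μ) Hartogs.projPlus ≤
          C * (⨆ m ∈ L, ⨆ n ∈ L,
              Hartogs.operatorNorm p (Hartogs.weightMeasure ν) (Hartogs.maximal m n ν) *
              Hartogs.operatorNorm p.conjExponent (Hartogs.weightMeasure ψ)
                (Hartogs.maximal m n ψ)) *
            Hartogs.characteristic p μ ν ^ max 1 (1 / (p - 1)) := by
  refine ⟨Hartogs.isBergmanKernel_kernel, Hartogs.exists_isAdmissible, fun L hL p hp => ?_⟩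
  obtain ⟨C, hC⟩ := Hartogs.exists_tent_bound hL
  refine ⟨C * L.card ^ 2 * Hartogs.exponentConstant p, ?_⟩
  rintro μ _ _ hμ hpos rfl rfl hN hS hchar
  have hp0 : 0 < p := by linarith
  have hm : AEMeasurable μ (volume.restrict Hartogs.triangle) :=
    hμ.aestronglyMeasurable.aemeasurable
  have hac := Hartogs.weightMeasure_absolutelyContinuous μ
  have hac' := Hartogs.absolutelyContinuous_weightMeasure hm hpos
  have hest := fun f (hf : MemLp f (ENNReal.ofReal p) (Hartogs.weightMeasure μ)) =>
    Hartogs.lintegral_absProj_rpow_le hC hp hm hpos hchar hN hS hf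
  have hsup : (⨆ m ∈ L, ⨆ n ∈ L,
      Hartogs.operatorNorm p (Hartogs.weightMeasure (Hartogs.dualWeight p μ))
          (Hartogs.maximal m n (Hartogs.dualWeight p μ)) *
        Hartogs.operatorNorm p.conjExponent (Hartogs.weightMeasure (Hartogs.companionWeight p μ))
          (Hartogs.maximal m n (Hartogs.companionWeight p μ))) < ∞ := by
    -- Finiteness of each norm bounds the supremum because L is finite.
    simp_rw [← Finset.sup_eq_iSup]
    exact (Finset.sup_lt_iff ENNReal.zero_lt_top).2 fun m hmL =>
      (Finset.sup_lt_iff ENNReal.zero_lt_top).2 fun n hnL =>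
        ENNReal.mul_lt_top (hN m hmL n hnL) (hS m hmL n hnL)
  have hB := ENNReal.mul_lt_top (ENNReal.mul_lt_top
    (ENNReal.coe_lt_top (r := C * L.card ^ 2 * Hartogs.exponentConstant p)) hsup)
    (ENNReal.rpow_lt_top_of_nonneg (le_max_of_le_left zero_le_one : 0 ≤ max 1 (1 / (p - 1)))
      hchar.ne)
  have h1 := Hartogs.isBoundedOnLp_of_enorm_le hp0 hB
    (fun f hf => (Hartogs.aestronglyMeasurable_proj (hf.1.mono_ac hac')).mono_ac hac)
    Hartogs.enorm_proj_le hest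
  have h2 := Hartogs.isBoundedOnLp_of_enorm_le hp0 hB
    (fun f hf => (Hartogs.aestronglyMeasurable_projPlus (hf.1.mono_ac hac')).mono_ac hac)
    Hartogs.enorm_projPlus_le hest
  exact ⟨fun f hf z hz => Hartogs.integrableOn_kernel_mul hp hm hpos hchar hf hz, h1.1, h2.1,
    Hartogs.operatorNorm_proj_le _ _, h2.2⟩
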